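/- Let $F_1(p)=\tfrac18p^2(1-p^2)(5p^2-1)$, $F_2(p)=\tfrac18p^3(1-p^2)(12p^2-15p^4-1)$ and, for $s\ge2$, $$F_{s+1}(p)=\tfrac12p^2(1-p^2)F_s'(p)-\tfrac12\sum_{j=1}^{s-1}F_j(p)F_{s-j}(p),$$ and put $E_s(p)=-\int_0^p\frac{F_s(q)}{q^2(1-q^2)}\,dq$, $k_s=E_s(1)$ and $G_{n,s}=\sum_{k=s}^{n-1}F_kF_{s+n-k-1}$. Let $\Delta$ be the $z$-plane cut along the horizontal rays going to the left from $0$, $i$ and $-i$; it contains the closed right half-plane except for the points $0,\pm i$. On $\Delta$ let $(1+z^2)^{1/2}=(z-i)^{1/2}(z+i)^{1/2}$ and $(1+z^2)^{1/4}=(z-i)^{1/4}(z+i)^{1/4}$ with principal powers on the right (so they are the principal branches for $\mathrm{Re}\,z>0$), and $$p=(1+z^2)^{-1/2},\qquad \xi=(1+z^2)^{1/2}+\ln\frac{z}{1+(1+z^2)^{1/2}}.$$ A *progressive path* from $z=0$ (resp. from $z=+\infty$) to $z\in\Delta$ is a path in $\Delta$, ending at $z$ and starting at $0$ (resp. with $\mathrm{Re}\to+\infty$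 at its start), which is a finite chain of $C^2$ arcs with nonvanishing derivative, whose image under $z\mapsto q=(1+z^2)^{-1/2}$ is rectifiable, and along which $\mathrm{Re}\,\xi$ is nondecreasing (resp. nonincreasing). For a path $\mathcal L$ and $\nu>0$ let, with all integrals along the image of $\mathcal L$ in the $q$-plane, $$\omega_n(\nu,\mathcal L)=2\int\Big|\frac{F_n(q)\,dq}{q^2(1-q^2)}\Big|+\sum_{s=1}^{n-1}\frac1{\nu^s}\int\Big|\frac{G_{n,s}(q)\,dq}{q^2(1-q^2)}\Big|,\qquad \varpi_n(\nu,\mathcal L)=\sum_{s=0}^{n-2}\frac4{\nu^s}\int\Big|\frac{F_{s+1}(q)\,dq}{q^2(1-q^2)}\Big|.$$ Then: (1) For every $s\ge1$, $E_s$ is a polynomial with real coefficients, and $k_s$ is real. (2) Let $\nu>0$. There are functions $\eta_{n,1}(\nu,z)$, $\eta_{n,2}(\nu,z)$ such that for all $n\ge1$ and $z\in\Delta$ $$I_\nu(\nu z)=\frac{\nu^\nu}{e^\nu\Gamma(\nu+1)(1+z^2)^{1/4}}\exp\Big\{\nu\xi+\sum_{s=1}^{n-1}\frac{E_s(p)-k_s}{\nu^s}\Big\}\{1+\eta_{n,1}(\nu,z)\},$$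 $$K_\nu(\nu z)=\Big(\frac{\pi}{2\nu}\Big)^{1/2}\frac1{(1+z^2)^{1/4}}\exp\Big\{-\nu\xi+\sum_{s=1}^{n-1}(-1)^s\frac{E_s(p)}{\nu^s}\Big\}\{1+\eta_{n,2}(\nu,z)\},$$ and for every integer $r\ge0$, with $N=n+r$ and $\omega=\omega_N(\nu,\mathcal L)$, $\varpi=\varpi_N(\nu,\mathcal L)$, $$|\eta_{n,1}(\nu,z)|\le\Big|\exp\Big\{\sum_{s=n}^{n+r-1}\frac{E_s(p)-k_s}{\nu^s}\Big\}-1\Big|+\frac{\omega}{\nu^{N}}\exp\Big\{\frac{\varpi}{\nu}+\sum_{s=n}^{n+r-1}\frac{\mathrm{Re}\,E_s(p)-k_s}{\nu^s}+\frac{\omega}{\nu^{N}}\Big\}$$ for every progressive path $\mathcal L$ from $0$ to $z$, and $$|\eta_{n,2}(\nu,z)|\le\Big|\exp\Big\{\sum_{s=n}^{n+r-1}(-1)^s\frac{E_s(p)}{\nu^s}\Big\}-1\Big|+\frac{\omega}{\nu^{N}}\exp\Big\{\frac{\varpi}{\nu}+\sum_{s=n}^{n+r-1}(-1)^s\frac{\mathrm{Re}\,E_s(p)}{\nu^s}+\frac{\omega}{\nu^{N}}\Big\}$$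 for every progressive path $\mathcal L$ from $+\infty$ to $z$. (3) For every $\delta>0$ there are an unbounded domain (connected open set) $D_1$ containing all $z\ne0$ with $|\arg z|\le\frac12\pi$ whose distance from the two parts of the imaginary axis from $i$ to $i\infty$ and from $-i$ to $-i\infty$ is at least $\delta$, and for each $z\in D_1$ a progressive path $\mathcal L_z$ from $0$ to $z$, such that for all $N\ge1$ and $\nu_0>0$ the quantities $\omega_N(\nu,\mathcal L_z)$ and $\varpi_N(\nu,\mathcal L_z)$ are bounded uniformly in $z\in D_1$ and $\nu\ge\nu_0$. So the bound for $\eta_{n,1}$ holds uniformly on $D_1$. (4) For every $\delta>0$ there are an unbounded domain $D_2$ containing all $z\ne0$ with $|\arg z|\le\frac12\pi$ and $|z\mp i|\ge\delta$, and for each $z\in D_2$ a progressive path $\mathcal L_z$ from $+\infty$ to $z$, such that for all $N\ge1$ and $\nu_0>0$ the quantities $\omega_N(\nu,\mathcal L_z)$ and $\varpi_N(\nu,\mathcal L_z)$ are bounded uniformly in $z\in D_2$ and $\nu\ge\nu_0$. So the bound for $\eta_{n,2}$ holds uniformly on $D_2$. -/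

import Mathlib

namespace BesselLG

noncomputable section

/-- Modified Bessel function of the first kind `I_ν(w)` (principal branch),
`(w/2)^ν ∑ (w²/4)^k / (k! Γ(ν+k+1))`. -/
def besselI (ν : ℝ) (w : ℂ) : ℂ :=
  (w / 2) ^ (ν : ℂ) *
    ∑' k : ℕ, (w ^ 2 / 4) ^ k / ((k.factorial : ℂ) * Complex.Gamma ((ν : ℂ) + k + 1))

/-- Modified Bessel function of the second kind (Macdonald function) `K_ν(w)`, for `ν > -1/2` and
`|arg w| < π` (principal branch), by the classical integral
`(π/(2w))^{1/2} e^{-w} / Γ(ν+1/2) ∫_0^∞ e^{-t} t^{ν-1/2} (1 + t/(2w))^{ν-1/2} dt`,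
which converges on the whole slit plane. -/
def besselK (ν : ℝ) (w : ℂ) : ℂ :=
  ((Real.pi : ℂ) / (2 * w)) ^ (1 / 2 : ℂ) * Complex.exp (-w) / Complex.Gamma ((ν : ℂ) + 1 / 2) *
    ∫ t in Set.Ioi (0 : ℝ),
      ((Real.exp (-t) * t ^ (ν - 1 / 2) : ℝ) : ℂ) * (1 + (t : ℂ) / (2 * w)) ^ ((ν : ℂ) - 1 / 2)

/-- The `z`-plane with cuts running to the left from `0`, `i` and `-i`. It contains the closed
right half-plane except for the three points `0`, `i`, `-i`. -/
def cutPlane : Set ℂ := {z | ¬ (z.re ≤ 0 ∧ (z.im = 0 ∨ z.im = 1 ∨ z.im = -1))}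

/-- The branch of `(1+z²)^{1/2}` on `cutPlane`; it is the principal one for `Re z > 0`, and on the
imaginary axis it is the limit of the principal one from the right. -/
def sqrtBr (z : ℂ) : ℂ := (z - Complex.I) ^ (1 / 2 : ℂ) * (z + Complex.I) ^ (1 / 2 : ℂ)

/-- The corresponding branch of `(1+z²)^{1/4}`. -/
def fourthRootBr (z : ℂ) : ℂ := (z - Complex.I) ^ (1 / 4 : ℂ) * (z + Complex.I) ^ (1 / 4 : ℂ)

/-- `p = (1+z²)^{-1/2}`. -/
def pVar (z : ℂ) : ℂ := (sqrtBr z)⁻¹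

/-- `ξ = (1+z²)^{1/2} + ln (z / (1 + (1+z²)^{1/2}))`. -/
def xi (z : ℂ) : ℂ := sqrtBr z + Complex.log (z / (1 + sqrtBr z))

open Polynomial in
/-- The polynomials `F̃_s`, `s ≥ 1` (the value at `0` is not used). In the last clause the sum is
`∑_{j=1}^{s+1} F̃_j F̃_{s+2-j}`, with `j = i + 1`. -/
def Ftilde : ℕ → ℝ[X]
  | 0 => 0
  | 1 => C (1 / 8) * X ^ 2 * (1 - X ^ 2) * (5 * X ^ 2 - 1)
  | 2 => C (1 / 8) * X ^ 3 * (1 - X ^ 2) * (12 * X ^ 2 - 15 * X ^ 4 - 1)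
  | s + 3 => C (1 / 2) * X ^ 2 * (1 - X ^ 2) * derivative (Ftilde (s + 2))
      - C (1 / 2) * ∑ i : Fin (s + 1), Ftilde (i.1 + 1) * Ftilde (s + 1 - i.1)
  termination_by s => s
  decreasing_by all_goals omega

/-- `G̃_{n,s} = ∑_{k=s}^{n-1} F̃_k F̃_{s+n-k-1}` (`1 ≤ s ≤ n-1`). -/
def Gtilde (n s : ℕ) : Polynomial ℝ :=
  ∑ k ∈ Finset.Icc s (n - 1), Ftilde k * Ftilde (s + n - k - 1)

/-- `Q(q) / (q² (1-q²))`. -/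
def overWeight (Q : Polynomial ℝ) (q : ℂ) : ℂ :=
  Polynomial.aeval q Q / (q ^ 2 * (1 - q ^ 2))

/-- `Ẽ_s(p) = -∫_0^p F̃_s(q) / (q² (1-q²)) dq`, integrated along the segment `q = t p`. -/
def Etilde (s : ℕ) (p : ℂ) : ℂ :=
  -∫ t in (0 : ℝ)..1, overWeight (Ftilde s) ((t : ℂ) * p) * p

/-- The real constant `k_s = Ẽ_s(1)`. -/
def kConst (s : ℕ) : ℝ := (Etilde s 1).re

/-- `γ` is a path in the cut plane, parametrised by `(0,1]`, that ends at `z = γ 1`, is a finite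
chain of `R₂` arcs (twice continuously differentiable with nonvanishing derivative; the first arc
is open at the parameter `0`), and along which the integrals `∫ |dq|`, `q = (1+z²)^{-1/2}`,
converge. -/
structure IsArcChain (γ : ℝ → ℂ) (z : ℂ) : Prop where
  mem : ∀ t ∈ Set.Ioc (0 : ℝ) 1, γ t ∈ cutPlane
  endpoint : γ 1 = z
  arcs : ∃ (m : ℕ) (τ : ℕ → ℝ), τ 0 = 0 ∧ τ m = 1 ∧ (∀ i < m, τ i < τ (i + 1)) ∧
    ∀ i < m,
      ContDiffOn ℝ 2 γ (Set.Icc (τ i) (τ (i + 1)) ∩ Set.Ioi 0) ∧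
      ∀ t ∈ Set.Icc (τ i) (τ (i + 1)) ∩ Set.Ioi 0,
        derivWithin γ (Set.Icc (τ i) (τ (i + 1)) ∩ Set.Ioi 0) t ≠ 0
  rectifiable : MeasureTheory.IntegrableOn (deriv fun t => pVar (γ t)) (Set.Ioo 0 1)

/-- Progressive path from `z = 0` (`ξ = -∞`, `q = 1`) to `z`: `Re ξ` is nondecreasing. -/
structure IsProgressiveFromZero (γ : ℝ → ℂ) (z : ℂ) : Prop extends IsArcChain γ z where
  start : Filter.Tendsto γ (nhdsWithin 0 (Set.Ioi 0)) (nhds 0)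
  mono : MonotoneOn (fun t => (xi (γ t)).re) (Set.Ioc 0 1)

/-- Progressive path from `z = +∞` (`ξ = +∞`, `q = 0`) to `z`: `Re ξ` is nonincreasing. -/
structure IsProgressiveFromInfinity (γ : ℝ → ℂ) (z : ℂ) : Prop extends IsArcChain γ z where
  start : Filter.Tendsto (fun t => (γ t).re) (nhdsWithin 0 (Set.Ioi 0)) Filter.atTop
  anti : AntitoneOn (fun t => (xi (γ t)).re) (Set.Ioc 0 1)

/-- `∫ |Q(q) dq / (q² (1-q²))|` along the image `q = (1+z²)^{-1/2}` of the path `γ`. -/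
def absIntegral (γ : ℝ → ℂ) (Q : Polynomial ℝ) : ℝ :=
  ∫ t in Set.Ioo (0 : ℝ) 1, ‖overWeight Q (pVar (γ t))‖ * ‖deriv (fun u => pVar (γ u)) t‖

/-- `ω_n(ν, p) = 2 ∫ |F̃_n dq/(q²(1-q²))| + ∑_{s=1}^{n-1} ν^{-s} ∫ |G̃_{n,s} dq/(q²(1-q²))|`. -/
def omegaErr (n : ℕ) (ν : ℝ) (γ : ℝ → ℂ) : ℝ :=
  2 * absIntegral γ (Ftilde n) +
    ∑ s ∈ Finset.Icc 1 (n - 1), 1 / ν ^ s * absIntegral γ (Gtilde n s)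

/-- `ϖ_n(ν, p) = ∑_{s=0}^{n-2} 4 ν^{-s} ∫ |F̃_{s+1} dq/(q²(1-q²))|`. -/
def varpiErr (n : ℕ) (ν : ℝ) (γ : ℝ → ℂ) : ℝ :=
  ∑ s ∈ Finset.range (n - 1), 4 / ν ^ s * absIntegral γ (Ftilde (s + 1))

/-- The half-plane `|arg z| ≤ π/2` without the points at distance less than `δ` from the parts of
the imaginary axis from `i` to `i∞` and from `-i` to `-i∞`. -/
def halfPlaneI (δ : ℝ) : Set ℂ :=
  {z | 0 ≤ z.re ∧ z ≠ 0 ∧ ∀ y : ℝ, 1 ≤ |y| → δ ≤ ‖z - y * Complex.I‖}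

/-- The half-plane `|arg z| ≤ π/2` without the points at distance less than `δ` from `±i`. -/
def halfPlaneK (δ : ℝ) : Set ℂ :=
  {z | 0 ≤ z.re ∧ z ≠ 0 ∧ δ ≤ ‖z - Complex.I‖ ∧ δ ≤ ‖z + Complex.I‖}

end

end BesselLG

open BesselLG

namespace BesselLG

noncomputable section

/-! ### The coefficient polynomials -/

/-! In the variable `ξ` the function `W = (1+z²)^{1/4} B(z)`, with `B(z)` either `I_ν(νz)` or
`K_ν(νz)`, satisfies `W'' = (ν² + 2F₁(p)) W`, where `dp/dξ = -p²(1-p²)`. Write `W = const ·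
exp(Λ_N)(1+e)` with `Λ_N = μξ + ∑_{s<N} (E_s - κ_s)/μ^s`, `μ = ±ν`. Since `dE_s/dξ = F_s`, the
derivative of `Λ_N` is `v = μ + ∑ F_s/μ^s`, and `e'' = R(1+e) - 2ve'` with the Riccati residual `R =
μ² + 2F₁ - v² - v'`. The recurrence for the `F_s` cancels all orders of `R` above `μ^{1-N}`; what is
left is expressed by `F_N` and the `G_{N,s}` (`residual_eq`).

Along a progressive path put `x = σξ`, `σ = ±1`, `μ = σν`, so that `Re x` does not decrease, and let
`y = de/dx`. Both `2νe + y` and `exp(2νx) y` have derivatives free of the large coefficient `2ν`,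
apart from an exponential weight that monotonicity controls. Hence both `|y|` and `ν|e|` are bounded
by one increasing function, and Gronwall's inequality gives the bound (`norm_error_le`). The
integrals of `|R dξ|` and `|(v-μ) dξ|` are exactly those in `ω` and `ϖ`, because `dξ =
-dq/(q²(1-q²))` (`norm_error_le_of_path`, `norm_relError_le`).

The constants make `e` and `y` vanish at the start of the path. For `I_ν` the factor `z^ν` cancels
against `exp(-νξ)`, leaving a function holomorphic at `0` with value `1` there
(`tendsto_relError_besselI`). For `K_ν` Laplace's integral gives the limit as `Re z → +∞`
(`tendsto_relError_besselK`). The form of the bound with an extra `r` follows from `1 + η_n =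
exp(∑_{n≤s<n+r} a_s)(1 + η_{n+r})`, `a_s` being the terms of the exponent.

For uniformity it is enough to join each point of the domain to the start by two smooth arcs which
are progressive, stay at a fixed distance from `±i`, and have images of bounded length in the
`q`-plane. Away from `±i` one has `|dq| ≤ const · |dz|/(1+|z|²)`, so that an arctangent bounds the
length. The arcs are segments and horizontal half-lines; their monotonicity is a sign computation
for `Re(ξ'(z) d)`, `d` being the direction. -/

open Polynomial in
lemma Ftilde_succ (s : ℕ) (hs : 1 ≤ s) :
    Ftilde (s + 1) = C (1 / 2) * X ^ 2 * (1 - X ^ 2) * derivative (Ftilde s)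
      - C (1 / 2) * ∑ j ∈ Finset.Ico 1 s, Ftilde j * Ftilde (s - j) := by
  match s, hs with
  | 1, _ =>
    -- `F₂` is a separate clause of the definition, so here the recurrence, whose sum is empty, is a
    -- computation.
    have h2 : (C (1 / 2) : ℝ[X]) * 2 = 1 := by
      rw [show (2 : ℝ[X]) = C 2 by rfl, ← C_mul]; norm_num
    change Ftilde 2 = _
    simp only [Ftilde, Finset.Ico_self, Finset.sum_empty, derivative_mul, derivative_C,
      derivative_X_pow, derivative_sub, derivative_one, derivative_ofNat]
    have h2' : (C (2 : ℝ)) = (2 : ℝ[X]) := rfl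
    norm_num [h2']
    linear_combination (C (1 / 8) * X ^ 3 * (1 - X ^ 2) * (1 - 12 * X ^ 2 + 15 * X ^ 4)) * h2
  | s + 2, _ =>
    rw [Ftilde, Fin.sum_univ_eq_sum_range (fun i => Ftilde (i + 1) * Ftilde (s + 1 - i)) (s + 1),
      Finset.sum_Ico_eq_sum_range]
    congr 2
    refine Finset.sum_congr (by congr 1) fun i hi => ?_
    rw [add_comm 1 i, show s + 2 - (i + 1) = s + 1 - i by omega]

-- In the recurrence the derivative carries the weight as a factor, and the products inherit it from
-- their first factors. Because of this `E_s` is a polynomial and the integrands in `ω` and `ϖ` have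
-- no singularity at `q = 0` or `q = ±1`.
open Polynomial in
lemma dvd_Ftilde (s : ℕ) : (X ^ 2 * (1 - X ^ 2) : ℝ[X]) ∣ Ftilde s := by
  induction s using Nat.strong_induction_on with
  | _ s ih =>
    match s with
    | 0 => simp [Ftilde]
    | 1 => exact ⟨C (1 / 8) * (5 * X ^ 2 - 1), by rw [Ftilde]; ring⟩
    | s + 2 =>
      rw [Ftilde_succ (s + 1) (by omega)]
      refine dvd_sub ⟨C (1 / 2) * derivative (Ftilde (s + 1)), by ring⟩
        (Dvd.dvd.mul_left (Finset.dvd_sum fun j hj => ?_) _)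
      rw [Finset.mem_Ico] at hj
      exact Dvd.dvd.mul_right (ih j (by omega)) _

open Polynomial in
lemma dvd_Gtilde (n s : ℕ) : (X ^ 2 * (1 - X ^ 2) : ℝ[X]) ∣ Gtilde n s :=
  Finset.dvd_sum fun _ _ => Dvd.dvd.mul_right (dvd_Ftilde _) _

lemma exists_derivative_eq (Q : Polynomial ℝ) :
    ∃ A : Polynomial ℝ, Polynomial.derivative A = Q ∧ A.eval 0 = 0 := by
  induction Q using Polynomial.induction_on' with
  | add p q hp hq =>
    obtain ⟨A, hA, hA0⟩ := hp
    obtain ⟨B, hB, hB0⟩ := hq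
    exact ⟨A + B, by simp [hA, hB], by simp [hA0, hB0]⟩
  | monomial n a =>
    refine ⟨Polynomial.monomial (n + 1) (a / (n + 1)), ?_, by simp [Polynomial.eval_monomial]⟩
    rw [Polynomial.derivative_monomial]
    have : (n : ℝ) + 1 ≠ 0 := by positivity
    simp [this]

/-- The quotient of `F̃_s` by `X² (1 - X²)`. -/
def Fquot (s : ℕ) : Polynomial ℝ := (dvd_Ftilde s).choose

lemma Ftilde_eq (s : ℕ) :
    Ftilde s = Polynomial.X ^ 2 * (1 - Polynomial.X ^ 2) * Fquot s :=
  (dvd_Ftilde s).choose_spec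

/-- The polynomial `Ẽ_s`. -/
def Epoly (s : ℕ) : Polynomial ℝ := -(exists_derivative_eq (Fquot s)).choose

lemma derivative_Epoly (s : ℕ) : Polynomial.derivative (Epoly s) = -Fquot s := by
  rw [Epoly, Polynomial.derivative_neg, (exists_derivative_eq (Fquot s)).choose_spec.1]

lemma eval_zero_Epoly (s : ℕ) : (Epoly s).eval 0 = 0 := by
  rw [Epoly, Polynomial.eval_neg, (exists_derivative_eq (Fquot s)).choose_spec.2, neg_zero]

/-- A multiple of `X² (1 - X²)` divided by `q² (1 - q²)` is a polynomial in `q`. -/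
lemma overWeight_mul (Q : Polynomial ℝ) {q : ℂ} (hq : q ^ 2 * (1 - q ^ 2) ≠ 0) :
    overWeight (Polynomial.X ^ 2 * (1 - Polynomial.X ^ 2) * Q) q = Polynomial.aeval q Q := by
  rw [overWeight]
  simp only [map_mul, map_pow, map_sub, map_one, Polynomial.aeval_X]
  exact mul_div_cancel_left₀ _ hq

lemma aeval_mul_ofReal_hasDerivAt (A : Polynomial ℝ) (p : ℂ) (t : ℝ) :
    HasDerivAt (fun t : ℝ => Polynomial.aeval ((t : ℂ) * p) A)
      (Polynomial.aeval ((t : ℂ) * p) (Polynomial.derivative A) * p) t := by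
  have h1 : HasDerivAt (fun t : ℝ => (t : ℂ) * p) p t := by
    simpa using (Complex.ofRealCLM.hasDerivAt (x := t)).mul_const p
  exact (A.hasDerivAt_aeval ((t : ℂ) * p)).comp t h1

/-- Fundamental theorem of calculus along the segment from `0` to `p`, once the weight has been
cancelled. -/
lemma Etilde_eq (s : ℕ) (p : ℂ) : Etilde s p = Polynomial.aeval p (Epoly s) := by
  by_cases hp : p = 0
  · have h0 : Polynomial.aeval (0 : ℂ) (Epoly s) = 0 := by
      have := Polynomial.aeval_algebraMap_apply ℂ (0 : ℝ) (Epoly s)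
      rw [map_zero] at this
      rw [this]
      simp [eval_zero_Epoly]
    simp [Etilde, hp, h0]
  -- Where the weight vanishes the quotient has the default value `0` instead of that of the
  -- polynomial; these finitely many `t` do not affect the integral.
  have hfin : Set.Finite {t : ℝ | ((t : ℂ) * p) ^ 2 * (1 - ((t : ℂ) * p) ^ 2) = 0} := by
    have hsub : {t : ℝ | ((t : ℂ) * p) ^ 2 * (1 - ((t : ℂ) * p) ^ 2) = 0} ⊆
        (fun t : ℝ => (t : ℂ)) ⁻¹' {0, p⁻¹, -p⁻¹} := by
      intro t ht
      have ht' : ((t : ℂ) * p) ^ 2 * (1 - ((t : ℂ) * p) ^ 2) = 0 := ht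
      rw [mul_eq_zero, pow_eq_zero_iff two_ne_zero, mul_eq_zero] at ht'
      simp only [Set.mem_preimage, Set.mem_insert_iff, Set.mem_singleton_iff]
      rcases ht' with (h | h) | h
      · exact Or.inl h
      · exact absurd h hp
      · have : ((t : ℂ) * p - 1) * ((t : ℂ) * p + 1) = 0 := by linear_combination -h
        rcases mul_eq_zero.1 this with h | h
        · right; left; field_simp; linear_combination h
        · right; right; field_simp; linear_combination h
    exact ((Set.toFinite _).preimage (Complex.ofReal_injective.injOn)).subset hsub
  have hae : ∀ᵐ t : ℝ, t ∈ Set.uIoc (0 : ℝ) 1 →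
      overWeight (Ftilde s) ((t : ℂ) * p) * p = Polynomial.aeval ((t : ℂ) * p) (Fquot s) * p := by
    have := hfin.measure_zero MeasureTheory.volume
    filter_upwards [MeasureTheory.compl_mem_ae_iff.2 this] with t ht _
    rw [Ftilde_eq, overWeight_mul _ ht]
  rw [Etilde, intervalIntegral.integral_congr_ae hae]
  have hd : ∀ t ∈ Set.uIcc (0 : ℝ) 1, HasDerivAt
      (fun t : ℝ => -Polynomial.aeval ((t : ℂ) * p) (Epoly s))
      (Polynomial.aeval ((t : ℂ) * p) (Fquot s) * p) t := fun t _ => by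
    have := (aeval_mul_ofReal_hasDerivAt (Epoly s) p t).neg
    rwa [derivative_Epoly, map_neg, neg_mul, neg_neg] at this
  have hcont : Continuous fun t : ℝ => Polynomial.aeval ((t : ℂ) * p) (Fquot s) * p := by
    have := (Fquot s).continuous_aeval (A := ℂ)
    fun_prop
  rw [intervalIntegral.integral_eq_sub_of_hasDerivAt hd (hcont.intervalIntegrable _ _)]
  have h0 := Polynomial.aeval_algebraMap_apply ℂ (0 : ℝ) (Epoly s)
  rw [map_zero] at h0
  simp [h0, eval_zero_Epoly]

lemma Etilde_one (s : ℕ) : Etilde s 1 = (kConst s : ℂ) := by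
  have h := Polynomial.aeval_algebraMap_apply ℂ (1 : ℝ) (Epoly s)
  rw [map_one, ← Etilde_eq] at h
  rw [kConst, h]
  simp

/-! ### The Riccati residual -/

/-- Algebraic identity behind the residual of the truncated Riccati expansion. -/
lemma residual_sequence (F F' : ℕ → ℂ) (w μ : ℂ) (hμ : μ ≠ 0)
    (hF : ∀ s, 1 ≤ s → 2 * F (s + 1) = w * F' s - ∑ j ∈ Finset.Ico 1 s, F j * F (s - j)) (n : ℕ) :
    μ ^ 2 + 2 * F 1 + w * ∑ s ∈ Finset.Ico 1 (n + 1), F' s / μ ^ s -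
        (μ + ∑ s ∈ Finset.Ico 1 (n + 1), F s / μ ^ s) ^ 2 =
      2 * F (n + 1) / μ ^ n - ∑ s ∈ Finset.Ico 1 (n + 1),
        (∑ k ∈ Finset.Ico s (n + 1), F k * F (s + n - k)) / μ ^ (n + s) := by
  induction n with
  | zero => simp
  | succ n ih =>
    set g : ℕ → ℕ → ℂ := fun n s => ∑ k ∈ Finset.Ico s (n + 1), F k * F (s + n - k) with hg
    have hstep : ∀ s ∈ Finset.Ico 1 (n + 1), g (n + 1) s = 2 * F s * F (n + 1) + g n (s + 1) := by
      intro s hs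
      rw [Finset.mem_Ico] at hs
      simp only [hg]
      rw [Finset.sum_Ico_succ_top (by omega), Finset.sum_eq_sum_Ico_succ_bot (by omega)]
      rw [show s + (n + 1) - (n + 1) = s by omega, show s + (n + 1) - s = n + 1 by omega]
      have : ∑ k ∈ Finset.Ico (s + 1) (n + 1), F k * F (s + (n + 1) - k) =
          ∑ k ∈ Finset.Ico (s + 1) (n + 1), F k * F (s + 1 + n - k) :=
        Finset.sum_congr rfl fun k _ => by rw [show s + (n + 1) - k = s + 1 + n - k by omega]
      rw [this]; ring
    have hlast : g (n + 1) (n + 1) = F (n + 1) ^ 2 := by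
      simp only [hg, Nat.Ico_succ_singleton, Finset.sum_singleton]
      rw [show n + 1 + (n + 1) - (n + 1) = n + 1 by omega]; ring
    have hempty : g n (n + 1) = 0 := by simp [hg]
    -- The recurrence enters only here. With the new term `F (n+1) / μ^(n+1)`, its cross product
    -- with `μ` removes the old leading term `2 F (n+1) / μ^n`, and at the next order `w F' (n+1) -
    -- g n 1` leaves the new leading term `2 F (n+2)`.
    have hfirst : g n 1 = w * F' (n + 1) - 2 * F (n + 2) := by
      rw [hF (n + 1) (by omega)]
      simp only [hg, add_comm 1 n]; ring
    have hshift : ∑ s ∈ Finset.Ico 1 (n + 1), g n s / μ ^ (n + s) =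
        g n 1 / μ ^ (n + 1) + ∑ s ∈ Finset.Ico 1 (n + 1), g n (s + 1) / μ ^ (n + 1 + s) := by
      have h1 : ∑ s ∈ Finset.Ico 1 (n + 2), g n s / μ ^ (n + s) =
          ∑ s ∈ Finset.Ico 1 (n + 1), g n s / μ ^ (n + s) := by
        rw [Finset.sum_Ico_succ_top (by omega), hempty]; simp
      rw [← h1, Finset.sum_eq_sum_Ico_succ_bot (by omega), Finset.sum_Ico_add' (fun s =>
        g n s / μ ^ (n + s)) 1 (n + 1) 1 |>.symm]
      congr 1
      exact Finset.sum_congr rfl fun s _ => by rw [show n + (s + 1) = n + 1 + s by ring]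
    have hnew : ∑ s ∈ Finset.Ico 1 (n + 2), g (n + 1) s / μ ^ (n + 1 + s) =
        2 * F (n + 1) / μ ^ (n + 1) * ∑ s ∈ Finset.Ico 1 (n + 1), F s / μ ^ s +
          ∑ s ∈ Finset.Ico 1 (n + 1), g n (s + 1) / μ ^ (n + 1 + s) +
          F (n + 1) ^ 2 / μ ^ (n + 1 + (n + 1)) := by
      rw [Finset.sum_Ico_succ_top (by omega), hlast, Finset.mul_sum, ← Finset.sum_add_distrib]
      congr 1
      refine Finset.sum_congr rfl fun s hs => ?_
      rw [hstep s hs, pow_add μ (n + 1) s]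
      field_simp
    change _ = _ - ∑ s ∈ Finset.Ico 1 (n + 2), g (n + 1) s / μ ^ (n + 1 + s)
    change _ = _ - ∑ s ∈ Finset.Ico 1 (n + 1), g n s / μ ^ (n + s) at ih
    rw [hnew, Finset.sum_Ico_succ_top (by omega : 1 ≤ n + 1),
      Finset.sum_Ico_succ_top (by omega : 1 ≤ n + 1)]
    rw [hshift, hfirst] at ih
    have e1 : F (n + 1) / μ ^ (n + 1) * μ = F (n + 1) / μ ^ n := by
      rw [pow_succ]; field_simp
    have e2 : F (n + 1) ^ 2 / μ ^ (n + 1 + (n + 1)) = (F (n + 1) / μ ^ (n + 1)) ^ 2 := by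
      rw [pow_add]; field_simp
    rw [e2]
    linear_combination ih - 2 * e1

/-- The derivative with respect to `ξ` of the truncated Liouville--Green exponent. -/
def vFun (N : ℕ) (μ q : ℂ) : ℂ :=
  μ + ∑ s ∈ Finset.Ico 1 N, Polynomial.aeval q (Ftilde s) / μ ^ s

/-- The residual of the truncated Liouville--Green exponent. -/
def residual (N : ℕ) (μ q : ℂ) : ℂ :=
  2 * Polynomial.aeval q (Ftilde N) / μ ^ (N - 1) -
    ∑ s ∈ Finset.Icc 1 (N - 1), Polynomial.aeval q (Gtilde N s) / μ ^ (N - 1 + s)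

/-- The left side is `μ² + 2F₁ - v² - dv/dξ`; the sum of derivatives has a plus sign because `dq/dξ
= -q²(1-q²)`. -/
lemma residual_eq (N : ℕ) (hN : 1 ≤ N) (μ q : ℂ) (hμ : μ ≠ 0) :
    μ ^ 2 + 2 * Polynomial.aeval q (Ftilde 1) + q ^ 2 * (1 - q ^ 2) *
        ∑ s ∈ Finset.Ico 1 N, Polynomial.aeval q (Polynomial.derivative (Ftilde s)) / μ ^ s -
        vFun N μ q ^ 2 = residual N μ q := by
  obtain ⟨n, rfl⟩ : ∃ n, N = n + 1 := ⟨N - 1, by omega⟩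
  have key := residual_sequence (fun s => Polynomial.aeval q (Ftilde s))
    (fun s => Polynomial.aeval q (Polynomial.derivative (Ftilde s))) (q ^ 2 * (1 - q ^ 2)) μ hμ
    (fun s hs => by
      simp only [Ftilde_succ s hs, map_sub, map_mul, map_sum, map_pow, map_one,
        Polynomial.aeval_X, Polynomial.aeval_C]
      simp only [map_div₀, map_one, map_ofNat]
      ring) n
  rw [residual, vFun, key]
  congr 1
  refine Finset.sum_congr (by ext; simp) fun s _ => ?_
  rw [Gtilde, map_sum]
  simp only [map_mul, Nat.add_sub_cancel]
  congr 1
  refine Finset.sum_congr (by ext; simp) fun k _ => ?_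
  rw [show s + (n + 1) - k - 1 = s + n - k by omega]

end

noncomputable section

/-! ### Branches on the cut plane -/

lemma cutPlane_slitPlane {z : ℂ} (hz : z ∈ cutPlane) : z ∈ Complex.slitPlane := by
  rw [Complex.mem_slitPlane_iff]
  by_contra h
  push Not at h
  exact hz ⟨h.1, Or.inl h.2⟩

lemma cutPlane_sub_I {z : ℂ} (hz : z ∈ cutPlane) : z - Complex.I ∈ Complex.slitPlane := by
  rw [Complex.mem_slitPlane_iff]
  by_contra h
  push Not at h
  simp only [Complex.sub_re, Complex.I_re, sub_zero, Complex.sub_im, Complex.I_im] at h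
  exact hz ⟨h.1, Or.inr (Or.inl (by linarith [h.2]))⟩

lemma cutPlane_add_I {z : ℂ} (hz : z ∈ cutPlane) : z + Complex.I ∈ Complex.slitPlane := by
  rw [Complex.mem_slitPlane_iff]
  by_contra h
  push Not at h
  simp only [Complex.add_re, Complex.I_re, add_zero, Complex.add_im, Complex.I_im] at h
  exact hz ⟨h.1, Or.inr (Or.inr (by linarith [h.2]))⟩

lemma cutPlane_ne_zero {z : ℂ} (hz : z ∈ cutPlane) : z ≠ 0 :=
  Complex.slitPlane_ne_zero (cutPlane_slitPlane hz)

lemma mem_cutPlane_iff {z : ℂ} : z ∈ cutPlane ↔ z ∈ Complex.slitPlane ∧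
    z - Complex.I ∈ Complex.slitPlane ∧ z + Complex.I ∈ Complex.slitPlane := by
  refine ⟨fun h => ⟨cutPlane_slitPlane h, cutPlane_sub_I h, cutPlane_add_I h⟩, ?_⟩
  rintro ⟨h0, h1, h2⟩ ⟨hre, him | him | him⟩
  · exact (Complex.mem_slitPlane_iff.1 h0).elim (fun h => by linarith) (fun h => h him)
  · exact (Complex.mem_slitPlane_iff.1 h1).elim (fun h => by simp at h; linarith)
      (fun h => h (by simp [him]))
  · exact (Complex.mem_slitPlane_iff.1 h2).elim (fun h => by simp at h; linarith)
      (fun h => h (by simp [him]))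

lemma isOpen_cutPlane : IsOpen cutPlane := by
  have : cutPlane = Complex.slitPlane ∩ ((fun z => z - Complex.I) ⁻¹' Complex.slitPlane ∩
      (fun z => z + Complex.I) ⁻¹' Complex.slitPlane) := by
    ext z; exact mem_cutPlane_iff
  rw [this]
  exact Complex.isOpen_slitPlane.inter
    ((Complex.isOpen_slitPlane.preimage (by fun_prop)).inter
      (Complex.isOpen_slitPlane.preimage (by fun_prop)))

lemma sqrtBr_sq (z : ℂ) : sqrtBr z ^ 2 = 1 + z ^ 2 := by
  have h (w : ℂ) : (w ^ (1 / 2 : ℂ)) ^ 2 = w := by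
    rw [← Complex.cpow_nat_mul]; norm_num
  rw [sqrtBr, mul_pow, h, h]
  linear_combination -Complex.I_sq

lemma fourthRootBr_sq (z : ℂ) : fourthRootBr z ^ 2 = sqrtBr z := by
  have h (w : ℂ) : (w ^ (1 / 4 : ℂ)) ^ 2 = w ^ (1 / 2 : ℂ) := by
    rw [← Complex.cpow_nat_mul]; norm_num
  rw [fourthRootBr, mul_pow, h, h, sqrtBr]

lemma sqrtBr_ne_zero {z : ℂ} (h1 : z - Complex.I ∈ Complex.slitPlane)
    (h2 : z + Complex.I ∈ Complex.slitPlane) : sqrtBr z ≠ 0 := by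
  intro h
  have := sqrtBr_sq z
  rw [h, zero_pow two_ne_zero] at this
  have h3 : (z - Complex.I) * (z + Complex.I) = 0 := by
    linear_combination -this - Complex.I_sq
  rcases mul_eq_zero.1 h3 with h | h
  · exact Complex.slitPlane_ne_zero h1 h
  · exact Complex.slitPlane_ne_zero h2 h

lemma fourthRootBr_ne_zero {z : ℂ} (h1 : z - Complex.I ∈ Complex.slitPlane)
    (h2 : z + Complex.I ∈ Complex.slitPlane) : fourthRootBr z ≠ 0 := by
  intro h
  have := fourthRootBr_sq z
  rw [h, zero_pow two_ne_zero] at this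
  exact sqrtBr_ne_zero h1 h2 this.symm

lemma hasDerivAt_prod_cpow (a : ℂ) {z : ℂ} (h1 : z - Complex.I ∈ Complex.slitPlane)
    (h2 : z + Complex.I ∈ Complex.slitPlane) :
    HasDerivAt (fun z => (z - Complex.I) ^ a * (z + Complex.I) ^ a)
      (2 * a * z / (1 + z ^ 2) * ((z - Complex.I) ^ a * (z + Complex.I) ^ a)) z := by
  have n1 := Complex.slitPlane_ne_zero h1
  have n2 := Complex.slitPlane_ne_zero h2
  have d1 := ((hasDerivAt_id z).sub_const Complex.I).cpow_const (c := a) h1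
  have d2 := ((hasDerivAt_id z).add_const Complex.I).cpow_const (c := a) h2
  refine (d1.mul d2).congr_deriv ?_
  have h3 : 1 + z ^ 2 = (z - Complex.I) * (z + Complex.I) := by
    linear_combination Complex.I_sq
  simp only [id]
  rw [h3, Complex.cpow_sub _ _ n1, Complex.cpow_sub _ _ n2, Complex.cpow_one, Complex.cpow_one]
  field_simp
  ring

lemma hasDerivAt_sqrtBr {z : ℂ} (h1 : z - Complex.I ∈ Complex.slitPlane)
    (h2 : z + Complex.I ∈ Complex.slitPlane) : HasDerivAt sqrtBr (z / sqrtBr z) z := by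
  have hs := sqrtBr_ne_zero h1 h2
  refine HasDerivAt.congr_deriv (f := sqrtBr) (hasDerivAt_prod_cpow (1 / 2) h1 h2) ?_
  rw [← sqrtBr_sq]
  change _ * sqrtBr z = _
  field_simp

lemma hasDerivAt_fourthRootBr {z : ℂ} (h1 : z - Complex.I ∈ Complex.slitPlane)
    (h2 : z + Complex.I ∈ Complex.slitPlane) :
    HasDerivAt fourthRootBr (z / (2 * sqrtBr z ^ 2) * fourthRootBr z) z := by
  have hs := sqrtBr_ne_zero h1 h2
  refine HasDerivAt.congr_deriv (f := fourthRootBr) (hasDerivAt_prod_cpow (1 / 4) h1 h2) ?_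
  rw [← sqrtBr_sq]
  change _ * fourthRootBr z = _
  field_simp
  ring

lemma hasDerivAt_pVar {z : ℂ} (h1 : z - Complex.I ∈ Complex.slitPlane)
    (h2 : z + Complex.I ∈ Complex.slitPlane) :
    HasDerivAt pVar (-z / sqrtBr z ^ 3) z := by
  have hs := sqrtBr_ne_zero h1 h2
  refine HasDerivAt.congr_deriv (f := pVar) ((hasDerivAt_sqrtBr h1 h2).inv hs) ?_
  field_simp

/-- From `1 - p² = z²/(1+z²)`. Together with `dp/dz = -z/(1+z²)^{3/2}` this identifies `dξ` with
`-dp/(p²(1-p²))`. -/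
lemma pVar_weight {z : ℂ} (hz : z ∈ cutPlane) :
    pVar z ^ 2 * (1 - pVar z ^ 2) = z ^ 2 / sqrtBr z ^ 4 := by
  have hs := sqrtBr_ne_zero (cutPlane_sub_I hz) (cutPlane_add_I hz)
  have h2 := sqrtBr_sq z
  rw [pVar]
  field_simp
  linear_combination h2

lemma pVar_weight_ne_zero {z : ℂ} (hz : z ∈ cutPlane) :
    pVar z ^ 2 * (1 - pVar z ^ 2) ≠ 0 := by
  rw [pVar_weight hz]
  exact div_ne_zero (pow_ne_zero _ (cutPlane_ne_zero hz))
    (pow_ne_zero _ (sqrtBr_ne_zero (cutPlane_sub_I hz) (cutPlane_add_I hz)))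

/-! ### Signs of the square root, and the logarithm in `ξ` -/

lemma sqrtBr_eq_exp {z : ℂ} (h1 : z - Complex.I ≠ 0) (h2 : z + Complex.I ≠ 0) :
    sqrtBr z = Complex.exp ((Complex.log (z - Complex.I) + Complex.log (z + Complex.I)) / 2) := by
  rw [sqrtBr, Complex.cpow_def_of_ne_zero h1, Complex.cpow_def_of_ne_zero h2, ← Complex.exp_add]
  congr 1
  ring

lemma re_sqrtBr {z : ℂ} (h1 : z - Complex.I ≠ 0) (h2 : z + Complex.I ≠ 0) :
    (sqrtBr z).re = ‖sqrtBr z‖ *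
      Real.cos ((Complex.arg (z - Complex.I) + Complex.arg (z + Complex.I)) / 2) := by
  rw [sqrtBr_eq_exp h1 h2, Complex.norm_exp, Complex.exp_re]
  congr 2
  simp [Complex.log_im]

lemma im_sqrtBr {z : ℂ} (h1 : z - Complex.I ≠ 0) (h2 : z + Complex.I ≠ 0) :
    (sqrtBr z).im = ‖sqrtBr z‖ *
      Real.sin ((Complex.arg (z - Complex.I) + Complex.arg (z + Complex.I)) / 2) := by
  rw [sqrtBr_eq_exp h1 h2, Complex.norm_exp, Complex.exp_im]
  congr 2
  simp [Complex.log_im]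

lemma slitPlane_of_re_pos_or_im {z : ℂ} (h : 0 < z.re ∨ |z.im| < 1) :
    z - Complex.I ∈ Complex.slitPlane ∧ z + Complex.I ∈ Complex.slitPlane := by
  rw [Complex.mem_slitPlane_iff, Complex.mem_slitPlane_iff]
  rcases h with h | h
  · exact ⟨Or.inl (by simpa using h), Or.inl (by simpa using h)⟩
  · rw [abs_lt] at h
    refine ⟨Or.inr ?_, Or.inr ?_⟩
    · simp only [Complex.sub_im, Complex.I_im]; intro h'; linarith
    · simp only [Complex.add_im, Complex.I_im]; intro h'; linarith

/-- On the strip `|Im z| < 1` and on the right half-plane the branch has positive real part. -/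
lemma re_sqrtBr_pos {z : ℂ} (h : 0 < z.re ∨ |z.im| < 1) : 0 < (sqrtBr z).re := by
  obtain ⟨h1, h2⟩ := slitPlane_of_re_pos_or_im h
  have hs := sqrtBr_ne_zero h1 h2
  rw [re_sqrtBr (Complex.slitPlane_ne_zero h1) (Complex.slitPlane_ne_zero h2)]
  -- The sum of the two arguments must lie in `(-π, π)`. For `Re z > 0` each is below `π/2` in
  -- modulus; in the strip they lie in `(-π, 0)` and `[0, π)`.
  refine mul_pos (norm_pos_iff.2 hs) (Real.cos_pos_of_mem_Ioo ?_)
  rcases h with h | h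
  · have a1 := Complex.abs_arg_lt_pi_div_two_iff.2
      (Or.inl (by simpa using h) : 0 < (z - Complex.I).re ∨ _)
    have a2 := Complex.abs_arg_lt_pi_div_two_iff.2
      (Or.inl (by simpa using h) : 0 < (z + Complex.I).re ∨ _)
    rw [abs_lt] at a1 a2
    constructor <;> linarith
  · rw [abs_lt] at h
    have a1 : (z - Complex.I).arg < 0 := Complex.arg_neg_iff.2 (by simp; linarith)
    have a2 : 0 ≤ (z + Complex.I).arg := Complex.arg_nonneg_iff.2 (by simp; linarith)
    have a3 := Complex.neg_pi_lt_arg (z - Complex.I)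
    have a4 := Complex.arg_le_pi (z + Complex.I)
    have a5 : (z + Complex.I).arg ≠ Real.pi := fun h' => by
      have := (Complex.arg_eq_pi_iff.1 h').2
      simp at this; linarith
    have a6 := lt_of_le_of_ne a4 a5
    constructor <;> linarith

lemma pi_div_two_le_arg {w : ℂ} (hre : w.re ≤ 0) (him : 0 < w.im) :
    Real.pi / 2 ≤ w.arg ∧ w.arg < Real.pi := by
  have h0 : 0 ≤ w.arg := Complex.arg_nonneg_iff.2 him.le
  refine ⟨?_, lt_of_le_of_ne (Complex.arg_le_pi w) fun h' => ?_⟩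
  · by_contra h
    push Not at h
    rcases Complex.abs_arg_lt_pi_div_two_iff.1 ((abs_of_nonneg h0).trans_lt h) with h | h
    · linarith
    · simp [h] at him
  · exact him.ne' (Complex.arg_eq_pi_iff.1 h').2

lemma arg_le_neg_pi_div_two {w : ℂ} (hre : w.re ≤ 0) (him : w.im < 0) :
    -Real.pi < w.arg ∧ w.arg ≤ -(Real.pi / 2) := by
  have h0 : w.arg < 0 := Complex.arg_neg_iff.2 him
  refine ⟨Complex.neg_pi_lt_arg w, ?_⟩
  by_contra h
  push Not at h
  rcases Complex.abs_arg_lt_pi_div_two_iff.1 (show |w.arg| < Real.pi / 2 by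
    rw [abs_of_neg h0]; linarith) with h | h
  · linarith
  · simp [h] at him

/-- Quadrants to the left of the cuts. -/
lemma sqrtBr_left {z : ℂ} (hre : z.re ≤ 0) (him : 1 < |z.im|) :
    (sqrtBr z).re ≤ 0 ∧ 0 ≤ (sqrtBr z).im * z.im := by
  have n1 : z - Complex.I ≠ 0 := fun h => by
    have := congrArg Complex.im (sub_eq_zero.1 h); simp [this] at him
  have n2 : z + Complex.I ≠ 0 := fun h => by
    have := congrArg Complex.im (eq_neg_of_add_eq_zero_left h); simp [this] at him
  have hn := norm_nonneg (sqrtBr z)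
  have hpi := Real.pi_pos
  rw [re_sqrtBr n1 n2, im_sqrtBr n1 n2]
  rcases lt_abs.1 him with h | h
  · obtain ⟨a1, a2⟩ := pi_div_two_le_arg (w := z - Complex.I) (by simpa) (by simp; linarith)
    obtain ⟨a3, a4⟩ := pi_div_two_le_arg (w := z + Complex.I) (by simpa) (by simp; linarith)
    refine ⟨mul_nonpos_of_nonneg_of_nonpos hn
      (Real.cos_nonpos_of_pi_div_two_le_of_le (by linarith) (by linarith)), ?_⟩
    exact mul_nonneg (mul_nonneg hn (Real.sin_nonneg_of_nonneg_of_le_pi (by linarith)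
      (by linarith))) (by linarith)
  · obtain ⟨a1, a2⟩ := arg_le_neg_pi_div_two (w := z - Complex.I) (by simpa) (by simp; linarith)
    obtain ⟨a3, a4⟩ := arg_le_neg_pi_div_two (w := z + Complex.I) (by simpa) (by simp; linarith)
    refine ⟨mul_nonpos_of_nonneg_of_nonpos hn ?_, ?_⟩
    · rw [← Real.cos_neg]
      exact Real.cos_nonpos_of_pi_div_two_le_of_le (by linarith) (by linarith)
    · exact mul_nonneg_of_nonpos_of_nonpos (mul_nonpos_of_nonneg_of_nonpos hn
        (Real.sin_nonpos_of_nonpos_of_neg_pi_le (by linarith) (by linarith))) (by linarith)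

lemma one_add_sqrtBr_ne_zero {z : ℂ} (hz : z ≠ 0) : 1 + sqrtBr z ≠ 0 := by
  intro h
  have h2 := sqrtBr_sq z
  rw [show sqrtBr z = -1 by linear_combination h] at h2
  exact hz (pow_eq_zero_iff two_ne_zero |>.1 (by linear_combination -h2))

/-- If the quotient were a real `t ≤ 0`, the rational parametrization of `s² = 1 + z²` would give `s
= (1+t²)/(1-t²)` and `z = 2t/(1-t²)`. Then `z` is real, hence positive in the cut plane, so `s > 0`
and `1 - t² > 0`, which makes `z ≤ 0`. -/
lemma div_one_add_sqrtBr_mem {z : ℂ} (hz : z ∈ cutPlane) :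
    z / (1 + sqrtBr z) ∈ Complex.slitPlane := by
  have hz0 := cutPlane_ne_zero hz
  have h1 := one_add_sqrtBr_ne_zero hz0
  have h2 := sqrtBr_sq z
  rw [Complex.mem_slitPlane_iff]
  by_contra hcon
  push Not at hcon
  obtain ⟨hre, him⟩ := hcon
  obtain ⟨t, ht⟩ : ∃ t : ℝ, z / (1 + sqrtBr z) = (t : ℂ) :=
    ⟨_, Complex.ext rfl (by simpa using him)⟩
  rw [ht, Complex.ofReal_re] at hre
  have hzt : z = t * (1 + sqrtBr z) := by rw [← ht]; field_simp
  have h3 : sqrtBr z * (1 - (t : ℂ) ^ 2) = 1 + (t : ℂ) ^ 2 := by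
    have : (1 + sqrtBr z) * (sqrtBr z - 1) = (1 + sqrtBr z) * ((t : ℂ) ^ 2 * (1 + sqrtBr z)) := by
      linear_combination h2 + (z + t * (1 + sqrtBr z)) * hzt
    linear_combination mul_left_cancel₀ h1 this
  have ht1 : 1 - t ^ 2 ≠ 0 := by
    intro h
    have h' : (1 : ℂ) - (t : ℂ) ^ 2 = 0 := by exact_mod_cast h
    rw [h', mul_zero] at h3
    have : (1 : ℝ) + t ^ 2 = 0 := by exact_mod_cast h3.symm
    nlinarith [sq_nonneg t]
  have ht1' : (1 : ℂ) - (t : ℂ) ^ 2 ≠ 0 := by exact_mod_cast ht1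
  have hs : sqrtBr z = (((1 + t ^ 2) / (1 - t ^ 2) : ℝ) : ℂ) := by
    push_cast
    field_simp
    linear_combination h3
  have hz' : z = ((2 * t / (1 - t ^ 2) : ℝ) : ℂ) := by
    rw [hzt, hs]
    push_cast
    field_simp
    ring
  have hzre : z.re = 2 * t / (1 - t ^ 2) := by rw [hz', Complex.ofReal_re]
  have hsre : (sqrtBr z).re = (1 + t ^ 2) / (1 - t ^ 2) := by rw [hs, Complex.ofReal_re]
  have hpos : 0 < z.re := by
    by_contra hn
    exact hz ⟨not_lt.1 hn, Or.inl (by rw [hz', Complex.ofReal_im])⟩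
  have hspos := re_sqrtBr_pos (Or.inl hpos)
  rw [hsre] at hspos
  rw [hzre] at hpos
  have hden : 0 < 1 - t ^ 2 := by
    by_contra hn
    exact absurd hspos (not_lt.2 (div_nonpos_of_nonneg_of_nonpos (by positivity) (not_lt.1 hn)))
  have : 2 * t / (1 - t ^ 2) ≤ 0 := div_nonpos_of_nonpos_of_nonneg (by linarith) hden.le
  linarith

lemma hasDerivAt_xi {z : ℂ} (hz : z ∈ cutPlane) : HasDerivAt xi (sqrtBr z / z) z := by
  have hz0 := cutPlane_ne_zero hz
  have h1 := one_add_sqrtBr_ne_zero hz0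
  have hs := sqrtBr_ne_zero (cutPlane_sub_I hz) (cutPlane_add_I hz)
  have ds := hasDerivAt_sqrtBr (cutPlane_sub_I hz) (cutPlane_add_I hz)
  have h2 := sqrtBr_sq z
  have d := ds.add (((hasDerivAt_id z).div (ds.const_add 1) h1).clog (div_one_add_sqrtBr_mem hz))
  refine HasDerivAt.congr_deriv (f := xi) d ?_
  simp only [id, Pi.div_apply]
  field_simp
  linear_combination -sqrtBr z * h2

end

noncomputable section

/-! ### A Gronwall estimate -/

/-- Cut the interval at the exceptional points, one at a time. They stand for the corners of the
path, where nothing beyond continuity is available. -/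
lemma le_of_hasDerivAt_nonpos_off_finset {h h' : ℝ → ℝ} (T : Finset ℝ) :
    ∀ {a b : ℝ}, a ≤ b → ContinuousOn h (Set.Icc a b) →
      (∀ t ∈ Set.Ioo a b, t ∉ T → HasDerivAt h (h' t) t ∧ h' t ≤ 0) → h b ≤ h a := by
  induction T using Finset.induction_on with
  | empty =>
    intro a b hab hc hd
    refine antitoneOn_of_deriv_nonpos (convex_Icc a b) hc ?_ ?_ (Set.left_mem_Icc.2 hab)
      (Set.right_mem_Icc.2 hab) hab
    · rw [interior_Icc]
      exact fun t ht => (hd t ht (Finset.notMem_empty t)).1.differentiableAt.differentiableWithinAt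
    · rw [interior_Icc]
      intro t ht
      rw [(hd t ht (Finset.notMem_empty t)).1.deriv]
      exact (hd t ht (Finset.notMem_empty t)).2
  | insert s T _ ih =>
    intro a b hab hc hd
    by_cases hs : s ∈ Set.Ioo a b
    · have h1 := ih hs.1.le (hc.mono (Set.Icc_subset_Icc le_rfl hs.2.le)) fun t ht htT =>
        hd t ⟨ht.1, ht.2.trans hs.2⟩ (by
          rw [Finset.mem_insert, not_or]; exact ⟨ht.2.ne, htT⟩)
      have h2 := ih hs.2.le (hc.mono (Set.Icc_subset_Icc hs.1.le le_rfl)) fun t ht htT =>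
        hd t ⟨hs.1.trans ht.1, ht.2⟩ (by
          rw [Finset.mem_insert, not_or]; exact ⟨ht.1.ne', htT⟩)
      exact h2.trans h1
    · refine ih hab hc fun t ht htT => hd t ht ?_
      rw [Finset.mem_insert, not_or]
      exact ⟨fun h => hs (h ▸ ht), htT⟩

/-- If `‖G'‖ ≤ B'` off a finite set then the increment of `G` is at most that of `B`. -/
lemma norm_sub_le_off_finset {G G' : ℝ → ℂ} {B B' : ℝ → ℝ} (T : Finset ℝ) {a b : ℝ} (hab : a ≤ b)
    (hG : ContinuousOn G (Set.Icc a b)) (hB : ContinuousOn B (Set.Icc a b))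
    (hd : ∀ t ∈ Set.Ioo a b, t ∉ T →
      HasDerivAt G (G' t) t ∧ HasDerivAt B (B' t) t ∧ ‖G' t‖ ≤ B' t) :
    ‖G b - G a‖ ≤ B b - B a := by
  by_cases h0 : G b - G a = 0
  · rw [h0, norm_zero, sub_nonneg]
    have := le_of_hasDerivAt_nonpos_off_finset (h := fun t => -B t) (h' := fun t => -B' t) T hab
      hB.neg fun t ht hT => ⟨(hd t ht hT).2.1.neg, by
        have := (norm_nonneg _).trans (hd t ht hT).2.2
        linarith⟩
    linarith
  -- A unimodular factor rotating the increment onto the positive axis, which reduces the claim to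
  -- the real function `Re (c G) - B`.
  set c : ℂ := (starRingEnd ℂ) (G b - G a) / ‖G b - G a‖ with hc
  have hn : ‖G b - G a‖ ≠ 0 := norm_ne_zero_iff.2 h0
  have hc1 : ‖c‖ = 1 := by
    rw [hc, norm_div, RCLike.norm_conj, Complex.norm_real, norm_norm, div_self hn]
  have hcd : (c * (G b - G a)).re = ‖G b - G a‖ := by
    have : c * (G b - G a) = (‖G b - G a‖ : ℂ) := by
      rw [hc, div_mul_eq_mul_div, mul_comm, Complex.mul_conj, Complex.normSq_eq_norm_sq]
      have : (‖G b - G a‖ : ℂ) ≠ 0 := by exact_mod_cast hn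
      push_cast
      field_simp
    rw [this, Complex.ofReal_re]
  have key := le_of_hasDerivAt_nonpos_off_finset (h := fun t => (c * G t).re - B t)
    (h' := fun t => (c * G' t).re - B' t) T hab
    ((Complex.continuous_re.comp_continuousOn (continuousOn_const.mul hG)).sub hB)
    fun t ht hT => by
      obtain ⟨d1, d2, d3⟩ := hd t ht hT
      refine ⟨HasDerivAt.sub ?_ d2, ?_⟩
      · exact Complex.reCLM.hasFDerivAt.comp_hasDerivAt t (d1.const_mul c)
      · have := Complex.re_le_norm (c * G' t)
        rw [norm_mul, hc1, one_mul] at this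
        linarith
  simp only [mul_sub, Complex.sub_re] at hcd
  linarith

lemma primitive_off_finset {f : ℝ → ℝ} (T : Finset ℝ) {a b : ℝ} (hab : a ≤ b)
    (hf : IntervalIntegrable f MeasureTheory.volume a b)
    (hc : ∀ t ∈ Set.Ioo a b, t ∉ T → ContinuousAt f t) :
    ContinuousOn (fun t => ∫ u in a..t, f u) (Set.Icc a b) ∧
      ∀ t ∈ Set.Ioo a b, t ∉ T → HasDerivAt (fun t => ∫ u in a..t, f u) (f t) t := by
  constructor
  · have := intervalIntegral.continuousOn_primitive_interval' hf Set.left_mem_uIcc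
    rwa [Set.uIcc_of_le hab] at this
  · intro t ht hT
    have hopen : IsOpen (Set.Ioo a b \ (T : Set ℝ)) := isOpen_Ioo.sdiff T.finite_toSet.isClosed
    refine intervalIntegral.integral_hasDerivAt_right (hf.mono_set ?_) ?_ (hc t ht hT)
    · rw [Set.uIcc_of_le ht.1.le, Set.uIcc_of_le hab]
      exact Set.Icc_subset_Icc le_rfl ht.2.le
    · exact ContinuousOn.stronglyMeasurableAtFilter hopen
        (fun u hu => (hc u hu.1 hu.2).continuousWithinAt) t ⟨ht, hT⟩

/-- The error estimate for the first-order system satisfied by the relative error `e` of a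
Liouville--Green approximation along a path on which `Re x` is nondecreasing. -/
lemma norm_error_le {a b ν : ℝ} (hab : a ≤ b) (hν : 0 < ν) (T : Finset ℝ)
    {x e y x' R S : ℝ → ℂ}
    (hx : ContinuousOn x (Set.Icc a b)) (he : ContinuousOn e (Set.Icc a b))
    (hy : ContinuousOn y (Set.Icc a b)) (hR : ContinuousOn R (Set.Icc a b))
    (hS : ContinuousOn S (Set.Icc a b))
    (hx'i : IntervalIntegrable x' MeasureTheory.volume a b)
    (hx'c : ∀ t ∈ Set.Ioo a b, t ∉ T → ContinuousAt x' t)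
    (hmono : MonotoneOn (fun t => (x t).re) (Set.Icc a b))
    (hxd : ∀ t ∈ Set.Ioo a b, t ∉ T → HasDerivAt x (x' t) t)
    (hed : ∀ t ∈ Set.Ioo a b, t ∉ T → HasDerivAt e (y t * x' t) t)
    (hyd : ∀ t ∈ Set.Ioo a b, t ∉ T →
      HasDerivAt y ((R t * (1 + e t) - 2 * (ν + S t) * y t) * x' t) t) :
    ‖e b‖ ≤ Real.exp (2 * ∫ t in a..b, ‖S t * x' t‖) *
      (Real.exp ((∫ t in a..b, ‖R t * x' t‖) / ν) *
        (1 + (‖2 * ν * e a + y a‖ + ‖y a‖) / ν) - 1) := by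
  have hint (f : ℝ → ℂ) (hf : ContinuousOn f (Set.Icc a b)) :
      IntervalIntegrable (fun t => ‖f t * x' t‖) MeasureTheory.volume a b :=
    (hx'i.continuousOn_mul (by rwa [Set.uIcc_of_le hab])).norm
  have hcat (f : ℝ → ℂ) (hf : ContinuousOn f (Set.Icc a b)) (t : ℝ) (ht : t ∈ Set.Ioo a b)
      (hT : t ∉ T) : ContinuousAt (fun t => ‖f t * x' t‖) t :=
    ((hf.continuousAt (Icc_mem_nhds ht.1 ht.2)).mul (hx'c t ht hT)).norm
  obtain ⟨hVc, hVd⟩ := primitive_off_finset T hab (hint S hS) (hcat S hS)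
  obtain ⟨hρc, hρd⟩ := primitive_off_finset T hab (hint R hR) (hcat R hR)
  obtain ⟨hPc, hPd⟩ := primitive_off_finset T hab (hint _ (hR.mul (continuousOn_const.add he)))
    (hcat _ (hR.mul (continuousOn_const.add he)))
  obtain ⟨hQc, hQd⟩ := primitive_off_finset T hab (hint _ (hS.mul hy)) (hcat _ (hS.mul hy))
  set V : ℝ → ℝ := fun t => ∫ u in a..t, ‖S u * x' u‖ with hV
  set ρ : ℝ → ℝ := fun t => ∫ u in a..t, ‖R u * x' u‖ with hρ
  set P : ℝ → ℝ := fun t => ∫ u in a..t, ‖(R * fun t => 1 + e t) u * x' u‖ with hP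
  set Q : ℝ → ℝ := fun t => ∫ u in a..t, ‖(S * y) u * x' u‖ with hQ
  set M0 : ℝ := ‖2 * ν * e a + y a‖ + ‖y a‖ with hM0
  -- The common majorant: initial data plus the accumulated forcing `|R(1+e)| + 2|S y|`.
  set M : ℝ → ℝ := fun t => M0 + (P t + 2 * Q t) with hM
  have hMa : M a = M0 := by simp [hM, hP, hQ]
  have hMc : ContinuousOn M (Set.Icc a b) := by
    simp only [hM]; exact continuousOn_const.add (hPc.add (continuousOn_const.mul hQc))
  set g : ℝ → ℝ := fun t => ‖R t * (1 + e t) * x' t‖ + 2 * ‖S t * y t * x' t‖ with hg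
  have hg0 (t : ℝ) : 0 ≤ g t := by positivity
  have hMd : ∀ t ∈ Set.Ioo a b, t ∉ T → HasDerivAt M (g t) t := fun t ht hT =>
    (((hPd t ht hT).add ((hQd t ht hT).const_mul 2)).const_add M0)
  have hgle (t : ℝ) : ‖(R t * (1 + e t) - 2 * S t * y t) * x' t‖ ≤ g t := by
    rw [show (R t * (1 + e t) - 2 * S t * y t) * x' t =
      R t * (1 + e t) * x' t - 2 * (S t * y t * x' t) by ring]
    refine (norm_sub_le _ _).trans_eq ?_
    rw [norm_mul 2]; norm_num [hg]
  -- In the derivative of `2νe + y` the terms `±2νy` cancel, leaving `(R(1+e) - 2Sy) x'`.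
  have hu : ∀ t ∈ Set.Icc a b, ‖2 * ν * e t + y t‖ ≤ M t := by
    intro t ht
    have hsub : Set.Icc a t ⊆ Set.Icc a b := Set.Icc_subset_Icc le_rfl ht.2
    have := norm_sub_le_off_finset (G := fun t => 2 * ν * e t + y t)
      (G' := fun t => (R t * (1 + e t) - 2 * S t * y t) * x' t) (B := M) (B' := g) T ht.1
      ((continuousOn_const.mul (he.mono hsub)).add (hy.mono hsub)) (hMc.mono hsub)
      fun s hs hT => by
        have hs' : s ∈ Set.Ioo a b := ⟨hs.1, hs.2.trans_le ht.2⟩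
        refine ⟨?_, hMd s hs' hT, hgle s⟩
        refine (((hed s hs' hT).const_mul (2 * (ν : ℂ))).add (hyd s hs' hT)).congr_deriv ?_
        ring
    have h2 := norm_sub_norm_le (2 * ν * e t + y t) (2 * ν * e a + y a)
    have h3 := norm_nonneg (y a)
    simp only [hMa] at this
    linarith
  -- The integrating factor `exp(2νx)` removes `-2νy`. As `Re x` is nondecreasing, its modulus at
  -- earlier parameters is at most that at `t`, so it can be divided out at the end. This is the
  -- only use of progressiveness.
  have hy' : ∀ t ∈ Set.Icc a b, ‖y t‖ ≤ M t := by
    intro t ht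
    have hsub : Set.Icc a t ⊆ Set.Icc a b := Set.Icc_subset_Icc le_rfl ht.2
    have hE (s : ℝ) : ‖Complex.exp (2 * ν * x s)‖ = Real.exp (2 * ν * (x s).re) := by
      rw [Complex.norm_exp]; simp
    have := norm_sub_le_off_finset (G := fun t => Complex.exp (2 * ν * x t) * y t)
      (G' := fun t => Complex.exp (2 * ν * x t) *
        ((R t * (1 + e t) - 2 * S t * y t) * x' t))
      (B := fun s => Real.exp (2 * ν * (x t).re) * M s)
      (B' := fun s => Real.exp (2 * ν * (x t).re) * g s) T ht.1
      ((Complex.continuous_exp.comp_continuousOn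
        (continuousOn_const.mul (hx.mono hsub))).mul (hy.mono hsub))
      (continuousOn_const.mul (hMc.mono hsub))
      fun s hs hT => by
        have hs' : s ∈ Set.Ioo a b := ⟨hs.1, hs.2.trans_le ht.2⟩
        refine ⟨?_, (hMd s hs' hT).const_mul _, ?_⟩
        · refine ((((hxd s hs' hT).const_mul (2 * (ν : ℂ))).cexp).mul
            (hyd s hs' hT)).congr_deriv ?_
          ring
        · rw [norm_mul, hE]
          have hm := hmono ⟨hs.1.le, hs'.2.le⟩ ht hs.2.le
          simp only at hm
          gcongr
          exact hgle s
    have hm := hmono (Set.left_mem_Icc.2 hab) ht ht.1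
    simp only at hm
    have h2 := norm_sub_norm_le (Complex.exp (2 * ν * x t) * y t) (Complex.exp (2 * ν * x a) * y a)
    simp only [norm_mul (Complex.exp _), hE, hMa] at this h2
    have h3 : Real.exp (2 * ν * (x a).re) * ‖y a‖ ≤ Real.exp (2 * ν * (x t).re) * M0 := by
      gcongr
      rw [hM0]; linarith [norm_nonneg (2 * ν * e a + y a)]
    have h4 : Real.exp (2 * ν * (x t).re) * ‖y t‖ ≤ Real.exp (2 * ν * (x t).re) * M t := by
      linarith
    exact le_of_mul_le_mul_left h4 (Real.exp_pos _)
  have he' : ∀ t ∈ Set.Icc a b, ‖e t‖ ≤ M t / ν := by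
    intro t ht
    have h1 : 2 * ν * ‖e t‖ ≤ 2 * M t := by
      have : ‖2 * ν * e t‖ = 2 * ν * ‖e t‖ := by
        rw [norm_mul, norm_mul, Complex.norm_real, Real.norm_of_nonneg hν.le]; norm_num
      rw [← this, show 2 * ν * e t = (2 * ν * e t + y t) - y t by ring]
      exact (norm_sub_le _ _).trans (by linarith [hu t ht, hy' t ht])
    rw [le_div_iff₀ hν]; linarith
  have hM0' : 0 ≤ M0 := by positivity
  have hMnn : ∀ t ∈ Set.Icc a b, 0 ≤ M t := fun t ht => (norm_nonneg _).trans (hy' t ht)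
  -- Gronwall: from `M' ≤ ‖R x'‖ (1 + M/ν) + 2 ‖S x'‖ M` the quantity `(exp(-2V) M/ν + 1) exp(-ρ/ν)`
  -- is nonincreasing. Keeping the `1` outside `exp(-2V)` lets the final bound have the factor
  -- `exp(ρ/ν) - 1` when the initial data vanish.
  have key := le_of_hasDerivAt_nonpos_off_finset
    (h := fun t => (Real.exp (-(2 * V t)) * (M t / ν) + 1) * Real.exp (-(ρ t / ν)))
    (h' := fun t => (Real.exp (-(2 * V t)) * -(2 * ‖S t * x' t‖) * (M t / ν) +
        Real.exp (-(2 * V t)) * (g t / ν)) * Real.exp (-(ρ t / ν)) +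
        (Real.exp (-(2 * V t)) * (M t / ν) + 1) *
          (Real.exp (-(ρ t / ν)) * -(‖R t * x' t‖ / ν))) T hab
    (by
      refine ContinuousOn.mul (((Real.continuous_exp.comp_continuousOn
        (continuousOn_const.mul hVc).neg).mul (hMc.div_const _)).add continuousOn_const)
        (Real.continuous_exp.comp_continuousOn (hρc.div_const _).neg))
    fun t ht hT => by
      refine ⟨((((((hVd t ht hT).const_mul 2).neg).exp.mul ((hMd t ht hT).div_const ν)).add_const
        1).mul ((hρd t ht hT).div_const ν).neg.exp), ?_⟩
      have ht' := Set.Ioo_subset_Icc_self ht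
      have hV0 : 0 ≤ V t := intervalIntegral.integral_nonneg ht.1.le fun _ _ => norm_nonneg _
      have hE1 : Real.exp (-(2 * V t)) ≤ 1 := Real.exp_le_one_iff.2 (by linarith)
      have hgt : g t ≤ ‖R t * x' t‖ * (1 + M t / ν) + 2 * ‖S t * x' t‖ * M t := by
        have e1 : ‖R t * (1 + e t) * x' t‖ ≤ ‖R t * x' t‖ * (1 + M t / ν) := by
          rw [show R t * (1 + e t) * x' t = R t * x' t * (1 + e t) by ring, norm_mul]
          gcongr
          exact (norm_add_le _ _).trans (by rw [norm_one]; linarith [he' t ht'])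
        have e2 : ‖S t * y t * x' t‖ ≤ ‖S t * x' t‖ * M t := by
          rw [show S t * y t * x' t = S t * x' t * y t by ring, norm_mul]
          gcongr
          exact hy' t ht'
        simp only [hg]; linarith
      have e3 : Real.exp (-(2 * V t)) * (g t / ν) ≤ Real.exp (-(2 * V t)) *
          ((‖R t * x' t‖ * (1 + M t / ν) + 2 * ‖S t * x' t‖ * M t) / ν) := by gcongr
      have e4 : Real.exp (-(2 * V t)) * (‖R t * x' t‖ / ν) ≤ 1 * (‖R t * x' t‖ / ν) := by gcongr
      have e5 : (Real.exp (-(2 * V t)) * -(2 * ‖S t * x' t‖) * (M t / ν) +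
          Real.exp (-(2 * V t)) * (g t / ν)) +
          (Real.exp (-(2 * V t)) * (M t / ν) + 1) * -(‖R t * x' t‖ / ν) ≤ 0 := by
        have : Real.exp (-(2 * V t)) *
          ((‖R t * x' t‖ * (1 + M t / ν) + 2 * ‖S t * x' t‖ * M t) / ν) =
          Real.exp (-(2 * V t)) * (‖R t * x' t‖ / ν) +
          Real.exp (-(2 * V t)) * (M t / ν) * (‖R t * x' t‖ / ν) +
          Real.exp (-(2 * V t)) * (2 * ‖S t * x' t‖) * (M t / ν) := by field_simp
        linarith
      have := mul_nonpos_of_nonpos_of_nonneg e5 (Real.exp_pos (-(ρ t / ν))).le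
      linarith
  have hVa : V a = 0 := intervalIntegral.integral_same
  have hρa : ρ a = 0 := intervalIntegral.integral_same
  simp only [hVa, hρa, hMa, mul_zero, neg_zero, Real.exp_zero, zero_div, one_mul, mul_one] at key
  have hb := he' b (Set.right_mem_Icc.2 hab)
  have e1 : Real.exp (-(2 * V b)) * (M b / ν) + 1 ≤ Real.exp (ρ b / ν) * (1 + M0 / ν) := by
    have := mul_le_mul_of_nonneg_left key (Real.exp_pos (ρ b / ν)).le
    rw [mul_comm, mul_assoc, ← Real.exp_add, neg_add_cancel, Real.exp_zero, mul_one] at this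
    linarith
  calc ‖e b‖ ≤ M b / ν := hb
    _ = Real.exp (2 * V b) * (Real.exp (-(2 * V b)) * (M b / ν)) := by
        rw [← mul_assoc, ← Real.exp_add]; simp
    _ ≤ Real.exp (2 * V b) * (Real.exp (ρ b / ν) * (1 + M0 / ν) - 1) := by
        gcongr; linarith

end

noncomputable section

open MeasureTheory

/-! ### Integrals along progressive paths -/

/-- Adjacent closed arcs share a parameter, so continuity on `[ε, τ j]` propagates by pasting; `ε >
0` is needed because the first arc is open at `0`. -/
lemma IsArcChain.continuousOn {γ : ℝ → ℂ} {z : ℂ} (h : IsArcChain γ z) :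
    ContinuousOn γ (Set.Ioc 0 1) := by
  obtain ⟨m, τ, h0, hm, hlt, harc⟩ := h.arcs
  have key : ∀ ε : ℝ, 0 < ε → ∀ j ≤ m, ContinuousOn γ (Set.Icc ε (τ j)) := by
    intro ε hε j
    induction j with
    | zero => intro _; rw [h0, Set.Icc_eq_empty (by linarith)]; exact continuousOn_empty _
    | succ j ih =>
      intro hj
      have h1 := ih (by omega)
      have h2 : ContinuousOn γ (Set.Icc (max ε (τ j)) (τ (j + 1))) :=
        (harc j (by omega)).1.continuousOn.mono fun t ht =>
          ⟨⟨(le_max_right _ _).trans ht.1, ht.2⟩, hε.trans_le ((le_max_left _ _).trans ht.1)⟩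
      refine (h1.union_of_isClosed h2 isClosed_Icc isClosed_Icc).mono fun t ht => ?_
      rcases le_total t (τ j) with h | h
      · exact Or.inl ⟨ht.1, h⟩
      · exact Or.inr ⟨max_le ht.1 h, ht.2⟩
  intro t ht
  have h1 := key (t / 2) (half_pos ht.1) m le_rfl
  rw [hm] at h1
  refine (h1 t ⟨by linarith [ht.1], ht.2⟩).mono_of_mem_nhdsWithin ?_
  refine mem_nhdsWithin.2 ⟨Set.Ioi (t / 2), isOpen_Ioi, ?_, fun u hu => ⟨le_of_lt hu.1, hu.2.2⟩⟩
  exact half_lt_self ht.1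

lemma IsArcChain.exists_finset {γ : ℝ → ℂ} {z : ℂ} (h : IsArcChain γ z) :
    ∃ T : Finset ℝ, ∀ t ∈ Set.Ioo (0 : ℝ) 1, t ∉ T → ContDiffAt ℝ 2 γ t := by
  obtain ⟨m, τ, h0, hm, hlt, harc⟩ := h.arcs
  refine ⟨(Finset.range (m + 1)).image τ, fun t ht hT => ?_⟩
  have key : ∀ j ≤ m, t ≤ τ j → ∃ i < m, τ i < t ∧ t ≤ τ (i + 1) := by
    intro j
    induction j with
    | zero => intro _ h; rw [h0] at h; exact absurd ht.1 (not_lt.2 h)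
    | succ j ih =>
      intro hj htj
      by_cases hc : t ≤ τ j
      · exact ih (by omega) hc
      · exact ⟨j, by omega, not_le.1 hc, htj⟩
  obtain ⟨i, him, h1, h2⟩ := key m le_rfl (by rw [hm]; exact ht.2.le)
  have h3 : t ≠ τ (i + 1) := fun h =>
    hT (Finset.mem_image.2 ⟨i + 1, Finset.mem_range.2 (by omega), h.symm⟩)
  exact (harc i him).1.contDiffAt
    (Filter.inter_mem (Icc_mem_nhds h1 (lt_of_le_of_ne h2 h3)) (Ioi_mem_nhds ht.1))

lemma hasDerivAt_comp_path {f : ℂ → ℂ} {f' : ℂ} {γ : ℝ → ℂ} {t : ℝ} (hf : HasDerivAt f f' (γ t))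
    (hγ : DifferentiableAt ℝ γ t) : HasDerivAt (fun u => f (γ u)) (f' * deriv γ t) t :=
  hf.comp t hγ.hasDerivAt

lemma deriv_pVar_path {γ : ℝ → ℂ} {t : ℝ} (hz : γ t ∈ cutPlane) (hγ : DifferentiableAt ℝ γ t) :
    deriv (fun u => pVar (γ u)) t = -γ t / sqrtBr (γ t) ^ 3 * deriv γ t :=
  (hasDerivAt_comp_path (hasDerivAt_pVar (cutPlane_sub_I hz) (cutPlane_add_I hz)) hγ).deriv

lemma continuousAt_deriv_pVar_path {γ : ℝ → ℂ} {t : ℝ} (hz : γ t ∈ cutPlane)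
    (hγ : ContDiffAt ℝ 2 γ t) : ContinuousAt (deriv fun u => pVar (γ u)) t := by
  have hs := sqrtBr_ne_zero (cutPlane_sub_I hz) (cutPlane_add_I hz)
  have hc : ContinuousAt sqrtBr (γ t) :=
    (hasDerivAt_sqrtBr (cutPlane_sub_I hz) (cutPlane_add_I hz)).continuousAt
  have hcs : ContinuousAt (fun u => sqrtBr (γ u)) t :=
    ContinuousAt.comp (f := γ) hc hγ.continuousAt
  have hd : ContinuousAt (deriv γ) t := by
    have h1 := hγ.continuousAt_fderiv two_ne_zero
    exact h1.clm_apply continuousAt_const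
  have h2 : ContinuousAt (fun t => -γ t / sqrtBr (γ t) ^ 3 * deriv γ t) t :=
    (hγ.continuousAt.neg.div (hcs.pow 3) (pow_ne_zero 3 hs)).mul hd
  refine h2.congr ?_
  have h3 : ∀ᶠ u in nhds t, γ u ∈ cutPlane := hγ.continuousAt (isOpen_cutPlane.mem_nhds hz)
  filter_upwards [h3, hγ.eventually (by decide)] with u hu hu'
  exact (deriv_pVar_path hu (hu'.differentiableAt two_ne_zero)).symm

lemma continuousOn_pVar : ContinuousOn pVar cutPlane := fun _ hz =>
  (hasDerivAt_pVar (cutPlane_sub_I hz) (cutPlane_add_I hz)).continuousAt.continuousWithinAt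

lemma continuousOn_xi : ContinuousOn xi cutPlane := fun _ hz =>
  (hasDerivAt_xi hz).continuousAt.continuousWithinAt

lemma IsArcChain.continuousOn_pVar {γ : ℝ → ℂ} {z : ℂ} (h : IsArcChain γ z) :
    ContinuousOn (fun t => pVar (γ t)) (Set.Ioc 0 1) :=
  BesselLG.continuousOn_pVar.comp h.continuousOn h.mem

/-- No point of the image is farther from the endpoint than the total length, which is finite. This
boundedness of `q` makes all integrands of `ω` and `ϖ` integrable. -/
lemma IsArcChain.norm_pVar_le {γ : ℝ → ℂ} {z : ℂ} (h : IsArcChain γ z) :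
    ∃ C : ℝ, ∀ t ∈ Set.Ioc (0 : ℝ) 1, ‖pVar (γ t)‖ ≤ C := by
  obtain ⟨T, hT⟩ := h.exists_finset
  refine ⟨‖pVar (γ 1)‖ + ∫ t in Set.Ioo (0 : ℝ) 1, ‖deriv (fun t => pVar (γ t)) t‖, fun t ht => ?_⟩
  have hint : IntervalIntegrable (fun t => ‖deriv (fun t => pVar (γ t)) t‖) volume t 1 := by
    rw [intervalIntegrable_iff_integrableOn_Ioo_of_le ht.2]
    exact IntegrableOn.mono_set h.rectifiable.norm (Set.Ioo_subset_Ioo ht.1.le le_rfl)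
  obtain ⟨hc, hd⟩ := primitive_off_finset T ht.2 hint fun u hu hu' =>
    (continuousAt_deriv_pVar_path (h.mem u ⟨ht.1.trans hu.1, hu.2.le⟩)
      (hT u ⟨ht.1.trans hu.1, hu.2⟩ hu')).norm
  have key := norm_sub_le_off_finset (G := fun t => pVar (γ t))
    (G' := deriv fun t => pVar (γ t)) T ht.2
    (h.continuousOn_pVar.mono fun u hu => ⟨ht.1.trans_le hu.1, hu.2⟩) hc
    fun u hu hu' => by
      have hu2 : u ∈ Set.Ioo (0 : ℝ) 1 := ⟨ht.1.trans hu.1, hu.2⟩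
      refine ⟨DifferentiableAt.hasDerivAt ?_, hd u hu hu', le_rfl⟩
      have hz := h.mem u ⟨hu2.1, hu2.2.le⟩
      exact (hasDerivAt_comp_path (hasDerivAt_pVar (cutPlane_sub_I hz) (cutPlane_add_I hz))
        ((hT u hu2 hu').differentiableAt two_ne_zero)).differentiableAt
  rw [intervalIntegral.integral_same, sub_zero] at key
  have h2 := norm_sub_norm_le (pVar (γ t)) (pVar (γ 1))
  rw [norm_sub_rev] at h2
  have h3 : ∫ u in t..1, ‖deriv (fun t => pVar (γ t)) u‖ ≤
      ∫ t in Set.Ioo (0 : ℝ) 1, ‖deriv (fun t => pVar (γ t)) t‖ := by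
    rw [intervalIntegral.integral_of_le ht.2, integral_Ioc_eq_integral_Ioo]
    exact setIntegral_mono_set h.rectifiable.norm (Filter.Eventually.of_forall fun _ =>
      norm_nonneg _) (Set.Ioo_subset_Ioo ht.1.le le_rfl).eventuallyLE
  linarith

lemma norm_aeval_le (Q : Polynomial ℝ) (C : ℝ) :
    ∃ B : ℝ, 0 ≤ B ∧ ∀ q : ℂ, ‖q‖ ≤ C → ‖Polynomial.aeval q Q‖ ≤ B := by
  obtain ⟨B, hB⟩ := (isCompact_closedBall (0 : ℂ) C).exists_bound_of_continuousOn
    (Q.continuous_aeval (A := ℂ)).continuousOn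
  refine ⟨max B 0, le_max_right _ _, fun q hq => ?_⟩
  exact (hB q (by simpa using hq)).trans (le_max_left _ _)

/-- A multiple of `X² (1 - X²)` has bounded quotient by the weight on bounded sets. -/
lemma norm_overWeight_le {Q : Polynomial ℝ}
    (hQ : (Polynomial.X ^ 2 * (1 - Polynomial.X ^ 2) : Polynomial ℝ) ∣ Q) (C : ℝ) :
    ∃ B : ℝ, 0 ≤ B ∧ ∀ q : ℂ, q ^ 2 * (1 - q ^ 2) ≠ 0 → ‖q‖ ≤ C → ‖overWeight Q q‖ ≤ B := by
  obtain ⟨P, rfl⟩ := hQ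
  obtain ⟨B, hB0, hB⟩ := norm_aeval_le P C
  exact ⟨B, hB0, fun q hq hqC => by rw [overWeight_mul _ hq]; exact hB q hqC⟩

lemma continuousOn_overWeight (Q : Polynomial ℝ) :
    ContinuousOn (overWeight Q) {q | q ^ 2 * (1 - q ^ 2) ≠ 0} := by
  have := (Q.continuous_aeval (A := ℂ)).continuousOn (s := {q | q ^ 2 * (1 - q ^ 2) ≠ 0})
  exact this.div (by fun_prop) fun q hq => hq

lemma IsArcChain.integrableOn {γ : ℝ → ℂ} {z : ℂ} (h : IsArcChain γ z) {Q : Polynomial ℝ}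
    (hQ : (Polynomial.X ^ 2 * (1 - Polynomial.X ^ 2) : Polynomial ℝ) ∣ Q) :
    IntegrableOn (fun t => ‖overWeight Q (pVar (γ t))‖ * ‖deriv (fun u => pVar (γ u)) t‖)
      (Set.Ioo 0 1) := by
  obtain ⟨C, hC⟩ := h.norm_pVar_le
  obtain ⟨B, hB0, hB⟩ := norm_overWeight_le hQ C
  have hc : ContinuousOn (fun t => ‖overWeight Q (pVar (γ t))‖) (Set.Ioo 0 1) :=
    ((continuousOn_overWeight Q).comp (h.continuousOn_pVar.mono Set.Ioo_subset_Ioc_self)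
      fun t ht => pVar_weight_ne_zero (h.mem t (Set.Ioo_subset_Ioc_self ht))).norm
  refine Integrable.mono' (h.rectifiable.norm.const_mul B)
    ((hc.aestronglyMeasurable measurableSet_Ioo).mul h.rectifiable.norm.aestronglyMeasurable) ?_
  rw [ae_restrict_iff' measurableSet_Ioo]
  refine Filter.Eventually.of_forall fun t ht => ?_
  rw [norm_mul, norm_norm, norm_norm]
  have ht' := Set.Ioo_subset_Ioc_self ht
  gcongr
  exact hB _ (pVar_weight_ne_zero (h.mem t ht')) (hC t ht')

/-- The derivative of `ξ` along a path. -/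
def xiDeriv (γ : ℝ → ℂ) (t : ℝ) : ℂ :=
  -(deriv (fun u => pVar (γ u)) t) / (pVar (γ t) ^ 2 * (1 - pVar (γ t) ^ 2))

lemma xiDeriv_eq {γ : ℝ → ℂ} {t : ℝ} (hz : γ t ∈ cutPlane) (hγ : DifferentiableAt ℝ γ t) :
    xiDeriv γ t = sqrtBr (γ t) / γ t * deriv γ t := by
  have hs := sqrtBr_ne_zero (cutPlane_sub_I hz) (cutPlane_add_I hz)
  have hz0 := cutPlane_ne_zero hz
  rw [xiDeriv, deriv_pVar_path hz hγ, pVar_weight hz]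
  field_simp

/-- Translates integrals in `ξ` into integrals over the image in the `q`-plane; the sign of `dξ =
-dq/(q²(1-q²))` is lost in the norm. -/
lemma norm_aeval_mul_xiDeriv (Q : Polynomial ℝ) (γ : ℝ → ℂ) (t : ℝ) :
    ‖Polynomial.aeval (pVar (γ t)) Q * xiDeriv γ t‖ =
      ‖overWeight Q (pVar (γ t))‖ * ‖deriv (fun u => pVar (γ u)) t‖ := by
  rw [← norm_mul, xiDeriv, overWeight, ← norm_neg]
  congr 1
  ring

lemma continuousOn_vFun (N : ℕ) (μ : ℂ) : Continuous (vFun N μ) := by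
  unfold vFun
  refine continuous_const.add (continuous_finsetSum _ fun s _ => ?_)
  exact ((Ftilde s).continuous_aeval (A := ℂ)).div_const _

lemma continuous_residual (N : ℕ) (μ : ℂ) : Continuous (residual N μ) := by
  unfold residual
  refine (((continuous_const.mul ((Ftilde N).continuous_aeval (A := ℂ))).div_const _)).sub
    (continuous_finsetSum _ fun s _ => ?_)
  exact ((Gtilde N s).continuous_aeval (A := ℂ)).div_const _

lemma intervalIntegral_le_absIntegral {γ : ℝ → ℂ} {z : ℂ} (h : IsArcChain γ z) {Q : Polynomial ℝ}
    (hQ : (Polynomial.X ^ 2 * (1 - Polynomial.X ^ 2) : Polynomial ℝ) ∣ Q) {a : ℝ}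
    (ha : a ∈ Set.Ioo (0 : ℝ) 1) :
    IntervalIntegrable (fun t => ‖overWeight Q (pVar (γ t))‖ * ‖deriv (fun u => pVar (γ u)) t‖)
      volume a 1 ∧
    ∫ t in a..1, ‖overWeight Q (pVar (γ t))‖ * ‖deriv (fun u => pVar (γ u)) t‖ ≤
      absIntegral γ Q := by
  have hi := h.integrableOn hQ
  refine ⟨?_, ?_⟩
  · rw [intervalIntegrable_iff_integrableOn_Ioo_of_le ha.2.le]
    exact hi.mono_set (Set.Ioo_subset_Ioo ha.1.le le_rfl)
  · rw [intervalIntegral.integral_of_le ha.2.le, integral_Ioc_eq_integral_Ioo]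
    exact setIntegral_mono_set hi (Filter.Eventually.of_forall fun _ =>
      mul_nonneg (norm_nonneg _) (norm_nonneg _)) (Set.Ioo_subset_Ioo ha.1.le le_rfl).eventuallyLE

lemma absIntegral_nonneg (γ : ℝ → ℂ) (Q : Polynomial ℝ) : 0 ≤ absIntegral γ Q :=
  integral_nonneg fun _ => mul_nonneg (norm_nonneg _) (norm_nonneg _)

/-- The residual starts at order `ν^{-(N-1)}`; the missing power of `ν` is the division by `ν` in
the Gronwall estimate. Discarding the part of the path before `a` only decreases the integrals. -/
lemma integral_residual_le {γ : ℝ → ℂ} {z : ℂ} (h : IsArcChain γ z) {N : ℕ} (hN : 1 ≤ N)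
    {ν : ℝ} (hν : 0 < ν) {μ : ℂ} (hμ : ‖μ‖ = ν) {σ : ℂ} (hσ : ‖σ‖ = 1) {a : ℝ}
    (ha : a ∈ Set.Ioo (0 : ℝ) 1)
    (hint : IntervalIntegrable (fun t => ‖residual N μ (pVar (γ t)) * (σ * xiDeriv γ t)‖)
      volume a 1) :
    (∫ t in a..1, ‖residual N μ (pVar (γ t)) * (σ * xiDeriv γ t)‖) / ν ≤
      omegaErr N ν γ / ν ^ N := by
  obtain ⟨n, rfl⟩ : ∃ n, N = n + 1 := ⟨N - 1, by omega⟩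
  set A : Polynomial ℝ → ℝ → ℝ := fun Q t =>
    ‖overWeight Q (pVar (γ t))‖ * ‖deriv (fun u => pVar (γ u)) t‖ with hA
  have hF := intervalIntegral_le_absIntegral h (dvd_Ftilde (n + 1)) ha
  have hG := fun s => intervalIntegral_le_absIntegral h (dvd_Gtilde (n + 1) s) ha
  have hpt : ∀ t ∈ Set.Icc a 1, ‖residual (n + 1) μ (pVar (γ t)) * (σ * xiDeriv γ t)‖ ≤
      2 / ν ^ n * A (Ftilde (n + 1)) t +
        ∑ s ∈ Finset.Icc 1 n, 1 / ν ^ (n + s) * A (Gtilde (n + 1) s) t := by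
    intro t _
    have e : residual (n + 1) μ (pVar (γ t)) * (σ * xiDeriv γ t) =
        σ * (2 / μ ^ n * (Polynomial.aeval (pVar (γ t)) (Ftilde (n + 1)) * xiDeriv γ t) -
          ∑ s ∈ Finset.Icc 1 n, 1 / μ ^ (n + s) *
            (Polynomial.aeval (pVar (γ t)) (Gtilde (n + 1) s) * xiDeriv γ t)) := by
      rw [residual, Nat.add_sub_cancel, sub_mul, mul_sub, Finset.sum_mul, Finset.mul_sum]
      congr 1
      · ring
      · exact Finset.sum_congr rfl fun s _ => by ring
    rw [e, norm_mul, hσ, one_mul]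
    refine (norm_sub_le _ _).trans (add_le_add (le_of_eq ?_)
      ((norm_sum_le _ _).trans (Finset.sum_le_sum fun s _ => le_of_eq ?_)))
    · rw [norm_mul, norm_aeval_mul_xiDeriv, norm_div, norm_pow, hμ]; norm_num [hA]
    · rw [norm_mul, norm_aeval_mul_xiDeriv, norm_div, norm_pow, hμ]; norm_num [hA]
  have hi1 : IntervalIntegrable (fun t => 2 / ν ^ n * A (Ftilde (n + 1)) t) volume a 1 :=
    hF.1.const_mul _
  have hi2 : ∀ s ∈ Finset.Icc 1 n, IntervalIntegrable
      (fun t => 1 / ν ^ (n + s) * A (Gtilde (n + 1) s) t) volume a 1 :=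
    fun s _ => (hG s).1.const_mul _
  have hi2' : IntervalIntegrable (fun t => ∑ s ∈ Finset.Icc 1 n,
      1 / ν ^ (n + s) * A (Gtilde (n + 1) s) t) volume a 1 := by
    have := IntervalIntegrable.sum _ hi2
    simpa [Finset.sum_fn] using this
  have hle := intervalIntegral.integral_mono_on ha.2.le hint (hi1.add hi2') hpt
  rw [intervalIntegral.integral_add hi1 hi2', intervalIntegral.integral_finsetSum hi2,
    intervalIntegral.integral_const_mul] at hle
  simp only [intervalIntegral.integral_const_mul] at hle
  have hle2 : ∫ t in a..1, ‖residual (n + 1) μ (pVar (γ t)) * (σ * xiDeriv γ t)‖ ≤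
      2 / ν ^ n * absIntegral γ (Ftilde (n + 1)) +
        ∑ s ∈ Finset.Icc 1 n, 1 / ν ^ (n + s) * absIntegral γ (Gtilde (n + 1) s) := by
    refine hle.trans (add_le_add ?_ (Finset.sum_le_sum fun s _ => ?_))
    · exact mul_le_mul_of_nonneg_left hF.2 (by positivity)
    · exact mul_le_mul_of_nonneg_left (hG s).2 (by positivity)
  have e : omegaErr (n + 1) ν γ / ν ^ (n + 1) = (2 / ν ^ n * absIntegral γ (Ftilde (n + 1)) +
        ∑ s ∈ Finset.Icc 1 n, 1 / ν ^ (n + s) * absIntegral γ (Gtilde (n + 1) s)) / ν := by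
    rw [omegaErr, Nat.add_sub_cancel, pow_succ, ← div_div, add_div, Finset.sum_div]
    congr 2
    · ring
    · refine Finset.sum_congr rfl fun s _ => ?_
      rw [pow_add]; field_simp
  rw [e]
  gcongr

lemma integral_vFun_le {γ : ℝ → ℂ} {z : ℂ} (h : IsArcChain γ z) (N : ℕ)
    {ν : ℝ} (hν : 0 < ν) {μ : ℂ} (hμ : ‖μ‖ = ν) {σ : ℂ} (hσ : ‖σ‖ = 1) {a : ℝ}
    (ha : a ∈ Set.Ioo (0 : ℝ) 1)
    (hint : IntervalIntegrable
      (fun t => ‖σ * (vFun N μ (pVar (γ t)) - μ) * (σ * xiDeriv γ t)‖) volume a 1) :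
    2 * ∫ t in a..1, ‖σ * (vFun N μ (pVar (γ t)) - μ) * (σ * xiDeriv γ t)‖ ≤
      varpiErr N ν γ / ν := by
  set A : Polynomial ℝ → ℝ → ℝ := fun Q t =>
    ‖overWeight Q (pVar (γ t))‖ * ‖deriv (fun u => pVar (γ u)) t‖ with hA
  have hF := fun s => intervalIntegral_le_absIntegral h (dvd_Ftilde s) ha
  have hpt : ∀ t ∈ Set.Icc a 1, ‖σ * (vFun N μ (pVar (γ t)) - μ) * (σ * xiDeriv γ t)‖ ≤
      ∑ s ∈ Finset.Ico 1 N, 1 / ν ^ s * A (Ftilde s) t := by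
    intro t _
    have e : σ * (vFun N μ (pVar (γ t)) - μ) * (σ * xiDeriv γ t) = σ * (σ *
        ∑ s ∈ Finset.Ico 1 N, 1 / μ ^ s *
            (Polynomial.aeval (pVar (γ t)) (Ftilde s) * xiDeriv γ t)) := by
      rw [vFun, add_sub_cancel_left, show ∀ S : ℂ, σ * S * (σ * xiDeriv γ t) =
        σ * (σ * (S * xiDeriv γ t)) from fun S => by ring, Finset.sum_mul]
      congr 2
      exact Finset.sum_congr rfl fun s _ => by ring
    rw [e, norm_mul, hσ, one_mul, norm_mul, hσ, one_mul]
    refine (norm_sum_le _ _).trans (Finset.sum_le_sum fun s _ => le_of_eq ?_)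
    rw [norm_mul, norm_aeval_mul_xiDeriv, norm_div, norm_pow, hμ]; norm_num [hA]
  have hi2 : ∀ s ∈ Finset.Ico 1 N, IntervalIntegrable
      (fun t => 1 / ν ^ s * A (Ftilde s) t) volume a 1 :=
    fun s _ => (hF s).1.const_mul _
  have hi2' : IntervalIntegrable (fun t => ∑ s ∈ Finset.Ico 1 N,
      1 / ν ^ s * A (Ftilde s) t) volume a 1 := by
    have := IntervalIntegrable.sum _ hi2
    simpa [Finset.sum_fn] using this
  have hle := intervalIntegral.integral_mono_on ha.2.le hint hi2' hpt
  rw [intervalIntegral.integral_finsetSum hi2] at hle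
  simp only [intervalIntegral.integral_const_mul] at hle
  have hle2 : ∑ s ∈ Finset.Ico 1 N, 1 / ν ^ s * ∫ t in a..1, A (Ftilde s) t ≤
      ∑ s ∈ Finset.Ico 1 N, 1 / ν ^ s * absIntegral γ (Ftilde s) :=
    Finset.sum_le_sum fun s _ => mul_le_mul_of_nonneg_left (hF s).2 (by positivity)
  -- The estimate above needs only the factor `2` here; the constant `4` in `ϖ` leaves room.
  have e : varpiErr N ν γ / ν = 4 * ∑ s ∈ Finset.Ico 1 N, 1 / ν ^ s * absIntegral γ (Ftilde s) := by
    rw [varpiErr, Finset.sum_div, Finset.sum_Ico_eq_sum_range, Finset.mul_sum]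
    refine Finset.sum_congr rfl fun s _ => ?_
    rw [add_comm 1 s, pow_succ]; field_simp
  have hnn : 0 ≤ ∑ s ∈ Finset.Ico 1 N, 1 / ν ^ s * absIntegral γ (Ftilde s) :=
    Finset.sum_nonneg fun s _ => mul_nonneg (by positivity) (absIntegral_nonneg _ _)
  rw [e]
  linarith

set_option maxHeartbeats 1000000 in
/-- Error bound along a progressive path, for any solution `(e, y)` of the first-order system
satisfied by the relative error whose initial values vanish. Here `σ = ±1`. -/
theorem norm_error_le_of_path {ν : ℝ} (hν : 0 < ν) {σ : ℝ} (hσ : σ ^ 2 = 1) {N : ℕ} (hN : 1 ≤ N)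
    {e y : ℂ → ℂ}
    (he : ∀ z ∈ cutPlane, HasDerivAt e (y z * (σ * (sqrtBr z / z))) z)
    (hy : ∀ z ∈ cutPlane, HasDerivAt y ((residual N (σ * ν) (pVar z) * (1 + e z) -
      2 * (σ * vFun N (σ * ν) (pVar z)) * y z) * (σ * (sqrtBr z / z))) z)
    {γ : ℝ → ℂ} {z : ℂ} (hγ : IsArcChain γ z)
    (hmono : MonotoneOn (fun t => σ * (xi (γ t)).re) (Set.Ioc 0 1))
    (he0 : Filter.Tendsto (fun t => e (γ t)) (nhdsWithin 0 (Set.Ioi 0)) (nhds 0))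
    (hy0 : Filter.Tendsto (fun t => y (γ t)) (nhdsWithin 0 (Set.Ioi 0)) (nhds 0)) :
    ‖e z‖ ≤ omegaErr N ν γ / ν ^ N * Real.exp (varpiErr N ν γ / ν + omegaErr N ν γ / ν ^ N) := by
  obtain ⟨T, hT⟩ := hγ.exists_finset
  have hσabs : ‖(σ : ℂ)‖ = 1 := by
    rw [Complex.norm_real, Real.norm_eq_abs]
    rw [← Real.sqrt_sq_eq_abs, hσ, Real.sqrt_one]
  have hσσ : (σ : ℂ) * σ = 1 := by rw [← sq]; exact_mod_cast hσ
  have hμ : ‖(σ : ℂ) * ν‖ = ν := by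
    rw [norm_mul, hσabs, one_mul, Complex.norm_real, Real.norm_of_nonneg hν.le]
  have hcomp {f : ℂ → ℂ} (hf : ContinuousOn f cutPlane) {a : ℝ} (ha : 0 < a) :
      ContinuousOn (fun t => f (γ t)) (Set.Icc a 1) :=
    hf.comp (hγ.continuousOn.mono fun t ht => ⟨ha.trans_le ht.1, ht.2⟩)
      fun t ht => hγ.mem t ⟨ha.trans_le ht.1, ht.2⟩
  -- The start of the path is a singular point, so the estimate is applied on `[a, 1]` with bounds
  -- independent of `a` except for the initial data, and then `a → 0`.
  have hbound : ∀ a ∈ Set.Ioo (0 : ℝ) 1, ‖e z‖ ≤ Real.exp (varpiErr N ν γ / ν) *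
      (Real.exp (omegaErr N ν γ / ν ^ N) *
        (1 + (‖2 * ν * e (γ a) + y (γ a)‖ + ‖y (γ a)‖) / ν) - 1) := by
    intro a ha
    have hx'i : IntervalIntegrable (fun t => σ * xiDeriv γ t) volume a 1 := by
      have h1 : IntervalIntegrable (deriv fun t => pVar (γ t)) volume a 1 := by
        rw [intervalIntegrable_iff_integrableOn_Ioo_of_le ha.2.le]
        exact hγ.rectifiable.mono_set (Set.Ioo_subset_Ioo ha.1.le le_rfl)
      have h2 : ContinuousOn
          (fun t => -(σ : ℂ) / (pVar (γ t) ^ 2 * (1 - pVar (γ t) ^ 2))) (Set.uIcc a 1) := by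
        rw [Set.uIcc_of_le ha.2.le]
        have h3 := hcomp continuousOn_pVar ha.1
        exact continuousOn_const.div ((h3.pow 2).mul (continuousOn_const.sub (h3.pow 2)))
          fun t ht => pVar_weight_ne_zero (hγ.mem t ⟨ha.1.trans_le ht.1, ht.2⟩)
      refine (h1.continuousOn_mul h2).congr fun t _ => ?_
      simp only [xiDeriv]
      ring
    have hd : ∀ t ∈ Set.Ioo a 1, t ∉ T → γ t ∈ cutPlane ∧ ContDiffAt ℝ 2 γ t :=
      fun t ht htT => ⟨hγ.mem t ⟨ha.1.trans ht.1, ht.2.le⟩, hT t ⟨ha.1.trans ht.1, ht.2⟩ htT⟩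
    have hx'c : ∀ t ∈ Set.Ioo a 1, t ∉ T → ContinuousAt (fun t => σ * xiDeriv γ t) t := by
      intro t ht htT
      obtain ⟨h1, h2⟩ := hd t ht htT
      have h3 : ContinuousAt (fun t => pVar (γ t)) t :=
        (hγ.continuousOn_pVar.continuousAt (Ioc_mem_nhds (ha.1.trans ht.1) ht.2))
      exact continuousAt_const.mul ((continuousAt_deriv_pVar_path h1 h2).neg.div
        ((h3.pow 2).mul (continuousAt_const.sub (h3.pow 2))) (pVar_weight_ne_zero h1))
    have hec : ContinuousOn e cutPlane := fun w hw => (he w hw).continuousAt.continuousWithinAt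
    have hyc : ContinuousOn y cutPlane := fun w hw => (hy w hw).continuousAt.continuousWithinAt
    have hRc : ContinuousOn (fun w => residual N (σ * ν) (pVar w)) cutPlane :=
      (continuous_residual N _).comp_continuousOn continuousOn_pVar
    have hSc : ContinuousOn (fun w => σ * (vFun N (σ * ν) (pVar w) - σ * ν)) cutPlane :=
      continuousOn_const.mul
        (((continuousOn_vFun N _).comp_continuousOn continuousOn_pVar).sub continuousOn_const)
    have key := norm_error_le (x := fun t => σ * xi (γ t)) (e := fun t => e (γ t))
      (y := fun t => y (γ t)) (x' := fun t => σ * xiDeriv γ t)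
      (R := fun t => residual N (σ * ν) (pVar (γ t)))
      (S := fun t => σ * (vFun N (σ * ν) (pVar (γ t)) - σ * ν)) ha.2.le hν T
      (continuousOn_const.mul (hcomp continuousOn_xi ha.1)) (hcomp hec ha.1) (hcomp hyc ha.1)
      (hcomp hRc ha.1) (hcomp hSc ha.1) hx'i hx'c
      (by
        intro s hs t ht hst
        simpa using hmono ⟨ha.1.trans_le hs.1, hs.2⟩ ⟨ha.1.trans_le ht.1, ht.2⟩ hst)
      (fun t ht htT => by
        obtain ⟨h1, h2⟩ := hd t ht htT
        have h3 := h2.differentiableAt two_ne_zero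
        rw [xiDeriv_eq h1 h3]
        exact (hasDerivAt_comp_path (hasDerivAt_xi h1) h3).const_mul _)
      (fun t ht htT => by
        obtain ⟨h1, h2⟩ := hd t ht htT
        have h3 := h2.differentiableAt two_ne_zero
        rw [xiDeriv_eq h1 h3]
        refine (hasDerivAt_comp_path (he _ h1) h3).congr_deriv ?_
        ring)
      (fun t ht htT => by
        obtain ⟨h1, h2⟩ := hd t ht htT
        have h3 := h2.differentiableAt two_ne_zero
        rw [xiDeriv_eq h1 h3]
        refine (hasDerivAt_comp_path (hy _ h1) h3).congr_deriv ?_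
        have : (ν : ℂ) + σ * (vFun N (σ * ν) (pVar (γ t)) - σ * ν) =
            σ * vFun N (σ * ν) (pVar (γ t)) := by
          linear_combination -(ν : ℂ) * hσσ
        rw [this]
        ring)
    have hnorm {f : ℂ → ℂ} (hf : ContinuousOn f cutPlane) : IntervalIntegrable
        (fun t => ‖f (γ t) * (σ * xiDeriv γ t)‖) volume a 1 :=
      (hx'i.continuousOn_mul (by rw [Set.uIcc_of_le ha.2.le]; exact hcomp hf ha.1)).norm
    have iS : IntervalIntegrable (fun t => ‖σ * (vFun N (σ * ν) (pVar (γ t)) - σ * ν) *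
        (σ * xiDeriv γ t)‖) volume a 1 :=
      hnorm (f := fun w => σ * (vFun N (σ * ν) (pVar w) - σ * ν)) hSc
    have iR : IntervalIntegrable (fun t => ‖residual N (σ * ν) (pVar (γ t)) *
        (σ * xiDeriv γ t)‖) volume a 1 :=
      hnorm (f := fun w => residual N (σ * ν) (pVar w)) hRc
    have hV := integral_vFun_le hγ N hν hμ hσabs ha iS
    have hρ := integral_residual_le hγ hN hν hμ hσabs ha iR
    simp only [hγ.endpoint] at key
    refine key.trans ?_
    have h0 : (0 : ℝ) ≤ (‖2 * ν * e (γ a) + y (γ a)‖ + ‖y (γ a)‖) / ν := by positivity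
    have h1 : (0 : ℝ) ≤ (∫ t in a..1, ‖residual N (σ * ν) (pVar (γ t)) * (σ * xiDeriv γ t)‖) / ν :=
      div_nonneg (intervalIntegral.integral_nonneg ha.2.le fun _ _ => norm_nonneg _) hν.le
    refine mul_le_mul (Real.exp_le_exp.2 hV) ?_ ?_ (Real.exp_pos _).le
    · have := Real.exp_le_exp.2 hρ
      gcongr
    · have := Real.one_le_exp h1
      nlinarith
  have hlim : Filter.Tendsto (fun a => Real.exp (varpiErr N ν γ / ν) *
      (Real.exp (omegaErr N ν γ / ν ^ N) *
        (1 + (‖2 * ν * e (γ a) + y (γ a)‖ + ‖y (γ a)‖) / ν) - 1)) (nhdsWithin 0 (Set.Ioi 0))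
      (nhds (Real.exp (varpiErr N ν γ / ν) * (Real.exp (omegaErr N ν γ / ν ^ N) *
        (1 + (‖2 * ν * (0 : ℂ) + 0‖ + ‖(0 : ℂ)‖) / ν) - 1))) :=
    ((((((he0.const_mul (2 * (ν : ℂ))).add hy0).norm.add hy0.norm).div_const ν).const_add
      1).const_mul _ |>.sub_const 1).const_mul _
  have hfin := ge_of_tendsto hlim (Filter.eventually_of_mem (Ioo_mem_nhdsGT one_pos) hbound)
  simp only [mul_zero, add_zero, norm_zero, zero_div, mul_one] at hfin
  refine hfin.trans ?_
  rw [Real.exp_add]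
  set w := omegaErr N ν γ / ν ^ N with hw
  -- This is `1 - w ≤ exp(-w)` multiplied by `exp w`.
  have hexp : Real.exp w - 1 ≤ w * Real.exp w := by
    have h1 := Real.add_one_le_exp (-w)
    have h2 : Real.exp w * Real.exp (-w) = 1 := by rw [← Real.exp_add]; simp
    nlinarith [Real.exp_pos w]
  nlinarith [Real.exp_pos (varpiErr N ν γ / ν)]

end

noncomputable section

/-! ### The relative error of a Liouville--Green approximation -/

/-- The Liouville--Green exponent. -/
def lgExponent (μ : ℂ) (κ : ℕ → ℂ) (N : ℕ) (z : ℂ) : ℂ :=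
  μ * xi z + ∑ s ∈ Finset.Ico 1 N, (Etilde s (pVar z) - κ s) / μ ^ s

/-- That is, `dE_s/dξ = F_s`: the minus sign in the definition of `E_s` cancels that of `dp/dξ`. -/
lemma hasDerivAt_Etilde_pVar (s : ℕ) {z : ℂ} (hz : z ∈ cutPlane) :
    HasDerivAt (fun z => Etilde s (pVar z))
      (sqrtBr z / z * Polynomial.aeval (pVar z) (Ftilde s)) z := by
  have hs := sqrtBr_ne_zero (cutPlane_sub_I hz) (cutPlane_add_I hz)
  have hz0 := cutPlane_ne_zero hz
  simp only [Etilde_eq]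
  refine (((Epoly s).hasDerivAt_aeval (pVar z)).comp z
    (hasDerivAt_pVar (cutPlane_sub_I hz) (cutPlane_add_I hz))).congr_deriv ?_
  rw [derivative_Epoly, Ftilde_eq]
  simp only [map_mul, map_pow, map_sub, map_one, map_neg, Polynomial.aeval_X]
  rw [pVar_weight hz]
  field_simp

lemma hasDerivAt_lgExponent (μ : ℂ) (κ : ℕ → ℂ) (N : ℕ) {z : ℂ} (hz : z ∈ cutPlane) :
    HasDerivAt (lgExponent μ κ N) (sqrtBr z / z * vFun N μ (pVar z)) z := by
  have h := ((hasDerivAt_xi hz).const_mul μ).add (HasDerivAt.fun_sum (u := Finset.Ico 1 N)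
    fun s _ => ((hasDerivAt_Etilde_pVar s hz).sub_const (κ s)).div_const (μ ^ s))
  refine HasDerivAt.congr_deriv (f := lgExponent μ κ N) h ?_
  rw [vFun, mul_add, Finset.mul_sum]
  congr 1
  · ring
  · exact Finset.sum_congr rfl fun s _ => by ring

lemma hasDerivAt_vFun (N : ℕ) (μ q : ℂ) : HasDerivAt (vFun N μ)
    (∑ s ∈ Finset.Ico 1 N, Polynomial.aeval q (Polynomial.derivative (Ftilde s)) / μ ^ s) q :=
  (HasDerivAt.fun_sum fun s _ => ((Ftilde s).hasDerivAt_aeval q).div_const (μ ^ s)).const_add μ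

/-- The change of variables from the Bessel equation in `z` to the equation `e'' = R(1+e) - 2ve'` in
`ξ`, reduced to field arithmetic. Here `B1` stands for `B'`, `d` for the sum of the `F_s'/μ^s`, and
the hypothesis on `R` contains `2F₁` written in `z` and `s`. -/
lemma relError_algebra {z s B B1 v d R ν : ℂ} (hz : z ≠ 0) (hs : s ≠ 0) (h : s ^ 2 = 1 + z ^ 2)
    (hd : ν ^ 2 + 2 * (1 / 8 * (z ^ 2 / s ^ 4) * (5 * (s⁻¹) ^ 2 - 1)) + z ^ 2 / s ^ 4 * d - v ^ 2 =
      R) :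
    ((2 * z * B + z ^ 2 * B1) / (2 * s ^ 3) - 3 * z ^ 3 * B / (2 * s ^ 5) + B1 / s -
        z ^ 2 * B1 / s ^ 3 + z / s * ((ν ^ 2 * (1 + z ^ 2) * B - z * B1) / z ^ 2) -
        d * (-z / s ^ 3) * B - v * B1) +
      (z ^ 2 * B / (2 * s ^ 3) + z * B1 / s - v * B) * (z / (2 * s ^ 2) - s / z * v) =
    (R * B - 2 * v * (z ^ 2 * B / (2 * s ^ 3) + z * B1 / s - v * B)) * (s / z) := by
  subst hd
  field_simp
  grind

/-- The relative error of a Liouville--Green approximation. -/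
def relError (B : ℂ → ℂ) (μ : ℂ) (κ : ℕ → ℂ) (c : ℂ) (N : ℕ) (z : ℂ) : ℂ :=
  fourthRootBr z * Complex.exp (-lgExponent μ κ N z) * c * B z - 1

/-- The derivative of the relative error with respect to `σ ξ`, up to the sign `σ`. -/
def relErrorDeriv (B B1 : ℂ → ℂ) (μ : ℂ) (κ : ℕ → ℂ) (c : ℂ) (N : ℕ) (z : ℂ) : ℂ :=
  fourthRootBr z * Complex.exp (-lgExponent μ κ N z) * c *
    (z ^ 2 * B z / (2 * sqrtBr z ^ 3) + z * B1 z / sqrtBr z - vFun N μ (pVar z) * B z)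

lemma hasDerivAt_prefactor (μ : ℂ) (κ : ℕ → ℂ) (c : ℂ) (N : ℕ) {z : ℂ} (hz : z ∈ cutPlane) :
    HasDerivAt (fun z => fourthRootBr z * Complex.exp (-lgExponent μ κ N z) * c)
      (fourthRootBr z * Complex.exp (-lgExponent μ κ N z) * c *
        (z / (2 * sqrtBr z ^ 2) - sqrtBr z / z * vFun N μ (pVar z))) z := by
  refine (((hasDerivAt_fourthRootBr (cutPlane_sub_I hz) (cutPlane_add_I hz)).mul
    (hasDerivAt_lgExponent μ κ N hz).fun_neg.cexp).mul_const c).congr_deriv ?_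
  ring

lemma hasDerivAt_relError {B B1 : ℂ → ℂ} {μ : ℂ} (κ : ℕ → ℂ) (c : ℂ) (N : ℕ) {z : ℂ}
    (hz : z ∈ cutPlane) (hB : HasDerivAt B (B1 z) z) :
    HasDerivAt (relError B μ κ c N) (relErrorDeriv B B1 μ κ c N z * (sqrtBr z / z)) z := by
  have hs := sqrtBr_ne_zero (cutPlane_sub_I hz) (cutPlane_add_I hz)
  have hz0 := cutPlane_ne_zero hz
  refine HasDerivAt.congr_deriv (f := relError B μ κ c N)
    (((hasDerivAt_prefactor μ κ c N hz).mul hB).sub_const 1) ?_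
  rw [relErrorDeriv]
  field_simp
  ring

lemma hasDerivAt_relErrorDeriv {B B1 : ℂ → ℂ} {μ ν : ℂ} (hμ : μ ≠ 0) (hμν : μ ^ 2 = ν ^ 2)
    (κ : ℕ → ℂ) (c : ℂ) {N : ℕ} (hN : 1 ≤ N) {z : ℂ}
    (hz : z ∈ cutPlane) (hB : HasDerivAt B (B1 z) z)
    (hB1 : HasDerivAt B1 ((ν ^ 2 * (1 + z ^ 2) * B z - z * B1 z) / z ^ 2) z) :
    HasDerivAt (relErrorDeriv B B1 μ κ c N) ((residual N μ (pVar z) * (1 + relError B μ κ c N z) -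
      2 * vFun N μ (pVar z) * relErrorDeriv B B1 μ κ c N z) * (sqrtBr z / z)) z := by
  have hs := sqrtBr_ne_zero (cutPlane_sub_I hz) (cutPlane_add_I hz)
  have hz0 := cutPlane_ne_zero hz
  have ds := hasDerivAt_sqrtBr (cutPlane_sub_I hz) (cutPlane_add_I hz)
  have dv := (hasDerivAt_vFun N μ (pVar z)).comp z
    (hasDerivAt_pVar (cutPlane_sub_I hz) (cutPlane_add_I hz))
  have hres := residual_eq N hN μ (pVar z) hμ
  rw [hμν, pVar_weight hz] at hres
  have hF1 : Polynomial.aeval (pVar z) (Ftilde 1) =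
      1 / 8 * (z ^ 2 / sqrtBr z ^ 4) * (5 * (sqrtBr z)⁻¹ ^ 2 - 1) := by
    rw [← pVar_weight hz, Ftilde]
    simp only [map_mul, map_pow, map_sub, map_one, Polynomial.aeval_X, Polynomial.aeval_C,
      map_ofNat, map_div₀]
    rw [← pVar]; ring
  rw [hF1] at hres
  have halg := relError_algebra (B := B z) (B1 := B1 z) hz0 hs (sqrtBr_sq z) hres
  have dU : HasDerivAt (fun z => z ^ 2 * B z / (2 * sqrtBr z ^ 3) + z * B1 z / sqrtBr z -
      vFun N μ (pVar z) * B z)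
      ((2 * z * B z + z ^ 2 * B1 z) / (2 * sqrtBr z ^ 3) - 3 * z ^ 3 * B z / (2 * sqrtBr z ^ 5) +
        B1 z / sqrtBr z - z ^ 2 * B1 z / sqrtBr z ^ 3 +
        z / sqrtBr z * ((ν ^ 2 * (1 + z ^ 2) * B z - z * B1 z) / z ^ 2) -
        (∑ s ∈ Finset.Ico 1 N, Polynomial.aeval (pVar z) (Polynomial.derivative (Ftilde s)) /
          μ ^ s) * (-z / sqrtBr z ^ 3) * B z - vFun N μ (pVar z) * B1 z) z := by
    have d1 := ((hasDerivAt_pow 2 z).mul hB).div ((ds.pow 3).const_mul 2)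
      (mul_ne_zero two_ne_zero (pow_ne_zero 3 hs))
    have d2 := ((hasDerivAt_id z).mul hB1).div ds hs
    have d3 := dv.mul hB
    refine ((d1.add d2).sub d3).congr_deriv ?_
    simp only [id, Pi.mul_apply, Function.comp_apply, Pi.pow_apply]
    generalize (∑ s ∈ Finset.Ico 1 N,
      Polynomial.aeval (pVar z) (Polynomial.derivative (Ftilde s)) / μ ^ s) = d
    field_simp
    push_cast
    ring
  refine HasDerivAt.congr_deriv (f := relErrorDeriv B B1 μ κ c N)
    ((hasDerivAt_prefactor μ κ c N hz).mul dU) ?_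
  rw [relErrorDeriv, relError]
  linear_combination (fourthRootBr z * Complex.exp (-lgExponent μ κ N z) * c) * halg

/-- Error bound for the Liouville--Green approximation of a solution of the Bessel equation along a
progressive path. -/
theorem norm_relError_le {ν : ℝ} (hν : 0 < ν) {σ : ℝ} (hσ : σ ^ 2 = 1) {N : ℕ} (hN : 1 ≤ N)
    {B B1 : ℂ → ℂ} (hB : ∀ z ∈ cutPlane, HasDerivAt B (B1 z) z)
    (hB1 : ∀ z ∈ cutPlane,
      HasDerivAt B1 (((ν : ℂ) ^ 2 * (1 + z ^ 2) * B z - z * B1 z) / z ^ 2) z)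
    (κ : ℕ → ℂ) (c : ℂ) {γ : ℝ → ℂ} {z : ℂ} (hγ : IsArcChain γ z)
    (hmono : MonotoneOn (fun t => σ * (xi (γ t)).re) (Set.Ioc 0 1))
    (he0 : Filter.Tendsto (fun t => relError B (σ * ν) κ c N (γ t)) (nhdsWithin 0 (Set.Ioi 0))
      (nhds 0))
    (hy0 : Filter.Tendsto (fun t => relErrorDeriv B B1 (σ * ν) κ c N (γ t))
      (nhdsWithin 0 (Set.Ioi 0)) (nhds 0)) :
    ‖relError B (σ * ν) κ c N z‖ ≤
      omegaErr N ν γ / ν ^ N * Real.exp (varpiErr N ν γ / ν + omegaErr N ν γ / ν ^ N) := by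
  have hσσ : (σ : ℂ) * σ = 1 := by rw [← sq]; exact_mod_cast hσ
  have hσ0 : (σ : ℂ) ≠ 0 := fun h => by simp [h] at hσσ
  have hμ : (σ : ℂ) * ν ≠ 0 := mul_ne_zero hσ0 (by exact_mod_cast hν.ne')
  refine norm_error_le_of_path hν hσ hN (e := relError B (σ * ν) κ c N)
    (y := fun z => σ * relErrorDeriv B B1 (σ * ν) κ c N z) ?_ ?_ hγ hmono he0 ?_
  · intro w hw
    refine (hasDerivAt_relError κ c N hw (hB w hw)).congr_deriv ?_
    linear_combination -(relErrorDeriv B B1 (σ * ν) κ c N w * (sqrtBr w / w)) * hσσ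
  · intro w hw
    refine ((hasDerivAt_relErrorDeriv hμ (ν := ν) (by linear_combination (ν : ℂ) ^ 2 * hσσ) κ c hN
      hw (hB w hw) (hB1 w hw)).const_mul (σ : ℂ)).congr_deriv ?_
    linear_combination 2 * vFun N (σ * ν) (pVar w) * relErrorDeriv B B1 (σ * ν) κ c N w *
      (sqrtBr w / w) * σ * hσσ
  · simpa using hy0.const_mul (σ : ℂ)

end

noncomputable section

/-! ### The function `I_ν` -/

/-- The entire series `∑ x^k / (k! Γ(a+k))`. -/
def besselSeries (a : ℝ) (x : ℂ) : ℂ :=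
  ∑' k : ℕ, x ^ k / ((k.factorial : ℂ) * Complex.Gamma ((a : ℂ) + k))

/-- Each step multiplies by `a + k ≥ 1`. It lets the exponential series dominate the Bessel series,
whose parameters here are `ν + 1` and larger. -/
lemma Gamma_le_Gamma_add_nat {a : ℝ} (ha : 1 ≤ a) (k : ℕ) : Real.Gamma a ≤ Real.Gamma (a + k) := by
  induction k with
  | zero => simp
  | succ k ih =>
    have h : 0 < a + k := by positivity
    push_cast
    rw [← add_assoc, Real.Gamma_add_one h.ne']
    have h1 : 1 ≤ a + k := by linarith [(Nat.cast_nonneg k : (0 : ℝ) ≤ k)]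
    have h2 := Real.Gamma_pos_of_pos h
    nlinarith

lemma norm_besselSeries_term_le {a : ℝ} (ha : 1 ≤ a) (k : ℕ) {x : ℂ} {r : ℝ} (hx : ‖x‖ ≤ r) :
    ‖x ^ k / ((k.factorial : ℂ) * Complex.Gamma ((a : ℂ) + k))‖ ≤
      (Real.Gamma a)⁻¹ * (r ^ k / k.factorial) := by
  have h0 : 0 < Real.Gamma a := Real.Gamma_pos_of_pos (by linarith)
  have h1 := Gamma_le_Gamma_add_nat ha k
  have h2 : Complex.Gamma ((a : ℂ) + k) = (Real.Gamma (a + k) : ℂ) := by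
    rw [← Complex.Gamma_ofReal]; push_cast; rfl
  rw [h2, norm_div, norm_mul, norm_pow, Complex.norm_natCast, Complex.norm_real,
    Real.norm_of_nonneg (h0.le.trans h1), mul_comm (k.factorial : ℝ), ← div_div,
    ← div_eq_inv_mul, div_div, div_div, mul_comm (k.factorial : ℝ)]
  have hr : 0 ≤ r := (norm_nonneg x).trans hx
  gcongr

lemma summable_besselSeries {a : ℝ} (ha : 1 ≤ a) (x : ℂ) :
    Summable fun k : ℕ => x ^ k / ((k.factorial : ℂ) * Complex.Gamma ((a : ℂ) + k)) :=
  Summable.of_norm_bounded ((Real.summable_pow_div_factorial ‖x‖).mul_left (Real.Gamma a)⁻¹)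
    fun k => norm_besselSeries_term_le ha k le_rfl

lemma besselSeries_deriv_term (a : ℝ) (k : ℕ) (x : ℂ) :
    ((k + 1 : ℕ) : ℂ) * x ^ k / (((k + 1).factorial : ℂ) *
      Complex.Gamma ((a : ℂ) + (k + 1 : ℕ))) =
    x ^ k / ((k.factorial : ℂ) * Complex.Gamma (((a + 1 : ℝ) : ℂ) + k)) := by
  have h1 : ((k + 1 : ℕ) : ℂ) ≠ 0 := by exact_mod_cast Nat.succ_ne_zero k
  rw [Nat.factorial_succ, Nat.cast_mul, mul_assoc, mul_div_mul_left _ _ h1]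
  congr 3
  push_cast
  ring

lemma hasDerivAt_besselSeries {a : ℝ} (ha : 1 ≤ a) (x : ℂ) :
    HasDerivAt (besselSeries a) (besselSeries (a + 1) x) x := by
  set r : ℝ := ‖x‖ + 1 with hr
  have hr0 : 0 ≤ r := by positivity
  have ha1 : 1 ≤ a + 1 := by linarith
  set g' : ℕ → ℂ → ℂ := fun (k : ℕ) y =>
    (k : ℂ) * y ^ (k - 1) / ((k.factorial : ℂ) * Complex.Gamma ((a : ℂ) + k)) with hg'
  set u : ℕ → ℝ := fun k => (Real.Gamma (a + 1))⁻¹ * (r ^ k / k.factorial) with hu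
  have husum : Summable u := (Real.summable_pow_div_factorial r).mul_left _
  have hg'succ (k : ℕ) (y : ℂ) : g' (k + 1) y =
      y ^ k / ((k.factorial : ℂ) * Complex.Gamma (((a + 1 : ℝ) : ℂ) + k)) := by
    simp only [hg', Nat.add_sub_cancel]
    exact besselSeries_deriv_term a k y
  -- The derivative of the term of index `k + 1` is the term of index `k` with parameter `a + 1`;
  -- hence the shifted majorant, with `0` for the constant term.
  set u' : ℕ → ℝ := fun k => if k = 0 then 0 else u (k - 1) with hu'
  have hu'sum : Summable u' := by
    rw [← summable_nat_add_iff 1]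
    simpa [hu'] using husum
  have key := hasDerivAt_tsum_of_isPreconnected (t := Metric.ball (0 : ℂ) r)
    (g := fun (k : ℕ) y => y ^ k / ((k.factorial : ℂ) * Complex.Gamma ((a : ℂ) + k))) (g' := g')
    hu'sum Metric.isOpen_ball (convex_ball _ _).isPreconnected
    (fun k y _ => (hasDerivAt_pow k y).div_const _)
    (fun k y hy => by
      cases k with
      | zero => simp [hg', hu']
      | succ k =>
        rw [hg'succ]
        simp only [hu', Nat.succ_ne_zero, if_false, Nat.add_sub_cancel]
        exact norm_besselSeries_term_le ha1 k (by simpa using (mem_ball_zero_iff.1 hy).le))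
    (y₀ := x) (by simp [hr]) (summable_besselSeries ha x) (y := x) (by simp [hr])
  have hsum : Summable fun k => g' k x := by
    rw [← summable_nat_add_iff 1]
    simp only [hg'succ]
    exact summable_besselSeries ha1 x
  rw [hsum.tsum_eq_zero_add] at key
  simp only [hg'succ] at key
  have h0 : g' 0 x = 0 := by simp [hg']
  rw [h0, zero_add] at key
  exact key

lemma besselSeries_zero {a : ℝ} : besselSeries a 0 = (Complex.Gamma a)⁻¹ := by
  rw [besselSeries, tsum_eq_single 0 (fun k hk => by simp [hk])]
  simp

/-- Termwise this is `Γ(a+1+k) = (a+k) Γ(a+k)`. As differentiation raises the parameter by one, the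
relation is the Bessel equation for the series factor. -/
lemma besselSeries_ode {a : ℝ} (ha : 1 ≤ a) (x : ℂ) :
    x * besselSeries (a + 2) x + a * besselSeries (a + 1) x = besselSeries a x := by
  have s1 := summable_besselSeries (show 1 ≤ a + 1 by linarith) x
  have s2 := summable_besselSeries (show 1 ≤ a + 2 by linarith) x
  set d : ℕ → ℂ := fun k => (k : ℂ) * (x ^ k / ((k.factorial : ℂ) *
    Complex.Gamma (((a + 1 : ℝ) : ℂ) + k))) with hd
  have hd1 (k : ℕ) : d (k + 1) =
      x * (x ^ k / ((k.factorial : ℂ) * Complex.Gamma (((a + 2 : ℝ) : ℂ) + k))) := by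
    have := besselSeries_deriv_term (a + 1) k x
    rw [show a + 1 + 1 = a + 2 by ring] at this
    simp only [hd]
    rw [← this]
    ring
  have hds : Summable d := by
    rw [← summable_nat_add_iff 1]
    simp only [hd1]
    exact s2.mul_left x
  have e1 : x * besselSeries (a + 2) x = ∑' k, d k := by
    rw [hds.tsum_eq_zero_add]
    simp only [hd1, besselSeries, tsum_mul_left]
    simp [hd]
  rw [e1, besselSeries, besselSeries, ← tsum_mul_left, ← hds.tsum_add (s1.mul_left _)]
  refine tsum_congr fun k => ?_
  have hak : (a : ℂ) + k ≠ 0 := by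
    have : (0 : ℝ) < a + k := by positivity
    exact_mod_cast this.ne'
  have hG : Complex.Gamma (((a + 1 : ℝ) : ℂ) + k) = (a + k) * Complex.Gamma ((a : ℂ) + k) := by
    rw [← Complex.Gamma_add_one _ hak]
    congr 1
    push_cast
    ring
  simp only [hd]
  rw [hG, mul_left_comm, ← div_div _ ((a : ℂ) + k), div_right_comm, ← add_mul]
  field_simp
  ring

/-- Derivative of `z ↦ I_ν(ν z)`. -/
def besselI' (ν : ℝ) (z : ℂ) : ℂ :=
  (ν * z / 2) ^ (ν : ℂ) * (ν / z * besselSeries (ν + 1) ((ν * z) ^ 2 / 4) +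
    ν ^ 2 * z / 2 * besselSeries (ν + 1 + 1) ((ν * z) ^ 2 / 4))

lemma besselI_eq (ν : ℝ) (z : ℂ) :
    besselI ν (ν * z) = (ν * z / 2) ^ (ν : ℂ) * besselSeries (ν + 1) ((ν * z) ^ 2 / 4) := by
  rw [besselI, besselSeries]
  congr 1
  refine tsum_congr fun k => ?_
  congr 3
  push_cast
  ring

lemma mul_mem_slitPlane {r : ℝ} (hr : 0 < r) {z : ℂ} (hz : z ∈ Complex.slitPlane) :
    (r : ℂ) * z ∈ Complex.slitPlane := by
  rw [Complex.mem_slitPlane_iff] at *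
  rw [Complex.re_ofReal_mul, Complex.im_ofReal_mul]
  exact hz.imp (fun h => by positivity) fun h => mul_ne_zero hr.ne' h

lemma hasDerivAt_scaled_cpow {ν : ℝ} (hν : 0 < ν) {z : ℂ} (hz : z ∈ Complex.slitPlane) :
    HasDerivAt (fun z : ℂ => (ν * z / 2) ^ (ν : ℂ)) (ν / z * (ν * z / 2) ^ (ν : ℂ)) z := by
  have hm : (ν : ℂ) * z / 2 ∈ Complex.slitPlane := by
    have := mul_mem_slitPlane (half_pos hν) hz
    push_cast at this
    rwa [div_mul_eq_mul_div] at this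
  have hz0 := Complex.slitPlane_ne_zero hz
  have hν0 : (ν : ℂ) ≠ 0 := by exact_mod_cast hν.ne'
  refine ((((hasDerivAt_id z).const_mul (ν : ℂ)).div_const 2).cpow_const hm).congr_deriv ?_
  simp only [id]
  rw [Complex.cpow_sub _ _ (Complex.slitPlane_ne_zero hm), Complex.cpow_one]
  field_simp

lemma hasDerivAt_scaled_series {a : ℝ} (ha : 1 ≤ a) (ν : ℝ) (z : ℂ) :
    HasDerivAt (fun z : ℂ => besselSeries a ((ν * z) ^ 2 / 4))
      (besselSeries (a + 1) ((ν * z) ^ 2 / 4) * (ν ^ 2 * z / 2)) z := by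
  refine ((hasDerivAt_besselSeries ha _).comp z
    ((((hasDerivAt_id z).const_mul (ν : ℂ)).pow 2).div_const 4)).congr_deriv ?_
  simp only [id]
  push_cast
  congr 1
  ring

lemma hasDerivAt_besselI {ν : ℝ} (hν : 0 < ν) {z : ℂ} (hz : z ∈ Complex.slitPlane) :
    HasDerivAt (fun z => besselI ν (ν * z)) (besselI' ν z) z := by
  simp only [besselI_eq]
  refine ((hasDerivAt_scaled_cpow hν hz).mul
    (hasDerivAt_scaled_series (by linarith) ν z)).congr_deriv ?_
  rw [besselI']
  ring

lemma hasDerivAt_besselI' {ν : ℝ} (hν : 0 < ν) {z : ℂ} (hz : z ∈ Complex.slitPlane) :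
    HasDerivAt (besselI' ν)
      (((ν : ℂ) ^ 2 * (1 + z ^ 2) * besselI ν (ν * z) - z * besselI' ν z) / z ^ 2) z := by
  have hz0 := Complex.slitPlane_ne_zero hz
  have d0 := hasDerivAt_scaled_series (show 1 ≤ ν + 1 by linarith) ν z
  have d1 := hasDerivAt_scaled_series (show 1 ≤ ν + 1 + 1 by linarith) ν z
  have dinv := (hasDerivAt_inv hz0).const_mul (ν : ℂ)
  have dlin := (((hasDerivAt_id z).const_mul ((ν : ℂ) ^ 2)).div_const 2)
  have hode := besselSeries_ode (show 1 ≤ ν + 1 by linarith) ((ν * z) ^ 2 / 4)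
  rw [show ν + 1 + 2 = ν + 1 + 1 + 1 by ring] at hode
  have h := (hasDerivAt_scaled_cpow hν hz).mul ((dinv.mul d0).add (dlin.mul d1))
  refine HasDerivAt.congr_deriv (f := besselI' ν) h ?_
  rw [besselI_eq, besselI']
  simp only [id, Pi.mul_apply, Pi.add_apply]
  push_cast at hode ⊢
  generalize besselSeries (ν + 1) ((ν * z) ^ 2 / 4) = b0 at *
  generalize besselSeries (ν + 1 + 1) ((ν * z) ^ 2 / 4) = b1 at *
  generalize besselSeries (ν + 1 + 1 + 1) ((ν * z) ^ 2 / 4) = b2 at *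
  generalize ((ν : ℂ) * z / 2) ^ (ν : ℂ) = P
  field_simp
  linear_combination (4 * z ^ 2 * (ν : ℂ) ^ 2 * P) * hode

/-! ### Behaviour of `I_ν` at the origin -/

lemma log_div_of_re_pos {z w : ℂ} (hz : 0 < z.re) (hw : 0 < w.re) :
    Complex.log (z / w) = Complex.log z - Complex.log w := by
  have hz0 : z ≠ 0 := fun h => by simp [h] at hz
  have hw0 : w ≠ 0 := fun h => by simp [h] at hw
  have a1 := abs_lt.1 (Complex.abs_arg_lt_pi_div_two_iff.2 (Or.inl hz))
  have a2 := abs_lt.1 (Complex.abs_arg_lt_pi_div_two_iff.2 (Or.inl hw))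
  have hpi := Real.pi_pos
  have hne : w.arg ≠ Real.pi := by linarith
  rw [div_eq_mul_inv, Complex.log_mul hz0 (inv_ne_zero hw0), Complex.log_inv _ hne, sub_eq_add_neg]
  rw [Complex.arg_inv, if_neg hne]
  constructor <;> linarith

/-- In the strip `|Im z| < 1` the logarithm in `ξ` splits. -/
lemma log_div_one_add_sqrtBr {z : ℂ} (hz : z ∈ cutPlane) (him : |z.im| < 1) :
    Complex.log (z / (1 + sqrtBr z)) = Complex.log z - Complex.log (1 + sqrtBr z) := by
  have hray (t : ℝ) (ht : 0 ≤ t) : z + t ∈ cutPlane := by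
    rintro ⟨h1, h2⟩
    refine hz ⟨?_, by simpa using h2⟩
    simp at h1; linarith
  have hone {w : ℂ} (hw : 0 < w.re ∨ |w.im| < 1) : 0 < (1 + sqrtBr w).re := by
    have := re_sqrtBr_pos hw
    simp; linarith
  -- The defect of the claimed identity. Its derivative vanishes in the part of the strip inside the
  -- cut plane, so it is constant along the ray from `z` to the right; that ray avoids the cuts and
  -- reaches the right half-plane, where the defect is zero.
  set D : ℂ → ℂ := fun w =>
    xi w - sqrtBr w - (Complex.log w - Complex.log (1 + sqrtBr w)) with hD
  have hDd : ∀ w ∈ cutPlane, |w.im| < 1 → HasDerivAt D 0 w := by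
    intro w hw hwim
    have hs := sqrtBr_ne_zero (cutPlane_sub_I hw) (cutPlane_add_I hw)
    have hw0 := cutPlane_ne_zero hw
    have h1 := one_add_sqrtBr_ne_zero hw0
    have ds := hasDerivAt_sqrtBr (cutPlane_sub_I hw) (cutPlane_add_I hw)
    refine (((hasDerivAt_xi hw).sub ds).sub
      (((hasDerivAt_id w).clog (cutPlane_slitPlane hw)).sub
        ((ds.const_add 1).clog (Or.inl (hone (Or.inr hwim)))))).congr_deriv ?_
    have := sqrtBr_sq w
    simp only [id]
    field_simp
    linear_combination (sqrtBr w) * this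
  set b : ℝ := |z.re| + 1 with hb
  have hb0 : 0 ≤ b := by positivity
  have hconst := constant_of_has_deriv_right_zero (f := fun t : ℝ => D (z + t)) (a := 0) (b := b)
    (fun t ht => by
      have := hDd (z + t) (hray t ht.1) (by simpa using him)
      exact (this.continuousAt.comp (f := fun t : ℝ => z + (t : ℂ))
        (by fun_prop)).continuousWithinAt)
    (fun t ht => by
      have := hDd (z + t) (hray t ht.1) (by simpa using him)
      have h2 : HasDerivAt (fun t : ℝ => z + (t : ℂ)) 1 t :=
        (Complex.ofRealCLM.hasDerivAt (x := t)).const_add z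
      have h3 := (this.comp t h2).hasDerivWithinAt (s := Set.Ici t)
      rw [zero_mul] at h3
      exact h3)
    b ⟨hb0, le_rfl⟩
  simp only [Complex.ofReal_zero, add_zero] at hconst
  have hre : 0 < (z + b).re := by
    simp [hb]; linarith [neg_abs_le z.re]
  have hzero : D (z + b) = 0 := by
    simp only [hD, xi]
    rw [log_div_of_re_pos hre (hone (Or.inl hre))]
    ring
  rw [hzero] at hconst
  simp only [hD, xi] at hconst
  linear_combination -hconst

/-- The regular factor of `I_ν(ν z)` divided by its Liouville--Green approximation near `z = 0`. -/
def besselIRatio (ν : ℝ) (N : ℕ) (c z : ℂ) : ℂ :=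
  fourthRootBr z * Complex.exp (-(ν * sqrtBr z) + ν * Complex.log (1 + sqrtBr z) +
    ν * Complex.log (ν / 2) -
    ∑ s ∈ Finset.Ico 1 N, (Etilde s (pVar z) - kConst s) / (ν : ℂ) ^ s) * c *
      besselSeries (ν + 1) ((ν * z) ^ 2 / 4)

/-- The `log z` in `-νξ` cancels the one in `(νz/2)^ν`, so nothing singular at the origin remains.
The strip is what allows the logarithm in `ξ` to be split. -/
lemma relError_besselI_eq {ν : ℝ} (hν : 0 < ν) (N : ℕ) (c : ℂ) {z : ℂ} (hz : z ∈ cutPlane)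
    (him : |z.im| < 1) :
    relError (fun z => besselI ν (ν * z)) ν (fun s => kConst s) c N z =
      besselIRatio ν N c z - 1 := by
  have hz0 := cutPlane_ne_zero hz
  have hν0 : (ν : ℂ) ≠ 0 := by exact_mod_cast hν.ne'
  rw [relError, besselIRatio, lgExponent, xi, log_div_one_add_sqrtBr hz him, besselI_eq,
    Complex.cpow_def_of_ne_zero (div_ne_zero (mul_ne_zero hν0 hz0) two_ne_zero)]
  have hlog : Complex.log (ν * z / 2) = Complex.log (ν / 2) + Complex.log z := by
    have := Complex.log_ofReal_mul (half_pos hν) hz0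
    rw [Complex.ofReal_log (half_pos hν).le] at this
    push_cast at this
    rw [← this]
    congr 1
    ring
  rw [hlog]
  set S := ∑ s ∈ Finset.Ico 1 N, (Etilde s (pVar z) - kConst s) / (ν : ℂ) ^ s
  rw [show -(ν * sqrtBr z) + ν * Complex.log (1 + sqrtBr z) + ν * Complex.log (ν / 2) - S =
    -(ν * (sqrtBr z + (Complex.log z - Complex.log (1 + sqrtBr z))) + S) +
      (Complex.log (ν / 2) + Complex.log z) * ν by ring, Complex.exp_add]
  ring

lemma differentiableAt_besselIRatio (ν : ℝ) (hν : 0 < ν) (N : ℕ) (c : ℂ) {z : ℂ}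
    (him : |z.im| < 1) : DifferentiableAt ℂ (besselIRatio ν N c) z := by
  obtain ⟨h1, h2⟩ := slitPlane_of_re_pos_or_im (Or.inr him)
  have hs := (hasDerivAt_sqrtBr h1 h2).differentiableAt
  have hf := (hasDerivAt_fourthRootBr h1 h2).differentiableAt
  have hp := (hasDerivAt_pVar h1 h2).differentiableAt
  have hre : 1 + sqrtBr z ∈ Complex.slitPlane := by
    refine Or.inl ?_
    have := re_sqrtBr_pos (Or.inr him)
    simp; linarith
  have hE (s : ℕ) : DifferentiableAt ℂ (fun z => Etilde s (pVar z)) z := by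
    simp only [Etilde_eq]
    exact ((Epoly s).differentiable_aeval (pVar z)).comp z hp
  unfold besselIRatio
  refine ((hf.mul ((((hs.const_mul _).neg.add (((hs.const_add 1).clog hre).const_mul _)).add_const
    _).sub (DifferentiableAt.fun_sum fun s _ => ((hE s).sub_const _).div_const _)).cexp).mul_const
      _).mul ?_
  exact (hasDerivAt_scaled_series (by linarith) ν z).differentiableAt

lemma sqrtBr_zero : sqrtBr 0 = 1 := by
  have h := sqrtBr_sq 0
  have hp := re_sqrtBr_pos (z := 0) (Or.inr (by simp))
  have : (sqrtBr 0 - 1) * (sqrtBr 0 + 1) = 0 := by linear_combination h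
  rcases mul_eq_zero.1 this with h | h
  · linear_combination h
  · rw [show sqrtBr 0 = -1 by linear_combination h] at hp
    simp at hp; linarith

lemma fourthRootBr_zero : fourthRootBr 0 = 1 := by
  rw [fourthRootBr, zero_sub, zero_add,
    Complex.cpow_def_of_ne_zero (neg_ne_zero.2 Complex.I_ne_zero),
    Complex.cpow_def_of_ne_zero Complex.I_ne_zero, Complex.log_neg_I, Complex.log_I,
    ← Complex.exp_add]
  simp

/-- This fixes the constant in the expansion of `I_ν`. At `z = 0` one has `p = 1`, so subtracting
`k_s = E_s(1)` removes the sum. -/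
lemma besselIRatio_zero {ν : ℝ} (hν : 0 < ν) (N : ℕ) :
    besselIRatio ν N ((Real.exp ν * Real.Gamma (ν + 1) / ν ^ ν : ℝ) : ℂ) 0 = 1 := by
  have hsum : ∑ s ∈ Finset.Ico 1 N, (Etilde s (pVar 0) - kConst s) / (ν : ℂ) ^ s = 0 := by
    refine Finset.sum_eq_zero fun s _ => ?_
    rw [pVar, sqrtBr_zero, inv_one, Etilde_one]
    simp
  have hG := Real.Gamma_pos_of_pos (show 0 < ν + 1 by linarith)
  have hνν : 0 < ν ^ ν := Real.rpow_pos_of_pos hν ν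
  rw [besselIRatio, hsum, sqrtBr_zero, fourthRootBr_zero]
  have e0 : ((ν : ℂ) * 0) ^ 2 / 4 = 0 := by simp
  rw [e0, besselSeries_zero, Complex.Gamma_ofReal]
  have e1 : (-((ν : ℂ) * 1) + ν * Complex.log (1 + 1) + ν * Complex.log (ν / 2) - 0) =
      ((-ν + ν * Real.log 2 + ν * Real.log (ν / 2) : ℝ) : ℂ) := by
    push_cast
    rw [Complex.ofReal_log (by norm_num : (0 : ℝ) ≤ 2), Complex.ofReal_log (half_pos hν).le]
    push_cast
    norm_num
  rw [e1, ← Complex.ofReal_exp]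
  rw [one_mul, ← Complex.ofReal_inv, ← Complex.ofReal_mul, ← Complex.ofReal_mul]
  norm_cast
  rw [Real.log_div hν.ne' two_ne_zero,
    show -ν + ν * Real.log 2 + ν * (Real.log ν - Real.log 2) = Real.log ν * ν - ν by ring,
    Real.exp_sub, ← Real.rpow_def_of_pos hν]
  field_simp

/-- The initial values of the relative error for `I_ν`. -/
lemma tendsto_relError_besselI {ν : ℝ} (hν : 0 < ν) (N : ℕ) {γ : ℝ → ℂ} {z : ℂ}
    (hγ : IsProgressiveFromZero γ z) :
    Filter.Tendsto (fun t => relError (fun z => besselI ν (ν * z)) ν (fun s => kConst s)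
      ((Real.exp ν * Real.Gamma (ν + 1) / ν ^ ν : ℝ) : ℂ) N (γ t)) (nhdsWithin 0 (Set.Ioi 0))
      (nhds 0) ∧
    Filter.Tendsto (fun t => relErrorDeriv (fun z => besselI ν (ν * z)) (besselI' ν) ν
      (fun s => kConst s) ((Real.exp ν * Real.Gamma (ν + 1) / ν ^ ν : ℝ) : ℂ) N (γ t))
      (nhdsWithin 0 (Set.Ioi 0)) (nhds 0) := by
  set c : ℂ := ((Real.exp ν * Real.Gamma (ν + 1) / ν ^ ν : ℝ) : ℂ) with hc
  set h := besselIRatio ν N c with hh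
  have hh0 : h 0 = 1 := besselIRatio_zero hν N
  have hopen : IsOpen {w : ℂ | |w.im| < 1} :=
    isOpen_lt (continuous_abs.comp Complex.continuous_im) continuous_const
  have hdiff : DifferentiableOn ℂ h {w : ℂ | |w.im| < 1} := fun w hw =>
    (differentiableAt_besselIRatio ν hν N c hw).differentiableWithinAt
  have h0mem : (0 : ℂ) ∈ {w : ℂ | |w.im| < 1} := by simp
  have han : AnalyticAt ℂ h 0 := hdiff.analyticAt (hopen.mem_nhds h0mem)
  have hev : ∀ᶠ t in nhdsWithin 0 (Set.Ioi 0), γ t ∈ cutPlane ∧ |(γ t).im| < 1 := by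
    filter_upwards [Ioc_mem_nhdsGT (zero_lt_one : (0 : ℝ) < 1),
      hγ.start (hopen.mem_nhds h0mem)] with t ht ht'
    exact ⟨hγ.mem t ht, ht'⟩
  constructor
  · have h1 : Filter.Tendsto (fun t => h (γ t) - 1) (nhdsWithin 0 (Set.Ioi 0)) (nhds 0) := by
      have := (han.continuousAt.tendsto.comp hγ.start).sub_const 1
      rwa [hh0, sub_self] at this
    refine h1.congr' ?_
    filter_upwards [hev] with t ht
    exact (relError_besselI_eq hν N c ht.1 ht.2).symm
  · have hs0 := (hasDerivAt_sqrtBr (slitPlane_of_re_pos_or_im (z := 0) (Or.inr (by simp))).1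
      (slitPlane_of_re_pos_or_im (z := 0) (Or.inr (by simp))).2).continuousAt
    have hquot : ContinuousAt (fun w => w / sqrtBr w) 0 :=
      continuousAt_id.div hs0 (by rw [sqrtBr_zero]; exact one_ne_zero)
    have h2 : Filter.Tendsto (fun t => γ t / sqrtBr (γ t) * deriv h (γ t))
        (nhdsWithin 0 (Set.Ioi 0)) (nhds 0) := by
      have := ((hquot.mul han.deriv.continuousAt).tendsto.comp hγ.start)
      simpa [Function.comp_def] using this
    refine h2.congr' ?_
    filter_upwards [hev] with t ht
    have hz0 := cutPlane_ne_zero ht.1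
    have hs := sqrtBr_ne_zero (cutPlane_sub_I ht.1) (cutPlane_add_I ht.1)
    have d1 := hasDerivAt_relError (μ := (ν : ℂ)) (fun s => (kConst s : ℂ)) c N ht.1
      (hasDerivAt_besselI hν (cutPlane_slitPlane ht.1))
    have d2 : HasDerivAt (fun w => h w - 1) (deriv h (γ t)) (γ t) :=
      (differentiableAt_besselIRatio ν hν N c ht.2).hasDerivAt.sub_const 1
    have heq : relError (fun z => besselI ν (ν * z)) ν (fun s => (kConst s : ℂ)) c N =ᶠ[nhds (γ t)]
        fun w => h w - 1 := by
      filter_upwards [isOpen_cutPlane.mem_nhds ht.1, hopen.mem_nhds ht.2] with w hw hw'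
      exact relError_besselI_eq hν N c hw hw'
    -- The holomorphic representation and the explicit formula give the same `z`-derivative. Passing
    -- to `ξ` multiplies it by `z/(1+z²)^{1/2}`, which tends to `0` at the origin.
    rw [← (d1.congr_of_eventuallyEq heq.symm).unique d2]
    field_simp

end

noncomputable section

open MeasureTheory

/-! ### The function `K_ν` -/

/-- The integrand `e^{-t} t^b (1 + t/(2w))^c`. -/
def kKernel (b c : ℝ) (w : ℂ) (t : ℝ) : ℂ :=
  ((Real.exp (-t) * t ^ b : ℝ) : ℂ) * (1 + (t : ℂ) / (2 * w)) ^ (c : ℂ)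

/-- `∫_0^∞ e^{-t} t^b (1 + t/(2w))^c dt`. -/
def kIntegral (b c : ℝ) (w : ℂ) : ℂ := ∫ t in Set.Ioi (0 : ℝ), kKernel b c w t

/-- If the value were a real `r ≤ 0`, then `w = t/(2(r-1))` would be real and nonpositive. -/
lemma one_add_div_mem_slitPlane {w : ℂ} (hw : w ∈ Complex.slitPlane) {t : ℝ} (ht : 0 ≤ t) :
    1 + (t : ℂ) / (2 * w) ∈ Complex.slitPlane := by
  have hw0 := Complex.slitPlane_ne_zero hw
  rw [Complex.mem_slitPlane_iff]
  by_contra h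
  push Not at h
  obtain ⟨hre, him⟩ := h
  obtain ⟨r, hr⟩ : ∃ r : ℝ, 1 + (t : ℂ) / (2 * w) = r := ⟨_, Complex.ext rfl (by simpa using him)⟩
  rw [hr, Complex.ofReal_re] at hre
  have hr1 : r - 1 ≠ 0 := by linarith
  have hr1' : (r : ℂ) - 1 ≠ 0 := by exact_mod_cast hr1
  have hwr : w = ((t / (2 * (r - 1)) : ℝ) : ℂ) := by
    push_cast
    field_simp at hr ⊢
    linear_combination -hr
  rw [hwr, Complex.mem_slitPlane_iff, Complex.ofReal_re, Complex.ofReal_im] at hw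
  rcases hw with h | h
  · have : t / (2 * (r - 1)) ≤ 0 := div_nonpos_of_nonneg_of_nonpos ht (by linarith)
    linarith
  · exact h rfl

/-- Write `1 + t/(2w) = (w + t/2)/w`: the numerator is the distance of `w` from a point of the cut.
The locally uniform bounds supply the domination needed to differentiate under the integral. -/
lemma exists_bounds_one_add_div {w₀ : ℂ} (hw₀ : w₀ ∈ Complex.slitPlane) :
    ∃ ε > 0, ∃ A ≥ 1, ∀ w ∈ Metric.ball w₀ ε, w ∈ Complex.slitPlane ∧ ε ≤ ‖w‖ ∧
      ∀ t : ℝ, 0 ≤ t → A⁻¹ ≤ ‖1 + (t : ℂ) / (2 * w)‖ ∧ ‖1 + (t : ℂ) / (2 * w)‖ ≤ A * (1 + t) := by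
  obtain ⟨e, he, hball⟩ := Metric.isOpen_iff.1 Complex.isOpen_slitPlane w₀ hw₀
  set ε := e / 2 with hε
  have hε0 : 0 < ε := half_pos he
  -- The middle term serves the lower bound, the other two the upper bound.
  set A : ℝ := 1 + (‖w₀‖ + ε) / ε + 1 / (2 * ε) with hA
  have hA1 : 1 ≤ A := by
    have : 0 ≤ (‖w₀‖ + ε) / ε := by positivity
    have : 0 ≤ 1 / (2 * ε) := by positivity
    linarith
  refine ⟨ε, hε0, A, hA1, fun w hw => ?_⟩
  have hws : w ∈ Complex.slitPlane := hball (Metric.ball_subset_ball (by linarith) hw)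
  have hw0 := Complex.slitPlane_ne_zero hws
  have hlow (t : ℝ) (ht : 0 ≤ t) : ε ≤ ‖w + t / 2‖ := by
    by_contra hcon
    push Not at hcon
    have hmem : (((-(t / 2) : ℝ)) : ℂ) ∈ Metric.ball w₀ e := by
      rw [Metric.mem_ball, dist_eq_norm] at hw ⊢
      have : (((-(t / 2) : ℝ)) : ℂ) - w₀ = -(w + t / 2) + (w - w₀) := by push_cast; ring
      rw [this]
      refine (norm_add_le _ _).trans_lt ?_
      rw [norm_neg]
      linarith
    have h2 := hball hmem
    rw [Complex.mem_slitPlane_iff, Complex.ofReal_re, Complex.ofReal_im] at h2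
    rcases h2 with h | h
    · linarith
    · exact h rfl
  have hεw : ε ≤ ‖w‖ := by simpa using hlow 0 le_rfl
  have hwn : 0 < ‖w‖ := norm_pos_iff.2 hw0
  refine ⟨hws, hεw, fun t ht => ⟨?_, ?_⟩⟩
  · have e1 : 1 + (t : ℂ) / (2 * w) = (w + t / 2) / w := by field_simp
    rw [e1, norm_div]
    have hwle : ‖w‖ ≤ ‖w₀‖ + ε := by
      have h3 := norm_sub_norm_le w w₀
      rw [Metric.mem_ball, dist_eq_norm] at hw
      linarith
    have h4 : ε / (‖w₀‖ + ε) ≤ ‖w + t / 2‖ / ‖w‖ := by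
      have := hlow t ht
      gcongr
    refine le_trans ?_ h4
    rw [← inv_div]
    have : 0 < (‖w₀‖ + ε) / ε := by positivity
    have h5 : 0 ≤ 1 / (2 * ε) := by positivity
    exact inv_anti₀ this (by linarith)
  · refine (norm_add_le _ _).trans ?_
    rw [norm_one, norm_div, norm_mul, Complex.norm_real, Real.norm_of_nonneg ht]
    have h6 : t / (‖(2 : ℂ)‖ * ‖w‖) ≤ t * (1 / (2 * ε)) := by
      rw [Complex.norm_ofNat, mul_one_div]
      gcongr
    have h7 : 0 ≤ (‖w₀‖ + ε) / ε := by positivity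
    have h8 : t * (1 / (2 * ε)) ≤ t * A := mul_le_mul_of_nonneg_left (by linarith) ht
    linarith

lemma rpow_le_of_bounds {A x T c : ℝ} (hA : 1 ≤ A) (hT : 1 ≤ T) (h1 : A⁻¹ ≤ x) (h2 : x ≤ A * T) :
    x ^ c ≤ (A * T) ^ |c| := by
  have hA0 : 0 < A := by linarith
  have hx : 0 < x := (inv_pos.2 hA0).trans_le h1
  rcases le_total 0 c with hc | hc
  · rw [abs_of_nonneg hc]
    exact Real.rpow_le_rpow hx.le h2 hc
  · rw [abs_of_nonpos hc]
    calc x ^ c ≤ (A⁻¹) ^ c := Real.rpow_le_rpow_of_nonpos (inv_pos.2 hA0) h1 hc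
      _ = A ^ (-c) := by rw [Real.inv_rpow hA0.le, Real.rpow_neg hA0.le]
      _ ≤ (A * T) ^ (-c) := Real.rpow_le_rpow hA0.le (by nlinarith) (by linarith)

/-- Half of the exponential absorbs `(1+t)^{|c|}`, through `x^n/n! ≤ exp x` at `x = (1+t)/2`. The
bound covers either sign of `c`. -/
lemma exists_kernel_bound (A c : ℝ) (hA : 1 ≤ A) : ∃ C : ℝ, 0 ≤ C ∧ ∀ (b t : ℝ) (w : ℂ), 0 < t →
    A⁻¹ ≤ ‖1 + (t : ℂ) / (2 * w)‖ → ‖1 + (t : ℂ) / (2 * w)‖ ≤ A * (1 + t) →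
    ‖kKernel b c w t‖ ≤ C * (t ^ b * Real.exp (-(1 / 2) * t ^ (1 : ℝ))) := by
  set n := ⌈|c|⌉₊ with hn
  have hA0 : 0 < A := by linarith
  refine ⟨A ^ |c| * (2 ^ n * n.factorial * Real.exp (1 / 2)), by positivity,
    fun b t w ht h1 h2 => ?_⟩
  have hk := rpow_le_of_bounds (c := c) hA (by linarith : (1 : ℝ) ≤ 1 + t) h1 h2
  rw [Real.mul_rpow hA0.le (by linarith)] at hk
  have hpow : (1 + t) ^ |c| ≤ 2 ^ n * n.factorial * Real.exp (1 / 2) * Real.exp (t / 2) := by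
    have e1 : (1 + t) ^ |c| ≤ (1 + t) ^ (n : ℝ) :=
      Real.rpow_le_rpow_of_exponent_le (by linarith) (Nat.le_ceil _)
    rw [Real.rpow_natCast] at e1
    have e2 := Real.pow_div_factorial_le_exp ((1 + t) / 2) (by linarith) n
    rw [div_pow, div_div, div_le_iff₀ (by positivity)] at e2
    have e3 : Real.exp ((1 + t) / 2) = Real.exp (1 / 2) * Real.exp (t / 2) := by
      rw [← Real.exp_add]; congr 1; ring
    rw [e3] at e2
    linarith
  rw [kKernel, norm_mul, Complex.norm_cpow_real, Complex.norm_real,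
    Real.norm_of_nonneg (mul_nonneg (Real.exp_pos _).le (Real.rpow_nonneg ht.le _)), Real.rpow_one]
  have htb := Real.rpow_nonneg ht.le b
  have hfin : ‖1 + (t : ℂ) / (2 * w)‖ ^ c ≤
      A ^ |c| * (2 ^ n * n.factorial * Real.exp (1 / 2) * Real.exp (t / 2)) :=
    hk.trans (by gcongr)
  calc Real.exp (-t) * t ^ b * ‖1 + (t : ℂ) / (2 * w)‖ ^ c
      ≤ Real.exp (-t) * t ^ b *
        (A ^ |c| * (2 ^ n * n.factorial * Real.exp (1 / 2) * Real.exp (t / 2))) := by gcongr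
    _ = A ^ |c| * (2 ^ n * n.factorial * Real.exp (1 / 2)) *
        (t ^ b * (Real.exp (-t) * Real.exp (t / 2))) := by ring
    _ = _ := by
      rw [← Real.exp_add]
      congr 3
      ring_nf

lemma integrableOn_kernel_bound {b : ℝ} (hb : -1 < b) (C : ℝ) :
    IntegrableOn (fun t : ℝ => C * (t ^ b * Real.exp (-(1 / 2) * t ^ (1 : ℝ)))) (Set.Ioi 0) :=
  (integrableOn_rpow_mul_exp_neg_mul_rpow hb one_pos (by norm_num)).const_mul C

lemma continuousOn_kKernel (b c : ℝ) {w : ℂ} (hw : w ∈ Complex.slitPlane) :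
    ContinuousOn (kKernel b c w) (Set.Ioi 0) := by
  intro t ht
  have ht0 : (0 : ℝ) < t := ht
  refine ContinuousAt.continuousWithinAt ?_
  refine ContinuousAt.mul ?_ ?_
  · exact Complex.continuous_ofReal.continuousAt.comp
      ((Real.continuous_exp.comp continuous_neg).continuousAt.mul
        (Real.continuousAt_rpow_const t b (Or.inl ht0.ne')))
  · exact ContinuousAt.cpow (by fun_prop) continuousAt_const (one_add_div_mem_slitPlane hw ht0.le)

lemma integrableOn_kKernel {b : ℝ} (hb : -1 < b) (c : ℝ) {w : ℂ} (hw : w ∈ Complex.slitPlane) :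
    IntegrableOn (kKernel b c w) (Set.Ioi 0) := by
  obtain ⟨ε, hε, A, hA, h⟩ := exists_bounds_one_add_div hw
  obtain ⟨C, -, hC⟩ := exists_kernel_bound A c hA
  refine Integrable.mono' (integrableOn_kernel_bound hb C)
    ((continuousOn_kKernel b c hw).aestronglyMeasurable measurableSet_Ioi) ?_
  rw [ae_restrict_iff' measurableSet_Ioi]
  refine Filter.Eventually.of_forall fun t ht => ?_
  have := (h w (Metric.mem_ball_self hε)).2.2 t (le_of_lt ht)
  exact hC b t w ht this.1 this.2

lemma hasDerivAt_kIntegral {b : ℝ} (hb : -1 < b) (c : ℝ) {w₀ : ℂ} (hw₀ : w₀ ∈ Complex.slitPlane) :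
    HasDerivAt (kIntegral b c) (-(c / (2 * w₀ ^ 2)) * kIntegral (b + 1) (c - 1) w₀) w₀ := by
  obtain ⟨ε, hε, A, hA, h⟩ := exists_bounds_one_add_div hw₀
  obtain ⟨C, hC0, hC⟩ := exists_kernel_bound A (c - 1) hA
  have hb1 : -1 < b + 1 := by linarith
  have key := hasDerivAt_integral_of_dominated_loc_of_deriv_le
    (μ := volume.restrict (Set.Ioi (0 : ℝ))) (F := kKernel b c)
    (F' := fun w t => -(c / (2 * w ^ 2)) * kKernel (b + 1) (c - 1) w t)
    (bound := fun t => |c| / (2 * ε ^ 2) *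
      (C * (t ^ (b + 1) * Real.exp (-(1 / 2) * t ^ (1 : ℝ)))))
    (Metric.ball_mem_nhds w₀ hε)
    (Filter.eventually_of_mem (Metric.ball_mem_nhds w₀ hε) fun w hw =>
      (continuousOn_kKernel b c (h w hw).1).aestronglyMeasurable measurableSet_Ioi)
    (integrableOn_kKernel hb c hw₀)
    ((continuousOn_const.mul (continuousOn_kKernel (b + 1) (c - 1) hw₀)).aestronglyMeasurable
      measurableSet_Ioi)
    (by
      rw [ae_restrict_iff' measurableSet_Ioi]
      refine Filter.Eventually.of_forall fun t ht w hw => ?_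
      obtain ⟨_, h2, h3⟩ := h w hw
      have h4 := hC (b + 1) t w ht (h3 t (le_of_lt ht)).1 (h3 t (le_of_lt ht)).2
      rw [norm_mul, norm_neg, norm_div, norm_mul, norm_pow, Complex.norm_real, Real.norm_eq_abs,
        Complex.norm_ofNat]
      gcongr)
    ((integrableOn_kernel_bound hb1 C).const_mul _)
    (by
      rw [ae_restrict_iff' measurableSet_Ioi]
      refine Filter.Eventually.of_forall fun t ht w hw => ?_
      have ht0 : (0 : ℝ) < t := ht
      have hws := (h w hw).1
      have hw0 := Complex.slitPlane_ne_zero hws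
      have hm := one_add_div_mem_slitPlane hws ht0.le
      have d1 : HasDerivAt (fun w : ℂ => 1 + (t : ℂ) / (2 * w)) (-(t : ℂ) / (2 * w ^ 2)) w := by
        refine (((hasDerivAt_const w (t : ℂ)).div ((hasDerivAt_id w).const_mul 2)
          (mul_ne_zero two_ne_zero hw0)).const_add 1).congr_deriv ?_
        simp only [id]
        field_simp
        ring
      refine ((d1.cpow_const (c := (c : ℂ)) hm).const_mul
        (((Real.exp (-t) * t ^ b : ℝ)) : ℂ)).congr_deriv ?_
      simp only [kKernel]
      rw [Real.rpow_add_one ht0.ne']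
      push_cast
      field_simp)
  refine key.2.congr_deriv ?_
  rw [kIntegral, ← integral_const_mul]

/-- The contiguity relation equivalent to the Bessel equation. -/
lemma kIntegral_contiguous {a : ℝ} (ha : -1 < a) {w : ℂ} (hw : w ∈ Complex.slitPlane) :
    (1 / w + 1) * kIntegral (a + 1) (a - 1) w +
      (a - 1) / (4 * w ^ 2) * kIntegral (a + 2) (a - 2) w = (a + 1) * kIntegral a a w := by
  have hw0 := Complex.slitPlane_ne_zero hw
  have i0 := integrableOn_kKernel ha a hw
  have i1 := integrableOn_kKernel (show -1 < a + 1 by linarith) (a - 1) hw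
  have i2 := integrableOn_kKernel (show -1 < a + 2 by linarith) (a - 2) hw
  set g' : ℝ → ℂ := fun t => (a + 1) * kKernel a a w t - (1 / w + 1) * kKernel (a + 1) (a - 1) w t -
    (a - 1) / (4 * w ^ 2) * kKernel (a + 2) (a - 2) w t with hg'
  have hint : IntegrableOn g' (Set.Ioi 0) :=
    ((i0.const_mul _).sub (i1.const_mul _)).sub (i2.const_mul _)
  -- The relation is the integral over `(0, ∞)` of the derivative of `e^{-t} t^{a+1} (1 +
  -- t/(2w))^{a-1}`, whose boundary values both vanish.
  have hderiv : ∀ t ∈ Set.Ioi (0 : ℝ), HasDerivAt (kKernel (a + 1) (a - 1) w) (g' t) t := by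
    intro t ht
    have ht0 : (0 : ℝ) < t := ht
    have hm := one_add_div_mem_slitPlane hw ht0.le
    have hm0 := Complex.slitPlane_ne_zero hm
    have d1 : HasDerivAt (fun t : ℝ => 1 + (t : ℂ) / (2 * w)) (1 / (2 * w)) t :=
      ((Complex.ofRealCLM.hasDerivAt (x := t)).div_const (2 * w)).const_add 1
    have d2 : HasDerivAt (fun t : ℝ => (1 + (t : ℂ) / (2 * w)) ^ (((a - 1 : ℝ)) : ℂ))
        (((a - 1 : ℝ) : ℂ) * (1 + (t : ℂ) / (2 * w)) ^ (((a - 1 : ℝ) : ℂ) - 1) * (1 / (2 * w)))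
        t := by
      have h := (hasDerivAt_id (1 + (t : ℂ) / (2 * w))).cpow_const (c := ((a - 1 : ℝ) : ℂ)) hm
      simp only [id, mul_one] at h
      exact h.comp t d1
    have d3 : HasDerivAt (fun t : ℝ => Real.exp (-t) * t ^ (a + 1))
        (-Real.exp (-t) * t ^ (a + 1) + Real.exp (-t) * ((a + 1) * t ^ a)) t := by
      refine ((hasDerivAt_neg t).exp.mul
        (Real.hasDerivAt_rpow_const (p := a + 1) (Or.inl ht0.ne'))).congr_deriv ?_
      rw [add_sub_cancel_right]
      ring
    refine (d3.ofReal_comp.mul d2).congr_deriv ?_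
    simp only [hg', kKernel]
    have c1 : ((a - 1 : ℝ) : ℂ) = ((a - 2 : ℝ) : ℂ) + 1 := by push_cast; ring
    have c2 : (a : ℂ) = ((a - 2 : ℝ) : ℂ) + 2 := by push_cast; ring
    have e1 : (1 + (t : ℂ) / (2 * w)) ^ ((a - 1 : ℝ) : ℂ) =
        (1 + (t : ℂ) / (2 * w)) ^ ((a - 2 : ℝ) : ℂ) * (1 + (t : ℂ) / (2 * w)) := by
      rw [c1, Complex.cpow_add _ _ hm0, Complex.cpow_one]
    have e2 : (1 + (t : ℂ) / (2 * w)) ^ (a : ℂ) =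
        (1 + (t : ℂ) / (2 * w)) ^ ((a - 2 : ℝ) : ℂ) * (1 + (t : ℂ) / (2 * w)) ^ 2 := by
      conv_lhs => rw [c2]
      rw [Complex.cpow_add _ _ hm0, Complex.cpow_ofNat]
    have e3 : ((a - 1 : ℝ) : ℂ) - 1 = ((a - 2 : ℝ) : ℂ) := by push_cast; ring
    have e4 : t ^ (a + 2) = t ^ a * t ^ 2 := by
      rw [Real.rpow_add ht0, Real.rpow_two]
    rw [e3, e1, e2, e4, Real.rpow_add_one ht0.ne']
    generalize (1 + (t : ℂ) / (2 * w)) ^ ((a - 2 : ℝ) : ℂ) = q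
    generalize t ^ a = u
    push_cast
    field_simp
    ring
  have hcont : ContinuousWithinAt (kKernel (a + 1) (a - 1) w) (Set.Ici 0) 0 := by
    refine ContinuousAt.continuousWithinAt (ContinuousAt.mul ?_ ?_)
    · exact Complex.continuous_ofReal.continuousAt.comp
        ((Real.continuous_exp.comp continuous_neg).continuousAt.mul
          (Real.continuousAt_rpow_const 0 (a + 1) (Or.inr (by linarith))))
    · exact ContinuousAt.cpow (by fun_prop) continuousAt_const
        (one_add_div_mem_slitPlane hw le_rfl)
  have hlim : Filter.Tendsto (kKernel (a + 1) (a - 1) w) Filter.atTop (nhds 0) := by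
    obtain ⟨ε, hε, A, hA, h⟩ := exists_bounds_one_add_div hw
    obtain ⟨C, -, hC⟩ := exists_kernel_bound A (a - 1) hA
    have h1 := (tendsto_rpow_mul_exp_neg_mul_atTop_nhds_zero (a + 1) (1 / 2)
      (by norm_num)).const_mul C
    rw [mul_zero] at h1
    refine squeeze_zero_norm' ?_ h1
    filter_upwards [Filter.eventually_gt_atTop 0] with t ht
    have := (h w (Metric.mem_ball_self hε)).2.2 t ht.le
    simpa using hC (a + 1) t w ht this.1 this.2
  have key := integral_Ioi_of_hasDerivAt_of_tendsto hcont hderiv hint hlim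
  have hz : kKernel (a + 1) (a - 1) w 0 = 0 := by
    rw [kKernel, Real.zero_rpow (by linarith)]
    simp
  rw [hz, sub_zero] at key
  simp only [hg'] at key
  have j0 : Integrable (fun t => ((a : ℂ) + 1) * kKernel a a w t) (volume.restrict (Set.Ioi 0)) :=
    i0.const_mul _
  have j1 : Integrable (fun t => (1 / w + 1) * kKernel (a + 1) (a - 1) w t)
    (volume.restrict (Set.Ioi 0)) := i1.const_mul _
  have j2 : Integrable (fun t => ((a : ℂ) - 1) / (4 * w ^ 2) * kKernel (a + 2) (a - 2) w t)
    (volume.restrict (Set.Ioi 0)) := i2.const_mul _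
  have j01 : Integrable (fun t => ((a : ℂ) + 1) * kKernel a a w t -
    (1 / w + 1) * kKernel (a + 1) (a - 1) w t) (volume.restrict (Set.Ioi 0)) := j0.sub j1
  rw [integral_sub j01 j2, integral_sub j0 j1, integral_const_mul, integral_const_mul,
    integral_const_mul] at key
  simp only [kIntegral]
  linear_combination -key

lemma besselK_eq (ν : ℝ) (w : ℂ) : besselK ν w =
    ((Real.pi : ℂ) / (2 * w)) ^ (1 / 2 : ℂ) * Complex.exp (-w) / Complex.Gamma ((ν : ℂ) + 1 / 2) *
      kIntegral (ν - 1 / 2) (ν - 1 / 2) w := by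
  rw [besselK, kIntegral]
  congr 2
  simp only [kKernel]
  push_cast
  rfl

/-- The elementary factor of `K_ν(ν z)`. -/
def kFactor (ν : ℝ) (z : ℂ) : ℂ :=
  ((Real.pi : ℂ) / (2 * (ν * z))) ^ (1 / 2 : ℂ) * Complex.exp (-(ν * z)) /
    Complex.Gamma ((ν : ℂ) + 1 / 2)

/-- Derivative of `z ↦ K_ν(ν z)`. -/
def besselK' (ν : ℝ) (z : ℂ) : ℂ :=
  kFactor ν z * (-(1 / (2 * z) + ν) * kIntegral (ν - 1 / 2) (ν - 1 / 2) (ν * z) -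
    (ν - 1 / 2) / (2 * ν * z ^ 2) * kIntegral (ν - 1 / 2 + 1) (ν - 1 / 2 - 1) (ν * z))

lemma inv_mem_slitPlane {z : ℂ} (hz : z ∈ Complex.slitPlane) : z⁻¹ ∈ Complex.slitPlane := by
  have h0 := Complex.slitPlane_ne_zero hz
  have hn : 0 < Complex.normSq z := Complex.normSq_pos.2 h0
  rw [Complex.mem_slitPlane_iff] at *
  rw [Complex.inv_re, Complex.inv_im]
  exact hz.imp (fun h => by positivity) fun h => div_ne_zero (neg_ne_zero.2 h) hn.ne'

lemma hasDerivAt_kFactor {ν : ℝ} (hν : 0 < ν) {z : ℂ} (hz : z ∈ Complex.slitPlane) :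
    HasDerivAt (kFactor ν) (-(1 / (2 * z) + ν) * kFactor ν z) z := by
  have hz0 := Complex.slitPlane_ne_zero hz
  have hν0 : (ν : ℂ) ≠ 0 := by exact_mod_cast hν.ne'
  have hπ : (Real.pi : ℂ) ≠ 0 := by exact_mod_cast Real.pi_pos.ne'
  have hm : (Real.pi : ℂ) / (2 * (ν * z)) ∈ Complex.slitPlane := by
    have := mul_mem_slitPlane (r := Real.pi / (2 * ν)) (by positivity) (inv_mem_slitPlane hz)
    convert this using 1
    push_cast
    field_simp
  have d1 : HasDerivAt (fun z : ℂ => (Real.pi : ℂ) / (2 * (ν * z)))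
      (-(Real.pi : ℂ) / (2 * ν * z ^ 2)) z := by
    refine ((hasDerivAt_const z (Real.pi : ℂ)).div
      (((hasDerivAt_id z).const_mul (ν : ℂ)).const_mul 2)
      (mul_ne_zero two_ne_zero (mul_ne_zero hν0 hz0))).congr_deriv ?_
    simp only [id]
    field_simp
    ring
  have d2 := (d1.cpow_const (c := (1 / 2 : ℂ)) hm).mul
    (((hasDerivAt_id z).const_mul (ν : ℂ)).fun_neg.cexp)
  refine (d2.div_const (Complex.Gamma ((ν : ℂ) + 1 / 2))).congr_deriv ?_
  rw [kFactor, Complex.cpow_sub _ _ (Complex.slitPlane_ne_zero hm), Complex.cpow_one]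
  simp only [id]
  field_simp
  ring

lemma hasDerivAt_kIntegral_scaled {ν : ℝ} (hν : 0 < ν) {b : ℝ} (hb : -1 < b) (c : ℝ) {z : ℂ}
    (hz : z ∈ Complex.slitPlane) :
    HasDerivAt (fun z : ℂ => kIntegral b c (ν * z))
      (-(c / (2 * ν * z ^ 2)) * kIntegral (b + 1) (c - 1) (ν * z)) z := by
  have hν0 : (ν : ℂ) ≠ 0 := by exact_mod_cast hν.ne'
  have hz0 := Complex.slitPlane_ne_zero hz
  refine ((hasDerivAt_kIntegral hb c (mul_mem_slitPlane hν hz)).comp z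
    ((hasDerivAt_id z).const_mul (ν : ℂ))).congr_deriv ?_
  field_simp

lemma hasDerivAt_besselK {ν : ℝ} (hν : 0 < ν) {z : ℂ} (hz : z ∈ Complex.slitPlane) :
    HasDerivAt (fun z => besselK ν (ν * z)) (besselK' ν z) z := by
  simp only [besselK_eq]
  refine ((hasDerivAt_kFactor hν hz).mul
    (hasDerivAt_kIntegral_scaled hν (by linarith) (ν - 1 / 2) hz)).congr_deriv ?_
  rw [besselK']
  push_cast
  ring

lemma hasDerivAt_besselK' {ν : ℝ} (hν : 0 < ν) {z : ℂ} (hz : z ∈ Complex.slitPlane) :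
    HasDerivAt (besselK' ν)
      (((ν : ℂ) ^ 2 * (1 + z ^ 2) * besselK ν (ν * z) - z * besselK' ν z) / z ^ 2) z := by
  have hz0 := Complex.slitPlane_ne_zero hz
  have hν0 : (ν : ℂ) ≠ 0 := by exact_mod_cast hν.ne'
  have d0 := hasDerivAt_kIntegral_scaled hν (show -1 < ν - 1 / 2 by linarith) (ν - 1 / 2) hz
  have d1 := hasDerivAt_kIntegral_scaled hν (show -1 < ν - 1 / 2 + 1 by linarith)
    (ν - 1 / 2 - 1) hz
  have hode := kIntegral_contiguous (show -1 < ν - 1 / 2 by linarith) (mul_mem_slitPlane hν hz)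
  rw [show ν - 1 / 2 + 2 = ν - 1 / 2 + 1 + 1 by ring,
    show ν - 1 / 2 - 2 = ν - 1 / 2 - 1 - 1 by ring] at hode
  have c0 : HasDerivAt (fun z : ℂ => -(1 / (2 * z) + (ν : ℂ))) (1 / (2 * z ^ 2)) z := by
    refine ((((hasDerivAt_const z (1 : ℂ)).div ((hasDerivAt_id z).const_mul 2)
      (mul_ne_zero two_ne_zero hz0)).add_const (ν : ℂ)).neg).congr_deriv ?_
    simp only [id]
    field_simp
    ring
  have c1 : HasDerivAt (fun z : ℂ => ((ν : ℂ) - 1 / 2) / (2 * ν * z ^ 2))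
      (-(((ν : ℂ) - 1 / 2) / (ν * z ^ 3))) z := by
    refine ((hasDerivAt_const z ((ν : ℂ) - 1 / 2)).div ((hasDerivAt_pow 2 z).const_mul
      (2 * (ν : ℂ))) (mul_ne_zero (mul_ne_zero two_ne_zero hν0)
        (pow_ne_zero 2 hz0))).congr_deriv ?_
    push_cast
    field_simp
    ring
  have h := (hasDerivAt_kFactor hν hz).mul ((c0.mul d0).sub (c1.mul d1))
  refine HasDerivAt.congr_deriv (f := besselK' ν) h ?_
  have e : besselK ν (ν * z) = kFactor ν z * kIntegral (ν - 1 / 2) (ν - 1 / 2) (ν * z) :=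
    besselK_eq ν (ν * z)
  rw [e, besselK']
  simp only [Pi.mul_apply, Pi.sub_apply]
  push_cast at hode ⊢
  generalize kIntegral (ν - 1 / 2) (ν - 1 / 2) (ν * z) = b0 at *
  generalize kIntegral (ν - 1 / 2 + 1) (ν - 1 / 2 - 1) (ν * z) = b1 at *
  generalize kIntegral (ν - 1 / 2 + 1 + 1) (ν - 1 / 2 - 1 - 1) (ν * z) = b2 at *
  generalize kFactor ν z = P
  clear d0 d1 c0 c1 h e
  -- The contiguity relation appears in the Bessel equation with the factor `(ν - 1/2)/z²`, coming
  -- from differentiating the power with exponent `ν - 1/2`; at `ν = 1/2` it is not needed.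
  have key : ((ν : ℂ) - 1 / 2) / z ^ 2 * ((1 / (ν * z) + 1) * b1 +
      (((ν : ℂ) - 1 / 2) - 1) / (4 * (ν * z) ^ 2) * b2) =
      ((ν : ℂ) - 1 / 2) / z ^ 2 * ((((ν : ℂ) - 1 / 2) + 1) * b0) := by rw [hode]
  field_simp at key ⊢
  linear_combination P * key

end

noncomputable section

open MeasureTheory

/-! ### Error bounds for the expansions -/

/-! ### Behaviour of `K_ν` as `Re z → +∞` -/

/-- The filter `Re z → +∞`. -/
def reAtTop : Filter ℂ := Filter.comap Complex.re Filter.atTop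

lemma eventually_reAtTop (r : ℝ) : ∀ᶠ z in reAtTop, r < z.re :=
  Filter.tendsto_comap.eventually (Filter.eventually_gt_atTop r)

lemma tendsto_inv_reAtTop : Filter.Tendsto (fun z : ℂ => z⁻¹) reAtTop (nhds 0) := by
  have h : Filter.Tendsto (fun z : ℂ => (z.re)⁻¹) reAtTop (nhds 0) :=
    tendsto_inv_atTop_zero.comp Filter.tendsto_comap
  refine squeeze_zero_norm' ?_ h
  filter_upwards [eventually_reAtTop 0] with z hz
  rw [norm_inv]
  exact inv_anti₀ hz (Complex.re_le_norm z)

/-- Dominated convergence: the power tends to `1`, leaving Euler's integral. Once `Re(νz) ≥ 1/2`,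
the modulus of `1 + t/(2νz)` lies between `1` and `1 + t`, so one majorant suffices. -/
lemma tendsto_kIntegral {ν : ℝ} (hν : 0 < ν) {b : ℝ} (hb : -1 < b) (c : ℝ) :
    Filter.Tendsto (fun z : ℂ => kIntegral b c (ν * z)) reAtTop
      (nhds (Complex.Gamma ((b : ℂ) + 1))) := by
  obtain ⟨C, -, hC⟩ := exists_kernel_bound 1 c le_rfl
  have hlim : Complex.Gamma ((b : ℂ) + 1) =
      ∫ t in Set.Ioi (0 : ℝ), ((Real.exp (-t) * t ^ b : ℝ) : ℂ) := by
    rw [integral_complex_ofReal]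
    have := Real.Gamma_eq_integral (show 0 < b + 1 by linarith)
    rw [add_sub_cancel_right] at this
    rw [← this, ← Complex.Gamma_ofReal]
    push_cast
    rfl
  rw [hlim]
  have : reAtTop.IsCountablyGenerated := by unfold reAtTop; infer_instance
  have hlarge : ∀ᶠ z : ℂ in reAtTop, 1 / 2 ≤ ((ν : ℂ) * z).re := by
    filter_upwards [eventually_reAtTop (1 / (2 * ν))] with z hz
    rw [Complex.re_ofReal_mul]
    rw [div_lt_iff₀ (by positivity)] at hz
    linarith
  refine tendsto_integral_filter_of_dominated_convergence
    (fun t : ℝ => C * (t ^ b * Real.exp (-(1 / 2) * t ^ (1 : ℝ)))) ?_ ?_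
    (integrableOn_kernel_bound hb C) ?_
  · filter_upwards [hlarge] with z hz
    exact (continuousOn_kKernel b c (Or.inl (by linarith))).aestronglyMeasurable measurableSet_Ioi
  · filter_upwards [hlarge] with z hz
    rw [ae_restrict_iff' measurableSet_Ioi]
    refine Filter.Eventually.of_forall fun t ht => ?_
    have ht0 : (0 : ℝ) < t := ht
    set w : ℂ := ν * z
    have hw0 : w ≠ 0 := fun h => by rw [h] at hz; norm_num at hz
    have hre : 1 ≤ (1 + (t : ℂ) / (2 * w)).re := by
      have h2 : 0 ≤ ((t : ℂ) / (2 * w)).re := by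
        rw [Complex.div_re, Complex.ofReal_re, Complex.ofReal_im, zero_mul, zero_div, add_zero]
        refine div_nonneg (mul_nonneg ht0.le ?_) (Complex.normSq_nonneg _)
        simp; linarith
      rw [Complex.add_re, Complex.one_re]
      linarith
    refine hC b t w ht0 (by rw [inv_one]; exact hre.trans (Complex.re_le_norm _)) ?_
    refine (norm_add_le _ _).trans ?_
    rw [norm_one, one_mul, norm_div, norm_mul, Complex.norm_real, Complex.norm_ofNat,
      Real.norm_of_nonneg ht0.le]
    have hwn := Complex.re_le_norm w
    have : t / (2 * ‖w‖) ≤ t := div_le_self ht0.le (by linarith)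
    linarith
  · rw [ae_restrict_iff' measurableSet_Ioi]
    refine Filter.Eventually.of_forall fun t _ => ?_
    have h1 : Filter.Tendsto (fun z : ℂ => 1 + (t : ℂ) / (2 * (ν * z))) reAtTop (nhds 1) := by
      have := (tendsto_inv_reAtTop.const_mul ((t : ℂ) / (2 * ν))).const_add 1
      rw [mul_zero, add_zero] at this
      refine this.congr fun z => ?_
      rw [← div_eq_mul_inv, div_div, mul_assoc]
    have h2 : Filter.Tendsto (fun z : ℂ => (1 + (t : ℂ) / (2 * (ν * z))) ^ (c : ℂ)) reAtTop
        (nhds (1 ^ (c : ℂ))) :=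
      (continuousAt_cpow_const (b := (c : ℂ)) (Or.inl (by norm_num))).tendsto.comp h1
    rw [Complex.one_cpow] at h2
    have h3 := h2.const_mul ((Real.exp (-t) * t ^ b : ℝ) : ℂ)
    rw [mul_one] at h3
    exact h3

/-- `log (1 - i/z) + log (1 + i/z)`. -/
def logCorrection (z : ℂ) : ℂ :=
  Complex.log (1 - Complex.I * z⁻¹) + Complex.log (1 + Complex.I * z⁻¹)

lemma tendsto_logCorrection : Filter.Tendsto logCorrection reAtTop (nhds 0) := by
  have h1 := (tendsto_inv_reAtTop.const_mul Complex.I)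
  have hlog : ContinuousAt Complex.log 1 := continuousAt_clog (Or.inl (by norm_num))
  have h2 : Filter.Tendsto (fun z : ℂ => 1 - Complex.I * z⁻¹) reAtTop (nhds 1) := by
    simpa using h1.const_sub 1
  have h3 : Filter.Tendsto (fun z : ℂ => 1 + Complex.I * z⁻¹) reAtTop (nhds 1) := by
    simpa using h1.const_add 1
  have := (hlog.tendsto.comp h2).add (hlog.tendsto.comp h3)
  rw [Complex.log_one, add_zero] at this
  exact this

lemma log_sub_add_log_add {z : ℂ} (hz : 0 < z.re) :
    Complex.log (z - Complex.I) + Complex.log (z + Complex.I) =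
      2 * Complex.log z + logCorrection z := by
  have hz0 : z ≠ 0 := fun h => by simp [h] at hz
  have h1 := log_div_of_re_pos (z := z - Complex.I) (w := z) (by simpa) hz
  have h2 := log_div_of_re_pos (z := z + Complex.I) (w := z) (by simpa) hz
  rw [sub_div, div_self hz0, div_eq_mul_inv] at h1
  rw [add_div, div_self hz0, div_eq_mul_inv] at h2
  rw [logCorrection, h1, h2]
  ring

lemma sqrtBr_eq_mul_exp {z : ℂ} (hz : 0 < z.re) :
    sqrtBr z = z * Complex.exp (logCorrection z / 2) := by
  have hz0 : z ≠ 0 := fun h => by simp [h] at hz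
  obtain ⟨h1, h2⟩ := slitPlane_of_re_pos_or_im (Or.inl hz)
  rw [sqrtBr_eq_exp (Complex.slitPlane_ne_zero h1) (Complex.slitPlane_ne_zero h2),
    log_sub_add_log_add hz, add_div, Complex.exp_add, mul_div_cancel_left₀ _ two_ne_zero,
    Complex.exp_log hz0]

lemma fourthRootBr_eq_exp {z : ℂ} (hz : 0 < z.re) :
    fourthRootBr z = Complex.exp (Complex.log z / 2 + logCorrection z / 4) := by
  obtain ⟨h1, h2⟩ := slitPlane_of_re_pos_or_im (Or.inl hz)
  rw [fourthRootBr, Complex.cpow_def_of_ne_zero (Complex.slitPlane_ne_zero h1),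
    Complex.cpow_def_of_ne_zero (Complex.slitPlane_ne_zero h2), ← Complex.exp_add]
  congr 1
  linear_combination (1 / 4) * log_sub_add_log_add hz

lemma tendsto_sqrtBr_div : Filter.Tendsto (fun z => sqrtBr z / z) reAtTop (nhds 1) := by
  have h := (tendsto_logCorrection.div_const 2).cexp
  rw [zero_div, Complex.exp_zero] at h
  refine h.congr' ?_
  filter_upwards [eventually_reAtTop 0] with z hz
  have hz0 : z ≠ 0 := fun h => by simp [h] at hz
  rw [sqrtBr_eq_mul_exp hz, mul_div_cancel_left₀ _ hz0]

lemma tendsto_div_sqrtBr : Filter.Tendsto (fun z => z / sqrtBr z) reAtTop (nhds 1) := by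
  have := tendsto_sqrtBr_div.inv₀ one_ne_zero
  rw [inv_one] at this
  exact this.congr fun z => inv_div _ _

lemma tendsto_pVar : Filter.Tendsto pVar reAtTop (nhds 0) := by
  have := tendsto_div_sqrtBr.mul tendsto_inv_reAtTop
  rw [mul_zero] at this
  refine this.congr' ?_
  filter_upwards [eventually_reAtTop 0] with z hz
  have hz0 : z ≠ 0 := fun h => by simp [h] at hz
  rw [pVar]
  field_simp

/-- Two limits: `(1+z²)^{1/2} - z = 1/((1+z²)^{1/2} + z) → 0`, and the argument of the logarithm
tends to `1`. -/
lemma tendsto_xi_sub : Filter.Tendsto (fun z => xi z - z) reAtTop (nhds 0) := by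
  have h1 : Filter.Tendsto (fun z => z⁻¹ / (sqrtBr z / z + 1)) reAtTop (nhds 0) := by
    have := tendsto_inv_reAtTop.div (tendsto_sqrtBr_div.add_const 1) (by norm_num)
    rw [zero_div] at this
    exact this
  have h2 : Filter.Tendsto (fun z => (z⁻¹ + sqrtBr z / z)⁻¹) reAtTop (nhds 1) := by
    have := (tendsto_inv_reAtTop.add tendsto_sqrtBr_div).inv₀ (by norm_num)
    simpa using this
  have h3 := (continuousAt_clog (x := 1) (Or.inl (by norm_num))).tendsto.comp h2
  have h4 := h1.add h3
  rw [Complex.log_one, add_zero] at h4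
  refine h4.congr' ?_
  filter_upwards [eventually_reAtTop 0] with z hz
  have hz0 : z ≠ 0 := fun h => by simp [h] at hz
  have hsp := re_sqrtBr_pos (Or.inl hz)
  have hsz : sqrtBr z + z ≠ 0 := fun h => by
    have := congrArg Complex.re h
    simp at this; linarith
  have hs1 := one_add_sqrtBr_ne_zero hz0
  have h5 := sqrtBr_sq z
  have e1 : z⁻¹ / (sqrtBr z / z + 1) = sqrtBr z - z := by
    have : sqrtBr z / z + 1 = (sqrtBr z + z) / z := by field_simp
    rw [this]
    field_simp
    linear_combination -h5
  have e2 : (z⁻¹ + sqrtBr z / z)⁻¹ = z / (1 + sqrtBr z) := by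
    have : z⁻¹ + sqrtBr z / z = (1 + sqrtBr z) / z := by field_simp
    rw [this, inv_div]
  simp only [Function.comp_apply]
  rw [e1, e2, xi]
  ring

lemma aeval_zero_Ftilde (s : ℕ) : Polynomial.aeval (0 : ℂ) (Ftilde s) = 0 := by
  rw [Ftilde_eq]; simp

lemma Etilde_zero (s : ℕ) : Etilde s 0 = 0 := by simp [Etilde]

lemma continuous_Etilde (s : ℕ) : Continuous (Etilde s) := by
  have : Etilde s = fun p => Polynomial.aeval p (Epoly s) := funext (Etilde_eq s)
  rw [this]
  exact (Epoly s).continuous_aeval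

lemma tendsto_vFun (N : ℕ) (μ : ℂ) :
    Filter.Tendsto (fun z => vFun N μ (pVar z)) reAtTop (nhds μ) := by
  have := ((continuousOn_vFun N μ).tendsto 0).comp tendsto_pVar
  simpa [vFun, aeval_zero_Ftilde, Function.comp_def] using this

/-- The normalising constant for `K_ν`. -/
def kNorm (ν : ℝ) : ℂ := (((Real.sqrt (Real.pi / (2 * ν)))⁻¹ : ℝ) : ℂ)

/-- The powers `z^{±1/2}` and the constant `(π/(2ν))^{1/2}` cancel, and `exp(νξ)` meets `exp(-νz)`.
What remains tends to `1/Γ(ν+1/2)`, the reciprocal of the limit of the integral factor. -/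
lemma prefactor_besselK {ν : ℝ} (hν : 0 < ν) (N : ℕ) {z : ℂ} (hz : 0 < z.re) :
    fourthRootBr z * Complex.exp (-lgExponent (-(ν : ℂ)) (fun _ => 0) N z) * kNorm ν * kFactor ν z =
      Complex.exp (logCorrection z / 4 + ν * (xi z - z) -
        ∑ s ∈ Finset.Ico 1 N, (Etilde s (pVar z) - 0) / (-(ν : ℂ)) ^ s) /
          Complex.Gamma ((ν : ℂ) + 1 / 2) := by
  have hz0 : z ≠ 0 := fun h => by simp [h] at hz
  set r : ℝ := Real.pi / (2 * ν) with hr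
  have hr0 : 0 < r := by positivity
  have hlog : Complex.log ((Real.pi : ℂ) / (2 * (ν * z))) = (Real.log r : ℂ) - Complex.log z := by
    have e : (Real.pi : ℂ) / (2 * (ν * z)) = (r : ℂ) / z := by
      rw [hr]; push_cast; rw [div_div, mul_assoc]
    rw [e, log_div_of_re_pos (by simpa using hr0) hz, Complex.ofReal_log hr0.le]
  have hne : (Real.pi : ℂ) / (2 * (ν * z)) ≠ 0 := by
    have h1 : (ν : ℂ) ≠ 0 := by exact_mod_cast hν.ne'
    have h2 : (Real.pi : ℂ) ≠ 0 := by exact_mod_cast Real.pi_pos.ne'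
    exact div_ne_zero h2 (mul_ne_zero two_ne_zero (mul_ne_zero h1 hz0))
  have hk : kNorm ν = Complex.exp (-(Real.log r : ℂ) / 2) := by
    rw [kNorm, ← hr, Real.sqrt_eq_rpow, ← Real.rpow_neg hr0.le, Real.rpow_def_of_pos hr0,
      Complex.ofReal_exp]
    congr 1
    push_cast
    ring
  rw [fourthRootBr_eq_exp hz, hk, kFactor, Complex.cpow_def_of_ne_zero hne, hlog, lgExponent]
  rw [mul_div_assoc', ← Complex.exp_add, ← Complex.exp_add, ← Complex.exp_add, ← Complex.exp_add]
  congr 2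
  ring

lemma tendsto_relError_besselK {ν : ℝ} (hν : 0 < ν) (N : ℕ) :
    Filter.Tendsto (relError (fun z => besselK ν (ν * z)) (-(ν : ℂ)) (fun _ => 0) (kNorm ν) N)
      reAtTop (nhds 0) ∧
    Filter.Tendsto (relErrorDeriv (fun z => besselK ν (ν * z)) (besselK' ν) (-(ν : ℂ))
      (fun _ => 0) (kNorm ν) N) reAtTop (nhds 0) := by
  set G : ℂ := Complex.Gamma ((ν : ℂ) + 1 / 2) with hG
  have hG0 : G ≠ 0 := by
    have h : G = (Real.Gamma (ν + 1 / 2) : ℂ) := by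
      rw [hG, ← Complex.Gamma_ofReal]; push_cast; rfl
    rw [h]
    exact_mod_cast (Real.Gamma_pos_of_pos (show 0 < ν + 1 / 2 by linarith)).ne'
  set M : ℂ → ℂ := fun z => fourthRootBr z *
    Complex.exp (-lgExponent (-(ν : ℂ)) (fun _ => 0) N z) * kNorm ν * kFactor ν z with hM
  have hMlim : Filter.Tendsto M reAtTop (nhds (1 / G)) := by
    have hsum : Filter.Tendsto (fun z => ∑ s ∈ Finset.Ico 1 N,
        (Etilde s (pVar z) - 0) / (-(ν : ℂ)) ^ s) reAtTop (nhds 0) := by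
      have := tendsto_finsetSum (Finset.Ico 1 N) fun s _ =>
        (((continuous_Etilde s).tendsto 0).comp tendsto_pVar |>.sub_const 0).div_const
          ((-(ν : ℂ)) ^ s)
      simpa [Etilde_zero] using this
    have h1 := ((((tendsto_logCorrection.div_const 4).add (tendsto_xi_sub.const_mul (ν : ℂ))).sub
      hsum).cexp).div_const G
    simp only [zero_div, mul_zero, add_zero, sub_self, Complex.exp_zero] at h1
    refine h1.congr' ?_
    filter_upwards [eventually_reAtTop 0] with z hz
    exact (prefactor_besselK hν N hz).symm
  have hJ0 : Filter.Tendsto (fun z : ℂ => kIntegral (ν - 1 / 2) (ν - 1 / 2) (ν * z)) reAtTop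
      (nhds G) := by
    have := tendsto_kIntegral hν (show -1 < ν - 1 / 2 by linarith) (ν - 1 / 2)
    convert this using 2
    rw [hG]; push_cast; ring_nf
  have hJ1 := tendsto_kIntegral hν (show -1 < ν - 1 / 2 + 1 by linarith) (ν - 1 / 2 - 1)
  constructor
  · have h := (hMlim.mul hJ0).sub_const 1
    rw [one_div_mul_cancel hG0, sub_self] at h
    refine h.congr fun z => ?_
    rw [relError, besselK_eq, ← mul_assoc, ← mul_assoc]
    simp only [hM, kFactor]
    ring_nf
  · have hz2 : Filter.Tendsto (fun z => z ^ 2 / (2 * sqrtBr z ^ 3)) reAtTop (nhds 0) := by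
      have := ((tendsto_div_sqrtBr.pow 2).mul tendsto_pVar).div_const 2
      rw [mul_zero, zero_div] at this
      refine this.congr fun z => ?_
      rw [pVar]
      field_simp
    have hlin : Filter.Tendsto (fun z : ℂ => -(z⁻¹ / 2 + ν)) reAtTop (nhds (-ν)) := by
      have := ((tendsto_inv_reAtTop.div_const 2).add_const (ν : ℂ)).neg
      simpa using this
    have hinv2 : Filter.Tendsto (fun z : ℂ => ((ν : ℂ) - 1 / 2) / (2 * ν) * z⁻¹ ^ 2) reAtTop
        (nhds 0) := by
      have := (tendsto_inv_reAtTop.pow 2).const_mul (((ν : ℂ) - 1 / 2) / (2 * ν))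
      simpa using this
    -- In the `ξ`-derivative the logarithmic derivative of the elementary factor contributes `-ν` in
    -- the limit, and subtracting `v → μ = -ν` cancels it; the term with the second integral is of
    -- order `z^{-2}`.
    have h := hMlim.mul ((hJ0.mul ((hz2.add (tendsto_div_sqrtBr.mul hlin)).sub
      (tendsto_vFun N (-(ν : ℂ))))).sub (tendsto_div_sqrtBr.mul (hinv2.mul hJ1)))
    simp only [zero_mul, mul_zero, zero_add, one_mul, sub_self, mul_zero] at h
    refine h.congr fun z => ?_
    have e : besselK ν (ν * z) = kFactor ν z * kIntegral (ν - 1 / 2) (ν - 1 / 2) (ν * z) :=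
      besselK_eq ν (ν * z)
    rw [relErrorDeriv, e, besselK']
    simp only [hM]
    generalize kIntegral (ν - 1 / 2) (ν - 1 / 2) (ν * z) = b0
    generalize kIntegral (ν - 1 / 2 + 1) (ν - 1 / 2 - 1) (ν * z) = b1
    simp only [div_eq_mul_inv, mul_inv, inv_pow]
    ring

/-! ### The expansions with `n` terms -/

/-- Passage from the relative error with `N` terms to that with `n` terms. -/
lemma norm_error_of_more_terms {A B : ℂ} {n N : ℕ} (hnN : n ≤ N) (hn : 1 ≤ n) (a : ℕ → ℂ)
    {e E : ℂ}
    (he : 1 + e = A * Complex.exp (-(B + ∑ s ∈ Finset.Ico 1 n, a s)))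
    (hE : 1 + E = A * Complex.exp (-(B + ∑ s ∈ Finset.Ico 1 N, a s))) :
    ‖e‖ ≤ ‖Complex.exp (∑ s ∈ Finset.Ico n N, a s) - 1‖ +
      Real.exp (∑ s ∈ Finset.Ico n N, (a s).re) * ‖E‖ := by
  have h1 : 1 + e = Complex.exp (∑ s ∈ Finset.Ico n N, a s) * (1 + E) := by
    rw [he, hE, ← Finset.sum_Ico_consecutive a hn hnN, mul_left_comm, ← Complex.exp_add]
    congr 2
    ring
  have h2 : e = (Complex.exp (∑ s ∈ Finset.Ico n N, a s) - 1) +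
      Complex.exp (∑ s ∈ Finset.Ico n N, a s) * E := by linear_combination h1
  calc ‖e‖ ≤ ‖Complex.exp (∑ s ∈ Finset.Ico n N, a s) - 1‖ +
        ‖Complex.exp (∑ s ∈ Finset.Ico n N, a s) * E‖ := by
        conv_lhs => rw [h2]
        exact norm_add_le _ _
    _ = _ := by rw [norm_mul, Complex.norm_exp, Complex.re_sum]

lemma one_add_relError (B : ℂ → ℂ) (μ : ℂ) (κ : ℕ → ℂ) (c : ℂ) (N : ℕ) (z : ℂ) :
    1 + relError B μ κ c N z = fourthRootBr z * c * B z * Complex.exp (-(μ * xi z +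
      ∑ s ∈ Finset.Ico 1 N, (Etilde s (pVar z) - κ s) / μ ^ s)) := by
  rw [relError, lgExponent]; ring

lemma eq_mul_one_add_relError (B : ℂ → ℂ) (μ : ℂ) (κ : ℕ → ℂ) {c : ℂ} (hc : c ≠ 0) (N : ℕ) {z : ℂ}
    (hz : z ∈ cutPlane) :
    B z = c⁻¹ / fourthRootBr z * Complex.exp (μ * xi z +
      ∑ s ∈ Finset.Ico 1 N, (Etilde s (pVar z) - κ s) / μ ^ s) *
        (1 + relError B μ κ c N z) := by
  have hf := fourthRootBr_ne_zero (cutPlane_sub_I hz) (cutPlane_add_I hz)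
  rw [one_add_relError, Complex.exp_neg]
  have := Complex.exp_ne_zero (μ * xi z +
      ∑ s ∈ Finset.Ico 1 N, (Etilde s (pVar z) - κ s) / μ ^ s)
  field_simp

lemma norm_relError_besselI_le {ν : ℝ} (hν : 0 < ν) {N : ℕ} (hN : 1 ≤ N) {γ : ℝ → ℂ} {z : ℂ}
    (hγ : IsProgressiveFromZero γ z) :
    ‖relError (fun z => besselI ν (ν * z)) ν (fun s => kConst s)
      ((Real.exp ν * Real.Gamma (ν + 1) / ν ^ ν : ℝ) : ℂ) N z‖ ≤
      omegaErr N ν γ / ν ^ N * Real.exp (varpiErr N ν γ / ν + omegaErr N ν γ / ν ^ N) := by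
  obtain ⟨h1, h2⟩ := tendsto_relError_besselI hν N hγ
  have := norm_relError_le hν (σ := 1) (by norm_num) hN
    (fun z hz => hasDerivAt_besselI hν (cutPlane_slitPlane hz))
    (fun z hz => hasDerivAt_besselI' hν (cutPlane_slitPlane hz)) (fun s => kConst s)
    ((Real.exp ν * Real.Gamma (ν + 1) / ν ^ ν : ℝ) : ℂ) hγ.toIsArcChain
  simp only [Complex.ofReal_one, one_mul] at this
  exact this hγ.mono h1 h2

lemma norm_relError_besselK_le {ν : ℝ} (hν : 0 < ν) {N : ℕ} (hN : 1 ≤ N) {γ : ℝ → ℂ} {z : ℂ}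
    (hγ : IsProgressiveFromInfinity γ z) :
    ‖relError (fun z => besselK ν (ν * z)) (-(ν : ℂ)) (fun _ => 0) (kNorm ν) N z‖ ≤
      omegaErr N ν γ / ν ^ N * Real.exp (varpiErr N ν γ / ν + omegaErr N ν γ / ν ^ N) := by
  obtain ⟨h1, h2⟩ := tendsto_relError_besselK hν N
  have hs : Filter.Tendsto γ (nhdsWithin 0 (Set.Ioi 0)) reAtTop :=
    Filter.tendsto_comap_iff.2 hγ.start
  have := norm_relError_le hν (σ := -1) (by norm_num) hN
    (fun z hz => hasDerivAt_besselK hν (cutPlane_slitPlane hz))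
    (fun z hz => hasDerivAt_besselK' hν (cutPlane_slitPlane hz)) (fun _ => 0)
    (kNorm ν) hγ.toIsArcChain
  simp only [Complex.ofReal_neg, Complex.ofReal_one, neg_mul, one_mul] at this
  exact this hγ.anti.neg (h1.comp hs) (h2.comp hs)

/-- The expansions with their error bounds. -/
theorem besselI_expansion {ν : ℝ} (hν : 0 < ν) : ∃ η : ℕ → ℂ → ℂ, ∀ n : ℕ, 1 ≤ n → ∀ z ∈ cutPlane,
    besselI ν (ν * z) =
          ((ν ^ ν / (Real.exp ν * Real.Gamma (ν + 1)) : ℝ) : ℂ) / fourthRootBr z *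
            Complex.exp (ν * xi z +
              ∑ s ∈ Finset.Ico 1 n, (Etilde s (pVar z) - kConst s) / (ν : ℂ) ^ s) *
            (1 + η n z) ∧
        ∀ r : ℕ, ∀ γ : ℝ → ℂ, IsProgressiveFromZero γ z →
          ‖η n z‖ ≤
            ‖Complex.exp (∑ s ∈ Finset.Ico n (n + r),
                (Etilde s (pVar z) - kConst s) / (ν : ℂ) ^ s) - 1‖ +
            omegaErr (n + r) ν γ / ν ^ (n + r) *
              Real.exp (varpiErr (n + r) ν γ / ν +
                ∑ s ∈ Finset.Ico n (n + r), ((Etilde s (pVar z)).re - kConst s) / ν ^ s +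
                omegaErr (n + r) ν γ / ν ^ (n + r)) := by
  set c : ℂ := ((Real.exp ν * Real.Gamma (ν + 1) / ν ^ ν : ℝ) : ℂ) with hc
  have hc' : c⁻¹ = ((ν ^ ν / (Real.exp ν * Real.Gamma (ν + 1)) : ℝ) : ℂ) := by
    rw [hc, ← Complex.ofReal_inv, inv_div]
  have hc0 : c ≠ 0 := by
    have h1 := Real.Gamma_pos_of_pos (show 0 < ν + 1 by linarith)
    have h2 := Real.rpow_pos_of_pos hν ν
    have : 0 < Real.exp ν * Real.Gamma (ν + 1) / ν ^ ν := by positivity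
    exact Complex.ofReal_ne_zero.2 this.ne'
  refine ⟨fun n z => relError (fun z => besselI ν (ν * z)) ν (fun s => kConst s) c n z,
    fun n hn z hz => ⟨?_, fun r γ hγ => ?_⟩⟩
  · rw [← hc']
    exact eq_mul_one_add_relError (fun z => besselI ν (ν * z)) ν (fun s => kConst s) hc0 n hz
  · have hE := norm_relError_besselI_le hν (N := n + r) (by omega) hγ
    refine (norm_error_of_more_terms (Nat.le_add_right n r) hn _
      (one_add_relError (fun z => besselI ν (ν * z)) ν (fun s => kConst s) c n z)
      (one_add_relError (fun z => besselI ν (ν * z)) ν (fun s => kConst s) c (n + r) z)).trans ?_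
    refine add_le_add le_rfl ?_
    have e : ∀ s, ((Etilde s (pVar z) - kConst s) / (ν : ℂ) ^ s).re =
        ((Etilde s (pVar z)).re - kConst s) / ν ^ s := fun s => by
      rw [← Complex.ofReal_pow, Complex.div_ofReal_re, Complex.sub_re, Complex.ofReal_re]
    simp only [e]
    refine (mul_le_mul_of_nonneg_left hE (Real.exp_pos _).le).trans_eq ?_
    rw [mul_left_comm, ← Real.exp_add]
    congr 2
    ring

theorem besselK_expansion {ν : ℝ} (hν : 0 < ν) : ∃ η : ℕ → ℂ → ℂ, ∀ n : ℕ, 1 ≤ n → ∀ z ∈ cutPlane,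
    besselK ν (ν * z) =
          ((Real.sqrt (Real.pi / (2 * ν)) : ℝ) : ℂ) / fourthRootBr z *
            Complex.exp (-(ν * xi z) +
              ∑ s ∈ Finset.Ico 1 n, (-1) ^ s * (Etilde s (pVar z) / (ν : ℂ) ^ s)) *
            (1 + η n z) ∧
        ∀ r : ℕ, ∀ γ : ℝ → ℂ, IsProgressiveFromInfinity γ z →
          ‖η n z‖ ≤
            ‖Complex.exp (∑ s ∈ Finset.Ico n (n + r),
                (-1) ^ s * (Etilde s (pVar z) / (ν : ℂ) ^ s)) - 1‖ +
            omegaErr (n + r) ν γ / ν ^ (n + r) *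
              Real.exp (varpiErr (n + r) ν γ / ν +
                ∑ s ∈ Finset.Ico n (n + r), (-1) ^ s * ((Etilde s (pVar z)).re / ν ^ s) +
                omegaErr (n + r) ν γ / ν ^ (n + r)) := by
  have hc' : (kNorm ν)⁻¹ = ((Real.sqrt (Real.pi / (2 * ν)) : ℝ) : ℂ) := by
    rw [kNorm, ← Complex.ofReal_inv, inv_inv]
  have hc0 : kNorm ν ≠ 0 := by
    have := Real.pi_pos
    have : 0 < (Real.sqrt (Real.pi / (2 * ν)))⁻¹ := by positivity
    rw [kNorm]
    exact_mod_cast this.ne'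
  have hterm : ∀ (z : ℂ) (s : ℕ), (Etilde s (pVar z) - 0) / (-(ν : ℂ)) ^ s =
      (-1) ^ s * (Etilde s (pVar z) / (ν : ℂ) ^ s) := fun z s => by
    rw [sub_zero, neg_pow]
    rcases neg_one_pow_eq_or ℂ s with h | h <;> rw [h] <;> ring
  refine ⟨fun n z => relError (fun z => besselK ν (ν * z)) (-(ν : ℂ)) (fun _ => 0) (kNorm ν) n z,
    fun n hn z hz => ⟨?_, fun r γ hγ => ?_⟩⟩
  · have := eq_mul_one_add_relError (fun z => besselK ν (ν * z)) (-(ν : ℂ)) (fun _ => 0) hc0 n hz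
    simp only [hterm, hc', neg_mul] at this
    exact this
  · have hE := norm_relError_besselK_le hν (N := n + r) (by omega) hγ
    have key := norm_error_of_more_terms (Nat.le_add_right n r) hn _
      (one_add_relError (fun z => besselK ν (ν * z)) (-(ν : ℂ)) (fun _ => 0) (kNorm ν) n z)
      (one_add_relError (fun z => besselK ν (ν * z)) (-(ν : ℂ)) (fun _ => 0) (kNorm ν) (n + r) z)
    simp only [hterm] at key
    refine key.trans (add_le_add le_rfl ?_)
    have e : ∀ s, ((-1) ^ s * (Etilde s (pVar z) / (ν : ℂ) ^ s)).re =
        (-1) ^ s * ((Etilde s (pVar z)).re / ν ^ s) := fun s => by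
      rw [← Complex.ofReal_pow ν, show ((-1 : ℂ)) ^ s = (((-1 : ℝ) ^ s : ℝ) : ℂ) by push_cast; rfl,
        Complex.re_ofReal_mul, Complex.div_ofReal_re]
    simp only [e]
    refine (mul_le_mul_of_nonneg_left hE (Real.exp_pos _).le).trans_eq ?_
    rw [mul_left_comm, ← Real.exp_add]
    congr 2
    ring

end

noncomputable section

open MeasureTheory

/-! ### Directions in which `Re ξ` increases -/

lemma sqrtBr_re_im (z : ℂ) : (sqrtBr z).re ^ 2 - (sqrtBr z).im ^ 2 = 1 + z.re ^ 2 - z.im ^ 2 ∧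
    (sqrtBr z).re * (sqrtBr z).im = z.re * z.im := by
  have h := sqrtBr_sq z
  have h1 := congrArg Complex.re h
  have h2 := congrArg Complex.im h
  simp [sq] at h1 h2
  constructor <;> linarith

/-- `Re((s/z) d)` has the sign of `Re(s z̄ d)`; with `dξ/dz = s/z` this decides monotonicity of `Re
ξ` in the direction `d`. -/
lemma re_div_mul_nonneg {s z d : ℂ}
    (h : 0 ≤ (s.re * z.re + s.im * z.im) * d.re - (s.im * z.re - s.re * z.im) * d.im) :
    0 ≤ (s / z * d).re := by
  rw [Complex.mul_re, Complex.div_re, Complex.div_im]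
  have e : (s.re * z.re / Complex.normSq z + s.im * z.im / Complex.normSq z) * d.re -
      (s.im * z.re / Complex.normSq z - s.re * z.im / Complex.normSq z) * d.im =
      ((s.re * z.re + s.im * z.im) * d.re - (s.im * z.re - s.re * z.im) * d.im) /
        Complex.normSq z := by ring
  rw [e]
  exact div_nonneg h (Complex.normSq_nonneg z)

/-- With `s = a + ib`, `z = x + iy` the sign is that of `ax + by`. For `x > 0` one has `a > 0`, and
`ab = xy` gives `by ≥ 0`; beyond the branch points on the left, `a` and `x` are both nonpositive and
again `by ≥ 0`. -/
lemma horizontal_nonneg {z : ℂ} (hz : 0 < z.re ∨ (z.re ≤ 0 ∧ 1 < |z.im|)) {k : ℝ} (hk : 0 ≤ k) :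
    0 ≤ (sqrtBr z / z * k).re := by
  refine re_div_mul_nonneg ?_
  rw [Complex.ofReal_re, Complex.ofReal_im, mul_zero, sub_zero]
  refine mul_nonneg ?_ hk
  rcases hz with hz | ⟨h1, h2⟩
  · have ha := re_sqrtBr_pos (Or.inl hz)
    obtain ⟨-, e2⟩ := sqrtBr_re_im z
    have hb : 0 ≤ (sqrtBr z).im * z.im := by
      have : 0 ≤ (sqrtBr z).re * ((sqrtBr z).im * z.im) := by
        have e3 : (sqrtBr z).re * ((sqrtBr z).im * z.im) = z.re * z.im ^ 2 := by
          linear_combination z.im * e2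
        rw [e3]; positivity
      exact nonneg_of_mul_nonneg_right this ha
    have := mul_pos ha hz
    linarith
  · obtain ⟨h3, h4⟩ := sqrtBr_left h1 h2
    have := mul_nonneg_of_nonpos_of_nonpos h3 h1
    linarith

/-- For motion away from the real axis: `a(ay - bx) = y(a² - x²)`, and `a² ≥ x²` because `(a² -
x²)(a² + y²) = a²`. -/
lemma vertical_nonneg {z : ℂ} (hz : 0 < z.re) {k : ℝ} (hk : 0 ≤ k * z.im) :
    0 ≤ (sqrtBr z / z * (k * Complex.I)).re := by
  refine re_div_mul_nonneg ?_
  have ha := re_sqrtBr_pos (Or.inl hz)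
  obtain ⟨e1, e2⟩ := sqrtBr_re_im z
  set a := (sqrtBr z).re
  set b := (sqrtBr z).im
  have hA : z.re ^ 2 ≤ a ^ 2 := by
    have h1 : (a ^ 2 - z.re ^ 2) * (a ^ 2 + z.im ^ 2) = a ^ 2 := by
      linear_combination a ^ 2 * e1 + (a * b + z.re * z.im) * e2
    have h2 : 0 < a ^ 2 + z.im ^ 2 := by positivity
    have h3 : 0 ≤ (a ^ 2 - z.re ^ 2) * (a ^ 2 + z.im ^ 2) := by rw [h1]; positivity
    linarith [nonneg_of_mul_nonneg_left h3 h2]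
  have h4 : 0 ≤ a * (k * (a * z.im - b * z.re)) := by
    have e3 : a * (k * (a * z.im - b * z.re)) = k * z.im * (a ^ 2 - z.re ^ 2) := by
      linear_combination (-k * z.re) * e2
    rw [e3]
    exact mul_nonneg hk (by linarith)
  have h5 := nonneg_of_mul_nonneg_right h4 ha
  simp
  linarith

/-- In the radial direction `dξ` is a nonnegative multiple of the square root itself. -/
lemma radial_nonneg {z : ℂ} (hz0 : z ≠ 0) (hz : 0 < z.re ∨ |z.im| < 1) {k : ℝ} (hk : 0 ≤ k) :
    0 ≤ (sqrtBr z / z * (k * z)).re := by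
  have : sqrtBr z / z * (k * z) = k * sqrtBr z := by field_simp
  rw [this, Complex.re_ofReal_mul]
  exact mul_nonneg hk (re_sqrtBr_pos hz).le

/-- For thin sectors to the left of the imaginary axis between the branch points. With `U = -Re z`
and `V = |Im z|` the sign is that of `a²(V - U) - UV(V + U)`; here `a²` is bounded below away from
`±i`, while the second term carries the small factor `U ≤ δV/16`. -/
lemma diagonal_nonneg {δ : ℝ} (hδ : 0 < δ) (hδ1 : δ ≤ 1) {z : ℂ} (h0 : z.re ≤ 0) {g : ℝ}
    (hg : g = 1 ∨ g = -1) (hgz : 0 ≤ g * z.im) (h1 : -z.re ≤ δ / 16 * (g * z.im))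
    (h2 : g * z.im ≤ 1 - δ / 4) {k : ℝ} (hk : 0 ≤ k) :
    0 ≤ (sqrtBr z / z * (k * (1 + g * Complex.I))).re := by
  have habs : |z.im| < 1 := by
    rw [abs_lt]
    rcases hg with rfl | rfl <;> constructor <;> linarith
  have ha := re_sqrtBr_pos (Or.inr habs)
  obtain ⟨e1, e2⟩ := sqrtBr_re_im z
  refine re_div_mul_nonneg ?_
  set a := (sqrtBr z).re
  set b := (sqrtBr z).im
  have hgg : g * g = 1 := by rcases hg with rfl | rfl <;> norm_num
  set V := g * z.im with hV
  set U := -z.re with hU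
  have hU0 : 0 ≤ U := by linarith
  have hVV : z.im ^ 2 = V ^ 2 := by rw [hV]; linear_combination -z.im ^ 2 * hgg
  -- From `a² ≥ 1 - V²` and `V ≤ 1 - δ/4`. The final comparison is then `15/64` against `8/64`, in
  -- units of `δV`.
  have hA : δ / 4 ≤ a ^ 2 := by nlinarith [sq_nonneg b, sq_nonneg z.re]
  have h4 : 0 ≤ a * (a * (V - U) - b * g * (-V - U)) := by
    have e3 : a * (a * (V - U) - b * g * (-V - U)) = a ^ 2 * (V - U) - U * V * (V + U) := by
      rw [hV, hU]; linear_combination (g * g * z.im - g * z.re) * e2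
    rw [e3]
    have hVU : 15 / 16 * V ≤ V - U := by nlinarith
    have h5 : δ / 4 * (15 / 16 * V) ≤ a ^ 2 * (V - U) := by
      apply mul_le_mul hA hVU (by positivity) (by positivity)
    have h6 : U * V * (V + U) ≤ δ / 16 * V * 1 * 2 := by
      have : U * V ≤ δ / 16 * V * 1 := mul_le_mul h1 (by linarith) hgz (by positivity)
      have h7 : V + U ≤ 2 := by nlinarith
      exact mul_le_mul this h7 (by linarith) (by positivity)
    nlinarith
  have h5 := nonneg_of_mul_nonneg_right h4 ha
  have e4 : (a * z.re + b * z.im) * (k * (1 + g * Complex.I)).re -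
      (b * z.re - a * z.im) * (k * (1 + g * Complex.I)).im =
      k * (a * (V - U) - b * g * (-V - U)) := by
    rw [hV, hU, Complex.re_ofReal_mul, Complex.im_ofReal_mul]
    simp
    linear_combination (-k * b * z.im) * hgg
  rw [e4]
  exact mul_nonneg hk h5

/-! ### Lengths in the `q`-plane -/

/-- With `u, v` the distances to `±i`: `1 + |z|² = uv + (u-v)²/2 ≤ uv + 2` and `|1+z²| = uv`. The
larger distance is at least `1`, so `uv ≥ δ`, which absorbs the `2`. -/
lemma one_add_normSq_le {δ : ℝ} (hδ : 0 < δ) {z : ℂ} (h1 : δ ≤ ‖z - Complex.I‖)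
    (h2 : δ ≤ ‖z + Complex.I‖) : 1 + ‖z‖ ^ 2 ≤ (1 + 2 / δ) * ‖sqrtBr z‖ ^ 2 := by
  set u := ‖z - Complex.I‖ with hu
  set v := ‖z + Complex.I‖ with hv
  have hprod : ‖sqrtBr z‖ ^ 2 = u * v := by
    rw [← norm_pow, sqrtBr_sq, hu, hv, ← norm_mul]
    congr 1
    linear_combination Complex.I_sq
  have hpar : u ^ 2 + v ^ 2 = 2 * (1 + ‖z‖ ^ 2) := by
    rw [hu, hv, ← Complex.normSq_eq_norm_sq, ← Complex.normSq_eq_norm_sq,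
      ← Complex.normSq_eq_norm_sq, Complex.normSq_apply, Complex.normSq_apply, Complex.normSq_apply]
    simp
    ring
  have hI : ‖(2 : ℂ) * Complex.I‖ = 2 := by simp
  have hsum : 2 ≤ u + v := by
    have := norm_sub_le (z + Complex.I) (z - Complex.I)
    rw [show z + Complex.I - (z - Complex.I) = 2 * Complex.I by ring, hI] at this
    linarith
  have hd1 : u - v ≤ 2 := by
    have := norm_sub_norm_le (z - Complex.I) (z + Complex.I)
    rw [show z - Complex.I - (z + Complex.I) = -(2 * Complex.I) by ring, norm_neg, hI] at this
    exact this
  have hd2 : v - u ≤ 2 := by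
    have := norm_sub_norm_le (z + Complex.I) (z - Complex.I)
    rw [show z + Complex.I - (z - Complex.I) = 2 * Complex.I by ring, hI] at this
    exact this
  have huv : δ ≤ u * v := by
    rcases le_total u v with h | h
    · nlinarith
    · nlinarith
  rw [hprod]
  have h3 : 2 ≤ 2 / δ * (u * v) := by
    rw [div_mul_eq_mul_div, le_div_iff₀ hδ]; linarith
  nlinarith

/-- Away from `±i`, lengths in the `q`-plane are dominated by `|dz|/(1+|z|²)`, for which straight
lines have bounded length even when unbounded. -/
lemma norm_pVar_deriv_le {δ : ℝ} (hδ : 0 < δ) {z : ℂ} (h1 : δ ≤ ‖z - Complex.I‖)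
    (h2 : δ ≤ ‖z + Complex.I‖) :
    ‖-z / sqrtBr z ^ 3‖ ≤ (1 + 2 / δ) ^ 2 / (1 + ‖z‖ ^ 2) ∧ ‖pVar z‖ ≤ 1 + 2 / δ := by
  set K := 1 + 2 / δ with hK
  have hK1 : 1 ≤ K := le_add_of_nonneg_right (by positivity)
  have h := one_add_normSq_le hδ h1 h2
  set s := ‖sqrtBr z‖ with hs
  have hs2 : 0 < s ^ 2 := by
    by_contra hn
    have : s ^ 2 = 0 := le_antisymm (not_lt.1 hn) (sq_nonneg s)
    rw [this, mul_zero] at h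
    nlinarith [sq_nonneg ‖z‖]
  have hs0 : 0 < s := lt_of_le_of_ne (norm_nonneg _) fun h0 => by
    rw [← h0] at hs2; norm_num at hs2
  have hzs : ‖z‖ ≤ K * s := by
    refine le_of_sq_le_sq ?_ (by positivity)
    rw [mul_pow]
    nlinarith
  constructor
  · rw [norm_div, norm_neg, norm_pow, ← hs, div_le_div_iff₀ (by positivity) (by positivity)]
    calc ‖z‖ * (1 + ‖z‖ ^ 2) ≤ (K * s) * (K * s ^ 2) := by gcongr
      _ = K ^ 2 * s ^ 3 := by ring
  · rw [pVar, norm_inv, ← hs]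
    refine inv_le_of_inv_le₀ (by positivity) ?_
    refine le_of_sq_le_sq ?_ hs0.le
    rw [inv_pow, inv_le_iff_one_le_mul₀ (by positivity)]
    nlinarith [sq_nonneg ‖z‖]

lemma integrableOn_deriv_arctan {a b : ℝ} (hab : a < b) {f f' : ℝ → ℝ}
    (hf : ∀ t ∈ Set.Ioo a b, HasDerivAt f (f' t) t) (hf' : ∀ t ∈ Set.Ioo a b, 0 ≤ f' t) :
    IntegrableOn (fun t => f' t / (1 + f t ^ 2)) (Set.Ioo a b) ∧
      ∫ t in Set.Ioo a b, f' t / (1 + f t ^ 2) ≤ Real.pi := by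
  -- Assigning `∓π/2` outside the open interval makes a monotone function on the closed one, even if
  -- `f` is unbounded at an end. The integral of its derivative is at most its increment `π`.
  set φ : ℝ → ℝ := fun t => if t ≤ a then -(Real.pi / 2) else if b ≤ t then Real.pi / 2 else
    Real.arctan (f t) with hφ
  have hmonof : MonotoneOn f (Set.Ioo a b) := by
    refine monotoneOn_of_deriv_nonneg (convex_Ioo a b)
      (fun t ht => (hf t ht).continuousAt.continuousWithinAt) ?_ ?_
    · rw [interior_Ioo]
      exact fun t ht => (hf t ht).differentiableAt.differentiableWithinAt
    · rw [interior_Ioo]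
      intro t ht
      rw [(hf t ht).deriv]
      exact hf' t ht
  have hmono : MonotoneOn φ (Set.uIcc a b) := by
    intro s hs t ht hst
    have h1 := Real.neg_pi_div_two_lt_arctan (f t)
    have h2 := Real.arctan_lt_pi_div_two (f s)
    have h3 := Real.pi_pos
    simp only [hφ]
    by_cases ha : s ≤ a
    · rw [if_pos ha]
      split_ifs <;> linarith
    · have hta : ¬ t ≤ a := fun h => ha (hst.trans h)
      rw [if_neg ha, if_neg hta]
      by_cases hb : b ≤ t
      · rw [if_pos hb]
        split_ifs <;> linarith
      · have hsb : ¬ b ≤ s := fun h => hb (h.trans hst)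
        rw [if_neg hb, if_neg hsb]
        exact Real.arctan_strictMono.monotone
          (hmonof ⟨not_le.1 ha, not_le.1 hsb⟩ ⟨not_le.1 hta, not_le.1 hb⟩ hst)
  have hderiv : ∀ t ∈ Set.Ioo a b, deriv φ t = f' t / (1 + f t ^ 2) := by
    intro t ht
    have hev : φ =ᶠ[nhds t] fun t => Real.arctan (f t) := by
      filter_upwards [isOpen_Ioo.mem_nhds ht] with u hu
      simp only [hφ]
      rw [if_neg (not_le.2 hu.1), if_neg (not_le.2 hu.2)]
    rw [hev.deriv_eq, (hf t ht).arctan.deriv]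
    ring
  have hi := hmono.intervalIntegrable_deriv
  have hle := hmono.intervalIntegral_deriv_mem_uIcc
  rw [intervalIntegrable_iff_integrableOn_Ioo_of_le hab.le] at hi
  have hφa : φ a = -(Real.pi / 2) := by simp [hφ]
  have hφb : φ b = Real.pi / 2 := by simp [hφ, hab]
  rw [hφa, hφb, Set.uIcc_of_le (by linarith [Real.pi_pos]),
    intervalIntegral.integral_of_le hab.le, integral_Ioc_eq_integral_Ioo] at hle
  refine ⟨hi.congr_fun hderiv measurableSet_Ioo, ?_⟩
  rw [← setIntegral_congr_fun measurableSet_Ioo hderiv]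
  linarith [hle.2]

/-! ### Arcs and their concatenation -/

/-- An arc along which `σ Re ξ` is nondecreasing, which stays away from `±i`, and whose image in
the `q`-plane has length at most a constant. -/
structure IsGoodArc (δ σ a b : ℝ) (γ γ' : ℝ → ℂ) : Prop where
  contDiff : ContDiffOn ℝ 2 γ (Set.Ioi 0)
  hasDeriv : ∀ t : ℝ, 0 < t → HasDerivAt γ (γ' t) t
  ne_zero : ∀ t : ℝ, 0 < t → γ' t ≠ 0
  mem : ∀ t ∈ Set.Icc a b ∩ Set.Ioi 0,
    γ t ∈ cutPlane ∧ δ ≤ ‖γ t - Complex.I‖ ∧ δ ≤ ‖γ t + Complex.I‖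
  mono : ∀ t ∈ Set.Ioo a b, 0 ≤ σ * (sqrtBr (γ t) / γ t * γ' t).re
  length : ∃ f f' : ℝ → ℝ, ∀ t ∈ Set.Ioo a b, HasDerivAt f (f' t) t ∧
    ‖γ' t‖ / (1 + ‖γ t‖ ^ 2) ≤ f' t / (1 + f t ^ 2)

lemma IsGoodArc.integral_le {δ σ a b : ℝ} (hδ : 0 < δ) (ha : 0 ≤ a) (hab : a < b) {γ γ' : ℝ → ℂ}
    (h : IsGoodArc δ σ a b γ γ') :
    IntegrableOn (deriv fun t => pVar (γ t)) (Set.Ioo a b) ∧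
      ∫ t in Set.Ioo a b, ‖deriv (fun t => pVar (γ t)) t‖ ≤ (1 + 2 / δ) ^ 2 * Real.pi := by
  obtain ⟨f, f', hf⟩ := h.length
  have hf0 : ∀ t ∈ Set.Ioo a b, 0 ≤ f' t := by
    intro t ht
    have h1 : 0 ≤ ‖γ' t‖ / (1 + ‖γ t‖ ^ 2) := by positivity
    have h2 := h1.trans (hf t ht).2
    have h3 : 0 < 1 + f t ^ 2 := by positivity
    rwa [le_div_iff₀ h3, zero_mul] at h2
  obtain ⟨hi, hle⟩ := integrableOn_deriv_arctan hab (fun t ht => (hf t ht).1) hf0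
  have hbound : ∀ t ∈ Set.Ioo a b, ‖deriv (fun t => pVar (γ t)) t‖ ≤
      (1 + 2 / δ) ^ 2 * (f' t / (1 + f t ^ 2)) := by
    intro t ht
    have ht0 : 0 < t := ha.trans_lt ht.1
    obtain ⟨hm, h1, h2⟩ := h.mem t ⟨Set.Ioo_subset_Icc_self ht, ht0⟩
    have hd := h.hasDeriv t ht0
    rw [deriv_pVar_path hm hd.differentiableAt, hd.deriv, norm_mul]
    have h3 := (norm_pVar_deriv_le hδ h1 h2).1
    calc ‖-γ t / sqrtBr (γ t) ^ 3‖ * ‖γ' t‖ ≤ (1 + 2 / δ) ^ 2 / (1 + ‖γ t‖ ^ 2) * ‖γ' t‖ := by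
          gcongr
      _ = (1 + 2 / δ) ^ 2 * (‖γ' t‖ / (1 + ‖γ t‖ ^ 2)) := by ring
      _ ≤ _ := mul_le_mul_of_nonneg_left (hf t ht).2 (by positivity)
  have hI : IntegrableOn (deriv fun t => pVar (γ t)) (Set.Ioo a b) :=
    Integrable.mono' (hi.const_mul _) (stronglyMeasurable_deriv _).aestronglyMeasurable
      ((ae_restrict_iff' measurableSet_Ioo).2 (Filter.Eventually.of_forall hbound))
  refine ⟨hI, (setIntegral_mono_on hI.norm (hi.const_mul _) measurableSet_Ioo hbound).trans ?_⟩
  rw [integral_const_mul]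
  exact mul_le_mul_of_nonneg_left hle (by positivity)

lemma IsGoodArc.monotoneOn {δ σ a b : ℝ} {γ γ' : ℝ → ℂ}
    (h : IsGoodArc δ σ a b γ γ') {S : Set ℝ} (hS : Convex ℝ S) (hsub : S ⊆ Set.Icc a b ∩ Set.Ioi 0)
    (hint : interior S = Set.Ioo a b) : MonotoneOn (fun t => σ * (xi (γ t)).re) S := by
  have hd : ∀ t ∈ S, HasDerivAt (fun t => σ * (xi (γ t)).re)
      (σ * (sqrtBr (γ t) / γ t * γ' t).re) t := by
    intro t ht
    have h1 := (hasDerivAt_xi (h.mem t (hsub ht)).1).comp t (h.hasDeriv t (hsub ht).2)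
    exact (Complex.reCLM.hasFDerivAt.comp_hasDerivAt t h1).const_mul σ
  refine monotoneOn_of_deriv_nonneg hS (fun t ht => (hd t ht).continuousAt.continuousWithinAt)
    (fun t ht => (hd t (interior_subset ht)).differentiableAt.differentiableWithinAt) ?_
  intro t ht
  rw [(hd t (interior_subset ht)).deriv]
  rw [hint] at ht
  exact h.mono t ht

/-- Concatenation of two arcs at the parameter `1/2`. -/
def glue (γ₁ γ₂ : ℝ → ℂ) (t : ℝ) : ℂ := if t ≤ 1 / 2 then γ₁ t else γ₂ t

lemma glue_of_le (γ₁ γ₂ : ℝ → ℂ) {t : ℝ} (h : t ≤ 1 / 2) : glue γ₁ γ₂ t = γ₁ t := if_pos h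

lemma glue_of_ge {γ₁ γ₂ : ℝ → ℂ} (h0 : γ₁ (1 / 2) = γ₂ (1 / 2)) {t : ℝ} (h : 1 / 2 ≤ t) :
    glue γ₁ γ₂ t = γ₂ t := by
  rcases h.eq_or_lt with rfl | h
  · rw [glue_of_le _ _ le_rfl, h0]
  · exact if_neg (not_le.2 h)

/-- The properties of the paths that give uniform error bounds. -/
structure IsBoundedPath (σ K L : ℝ) (γ : ℝ → ℂ) (z : ℂ) : Prop where
  arcChain : IsArcChain γ z
  mono : MonotoneOn (fun t => σ * (xi (γ t)).re) (Set.Ioc 0 1)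
  norm_le : ∀ t ∈ Set.Ioc (0 : ℝ) 1, ‖pVar (γ t)‖ ≤ K
  length_le : ∫ t in Set.Ioo (0 : ℝ) 1, ‖deriv (fun t => pVar (γ t)) t‖ ≤ L

lemma isBoundedPath_glue {δ σ : ℝ} (hδ : 0 < δ) {γ₁ γ₁' γ₂ γ₂' : ℝ → ℂ}
    (h1 : IsGoodArc δ σ 0 (1 / 2) γ₁ γ₁') (h2 : IsGoodArc δ σ (1 / 2) 1 γ₂ γ₂')
    (h0 : γ₁ (1 / 2) = γ₂ (1 / 2)) :
    IsBoundedPath σ (1 + 2 / δ) (2 * ((1 + 2 / δ) ^ 2 * Real.pi)) (glue γ₁ γ₂) (γ₂ 1) := by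
  have hmem : ∀ t ∈ Set.Ioc (0 : ℝ) 1, glue γ₁ γ₂ t ∈ cutPlane ∧
      δ ≤ ‖glue γ₁ γ₂ t - Complex.I‖ ∧ δ ≤ ‖glue γ₁ γ₂ t + Complex.I‖ := by
    intro t ht
    rcases le_total t (1 / 2) with h | h
    · rw [glue_of_le _ _ h]; exact h1.mem t ⟨⟨ht.1.le, h⟩, ht.1⟩
    · rw [glue_of_ge h0 h]; exact h2.mem t ⟨⟨h, ht.2⟩, ht.1⟩
  have S0 : Set.Icc (0 : ℝ) (1 / 2) ∩ Set.Ioi 0 = Set.Ioc 0 (1 / 2) := by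
    ext t; simp only [Set.mem_inter_iff, Set.mem_Icc, Set.mem_Ioi, Set.mem_Ioc]
    exact ⟨fun h => ⟨h.2, h.1.2⟩, fun h => ⟨⟨h.1.le, h.2⟩, h.1⟩⟩
  have S1 : Set.Icc (1 / 2 : ℝ) 1 ∩ Set.Ioi 0 = Set.Icc (1 / 2) 1 := by
    refine Set.inter_eq_left.2 fun t ht => ?_
    have : (0 : ℝ) < 1 / 2 := by norm_num
    exact this.trans_le ht.1
  have E0 : Set.EqOn (glue γ₁ γ₂) γ₁ (Set.Ioc 0 (1 / 2)) := fun t ht => glue_of_le _ _ ht.2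
  have E1 : Set.EqOn (glue γ₁ γ₂) γ₂ (Set.Icc (1 / 2) 1) := fun t ht => glue_of_ge h0 ht.1
  have D0 : Set.EqOn (deriv fun t => pVar (glue γ₁ γ₂ t)) (deriv fun t => pVar (γ₁ t))
      (Set.Ioo 0 (1 / 2)) := fun t ht => by
    refine Filter.EventuallyEq.deriv_eq ?_
    filter_upwards [isOpen_Ioo.mem_nhds ht] with u hu
    rw [E0 ⟨hu.1, hu.2.le⟩]
  have D1 : Set.EqOn (deriv fun t => pVar (glue γ₁ γ₂ t)) (deriv fun t => pVar (γ₂ t))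
      (Set.Ioo (1 / 2) 1) := fun t ht => by
    refine Filter.EventuallyEq.deriv_eq ?_
    filter_upwards [isOpen_Ioo.mem_nhds ht] with u hu
    rw [E1 ⟨hu.1.le, hu.2.le⟩]
  obtain ⟨i1, l1⟩ := h1.integral_le hδ le_rfl (by norm_num)
  obtain ⟨i2, l2⟩ := h2.integral_le hδ (by norm_num) (by norm_num)
  have i1' : IntegrableOn (deriv fun t => pVar (glue γ₁ γ₂ t)) (Set.Ioo 0 (1 / 2)) :=
    i1.congr_fun D0.symm measurableSet_Ioo
  have i2' : IntegrableOn (deriv fun t => pVar (glue γ₁ γ₂ t)) (Set.Ioo (1 / 2) 1) :=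
    i2.congr_fun D1.symm measurableSet_Ioo
  have i1c := (integrableOn_Ioc_iff_integrableOn_Ioo (μ := volume)).2 i1'
  have hunion : Set.Ioo (0 : ℝ) 1 = Set.Ioc 0 (1 / 2) ∪ Set.Ioo (1 / 2) 1 :=
    (Set.Ioc_union_Ioo_eq_Ioo (by norm_num) (by norm_num)).symm
  have hdisj : Disjoint (Set.Ioc (0 : ℝ) (1 / 2)) (Set.Ioo (1 / 2) 1) :=
    Set.disjoint_left.2 fun t ht ht' => absurd ht.2 (not_le.2 ht'.1)
  refine ⟨⟨fun t ht => (hmem t ht).1, glue_of_ge h0 (by norm_num), ?_, ?_⟩, ?_, ?_, ?_⟩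
  -- Two arcs with the breakpoints `0, 1/2, 1`; the first is open at `0`, so the relevant parameter
  -- sets are `(0, 1/2]` and `[1/2, 1]`.
  · refine ⟨2, fun i => i / 2, by simp, by simp, fun i _ => by push_cast; linarith, fun i hi => ?_⟩
    have hi' : i = 0 ∨ i = 1 := by omega
    rcases hi' with rfl | rfl
    · norm_num only [Nat.cast_zero, zero_div, zero_add, Nat.cast_one]
      rw [S0]
      refine ⟨(h1.contDiff.mono fun t ht => ht.1).congr E0, fun t ht => ?_⟩
      rw [derivWithin_congr E0 (E0 ht), (h1.hasDeriv t ht.1).hasDerivWithinAt.derivWithin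
        (uniqueDiffOn_Ioc 0 (1 / 2) t ht)]
      exact h1.ne_zero t ht.1
    · norm_num only [Nat.cast_one, Nat.cast_add]
      rw [S1]
      have hpos : ∀ t ∈ Set.Icc (1 / 2 : ℝ) 1, 0 < t := fun t ht => by linarith [ht.1]
      refine ⟨(h2.contDiff.mono fun t ht => hpos t ht).congr E1, fun t ht => ?_⟩
      rw [derivWithin_congr E1 (E1 ht), (h2.hasDeriv t (hpos t ht)).hasDerivWithinAt.derivWithin
        (uniqueDiffOn_Icc (by norm_num) t ht)]
      exact h2.ne_zero t (hpos t ht)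
  · rw [hunion]
    exact i1c.union i2'
  · have m1 : MonotoneOn (fun t => σ * (xi (glue γ₁ γ₂ t)).re) (Set.Ioc 0 (1 / 2)) :=
      (h1.monotoneOn (convex_Ioc _ _) S0.symm.subset interior_Ioc).congr
        fun t ht => by simp only [E0 ht]
    have m2 : MonotoneOn (fun t => σ * (xi (glue γ₁ γ₂ t)).re) (Set.Icc (1 / 2) 1) :=
      (h2.monotoneOn (convex_Icc _ _) S1.symm.subset interior_Icc).congr
        fun t ht => by simp only [E1 ht]
    have := m1.union_right m2 (c := 1 / 2) ⟨⟨by norm_num, le_rfl⟩, fun t ht => ht.2⟩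
      ⟨⟨le_rfl, by norm_num⟩, fun t ht => ht.1⟩
    rwa [Set.Ioc_union_Icc_eq_Ioc (by norm_num) (by norm_num)] at this
  · intro t ht
    obtain ⟨-, hm1, hm2⟩ := hmem t ht
    exact (norm_pVar_deriv_le hδ hm1 hm2).2
  · rw [hunion, setIntegral_union hdisj measurableSet_Ioo i1c.norm i2'.norm,
      integral_Ioc_eq_integral_Ioo]
    have e1 : ∫ t in Set.Ioo (0 : ℝ) (1 / 2), ‖deriv (fun t => pVar (glue γ₁ γ₂ t)) t‖ =
        ∫ t in Set.Ioo (0 : ℝ) (1 / 2), ‖deriv (fun t => pVar (γ₁ t)) t‖ :=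
      setIntegral_congr_fun measurableSet_Ioo fun t ht => by simp only [D0 ht]
    have e2 : ∫ t in Set.Ioo (1 / 2 : ℝ) 1, ‖deriv (fun t => pVar (glue γ₁ γ₂ t)) t‖ =
        ∫ t in Set.Ioo (1 / 2 : ℝ) 1, ‖deriv (fun t => pVar (γ₂ t)) t‖ :=
      setIntegral_congr_fun measurableSet_Ioo fun t ht => by simp only [D1 ht]
    rw [e1, e2]
    linarith

/-! ### Uniform bounds -/

lemma exists_absIntegral_le {Q : Polynomial ℝ}
    (hQ : (Polynomial.X ^ 2 * (1 - Polynomial.X ^ 2) : Polynomial ℝ) ∣ Q) (σ K L : ℝ) :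
    ∃ B : ℝ, ∀ (γ : ℝ → ℂ) (z : ℂ), IsBoundedPath σ K L γ z → absIntegral γ Q ≤ B := by
  obtain ⟨B, hB0, hB⟩ := norm_overWeight_le hQ K
  refine ⟨B * L, fun γ z h => ?_⟩
  have h1 : absIntegral γ Q ≤ ∫ t in Set.Ioo (0 : ℝ) 1, B * ‖deriv (fun t => pVar (γ t)) t‖ := by
    refine setIntegral_mono_on (h.arcChain.integrableOn hQ)
      (h.arcChain.rectifiable.norm.const_mul B) measurableSet_Ioo fun t ht => ?_
    have ht' := Set.Ioo_subset_Ioc_self ht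
    have := hB _ (pVar_weight_ne_zero (h.arcChain.mem t ht')) (h.norm_le t ht')
    gcongr
  rw [integral_const_mul] at h1
  exact h1.trans (mul_le_mul_of_nonneg_left h.length_le hB0)

/-- Only the bounds on `|q|` and on the length of the image enter; the powers `ν^{-s}` are largest
at `ν₀`. -/
lemma exists_uniform_bound (σ K L : ℝ) (N : ℕ) {ν₀ : ℝ} (hν₀ : 0 < ν₀) :
    ∃ M : ℝ, ∀ ν : ℝ, ν₀ ≤ ν → ∀ (γ : ℝ → ℂ) (z : ℂ), IsBoundedPath σ K L γ z →
      omegaErr N ν γ ≤ M ∧ varpiErr N ν γ ≤ M := by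
  choose BF hBF using fun s => exists_absIntegral_le (dvd_Ftilde s) σ K L
  choose BG hBG using fun s => exists_absIntegral_le (dvd_Gtilde N s) σ K L
  refine ⟨max (2 * BF N + ∑ s ∈ Finset.Icc 1 (N - 1), 1 / ν₀ ^ s * BG s)
    (∑ s ∈ Finset.range (N - 1), 4 / ν₀ ^ s * BF (s + 1)), fun ν hν γ z h => ⟨?_, ?_⟩⟩
  · refine le_trans ?_ (le_max_left _ _)
    rw [omegaErr]
    refine add_le_add (mul_le_mul_of_nonneg_left (hBF N γ z h) zero_le_two)
      (Finset.sum_le_sum fun s _ => ?_)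
    have := hBG s γ z h
    have := absIntegral_nonneg γ (Gtilde N s)
    gcongr
  · refine le_trans ?_ (le_max_right _ _)
    rw [varpiErr]
    refine Finset.sum_le_sum fun s _ => ?_
    have := hBF (s + 1) γ z h
    have := absIntegral_nonneg γ (Ftilde (s + 1))
    gcongr

/-! ### Topology of the domains -/

/-- A horizontal ray joins each point to the half-plane contained in `D`. -/
lemma isConnected_of_add_real {D : Set ℂ} {a : ℝ} (ha : ∀ z : ℂ, a < z.re → z ∈ D)
    (hD : ∀ z ∈ D, ∀ t : ℝ, 0 ≤ t → z + t ∈ D) : IsConnected D ∧ ¬ Bornology.IsBounded D := by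
  refine ⟨⟨⟨((a + 1 : ℝ) : ℂ), ha _ (by simp)⟩, ?_⟩, fun hb => ?_⟩
  · refine isPreconnected_of_forall ((a + 1 : ℝ) : ℂ) fun z hz => ?_
    refine ⟨{w : ℂ | a < w.re} ∪ (fun t : ℝ => z + t) '' Set.Ici 0, ?_, Or.inl (by simp),
      Or.inr ⟨0, by simp, by simp⟩, ?_⟩
    · rintro w (hw | ⟨t, ht, rfl⟩)
      · exact ha w hw
      · exact hD z hz t ht
    · refine IsPreconnected.union (z + ((|a| + |z.re| + 1 : ℝ) : ℂ)) ?_ ?_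
        (convex_halfSpace_re_gt a).isPreconnected
        (isPreconnected_Ici.image _ (by fun_prop))
      · simp only [Set.mem_ofPred_eq, Complex.add_re, Complex.ofReal_re]
        linarith [le_abs_self a, neg_abs_le z.re]
      · exact ⟨|a| + |z.re| + 1, by simp only [Set.mem_Ici]; positivity, rfl⟩
  · obtain ⟨C, hC⟩ := hb.exists_norm_le
    have h := hC _ (ha ((|a| + |C| + 1 : ℝ) : ℂ) (by
      rw [Complex.ofReal_re]; linarith [le_abs_self a, abs_nonneg C]))
    rw [Complex.norm_real, Real.norm_eq_abs, abs_of_nonneg (by positivity)] at h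
    linarith [le_abs_self C, abs_nonneg a]

end

noncomputable section

/-! ### Paths to the points of the domains -/

lemma le_norm_sub_and_add_I {δ : ℝ} {w : ℂ}
    (h : δ ≤ w.re ∨ δ ≤ |w.im| - 1 ∨ |w.im| ≤ 1 - δ) :
    δ ≤ ‖w - Complex.I‖ ∧ δ ≤ ‖w + Complex.I‖ := by
  have r1 := (le_abs_self _).trans (Complex.abs_re_le_norm (w - Complex.I))
  have r2 := (le_abs_self _).trans (Complex.abs_re_le_norm (w + Complex.I))
  have i1 := Complex.abs_im_le_norm (w - Complex.I)
  have i2 := Complex.abs_im_le_norm (w + Complex.I)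
  simp only [Complex.sub_re, Complex.add_re, Complex.I_re, Complex.sub_im, Complex.add_im,
    Complex.I_im] at r1 r2 i1 i2
  have j1 := abs_le.1 i1
  have j2 := abs_le.1 i2
  rcases h with h | h | h
  · constructor <;> linarith
  · rcases le_total 0 w.im with h0 | h0
    · rw [abs_of_nonneg h0] at h
      constructor <;> linarith
    · rw [abs_of_nonpos h0] at h
      constructor <;> linarith
  · obtain ⟨h1, h2⟩ := abs_le.1 h
    constructor <;> linarith

lemma sq_le_normSq_of_re (w : ℂ) : w.re ^ 2 ≤ ‖w‖ ^ 2 := by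
  rw [Complex.sq_norm, Complex.normSq_apply]
  nlinarith [mul_self_nonneg w.im]

lemma sq_le_normSq_of_im (w : ℂ) : w.im ^ 2 ≤ ‖w‖ ^ 2 := by
  rw [Complex.sq_norm, Complex.normSq_apply]
  nlinarith [mul_self_nonneg w.re]

/-- The numbers `p` and `q` define the affine comparison function `p + tq` whose arctangent bounds
the length. -/
lemma isGoodArc_affine {δ σ a b : ℝ} {c d : ℂ} (hd : d ≠ 0)
    (hmem : ∀ t ∈ Set.Icc a b ∩ Set.Ioi 0, c + (t : ℂ) * d ∈ cutPlane ∧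
      δ ≤ ‖c + (t : ℂ) * d - Complex.I‖ ∧ δ ≤ ‖c + (t : ℂ) * d + Complex.I‖)
    (hmono : ∀ t ∈ Set.Ioo a b, 0 ≤ σ * (sqrtBr (c + (t : ℂ) * d) / (c + (t : ℂ) * d) * d).re)
    (p q : ℝ) (hlen : ∀ t ∈ Set.Ioo a b,
      ‖d‖ / (1 + ‖c + (t : ℂ) * d‖ ^ 2) ≤ q / (1 + (p + t * q) ^ 2)) :
    IsGoodArc δ σ a b (fun t => c + (t : ℂ) * d) fun _ => d where
  contDiff := (contDiff_const.add (Complex.ofRealCLM.contDiff.mul contDiff_const)).contDiffOn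
  hasDeriv t _ := by
    simpa using ((Complex.ofRealCLM.hasDerivAt (x := t)).mul_const d).const_add c
  ne_zero _ _ := hd
  mem := hmem
  mono := hmono
  length := ⟨fun t => p + t * q, fun _ => q, fun t ht =>
    ⟨by simpa using ((hasDerivAt_id t).mul_const q).const_add p, hlen t ht⟩⟩

/-- The parameter `1/t` brings a horizontal half-line in from `+∞`; `Re ξ` decreases along it, hence
`σ = -1`. Minus the real part is the comparison function for the length. -/
lemma isGoodArc_inv {δ a b : ℝ} (ha : 0 ≤ a) {c : ℂ}
    (hmem : ∀ t ∈ Set.Icc a b ∩ Set.Ioi 0, c + ((t⁻¹ : ℝ) : ℂ) ∈ cutPlane ∧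
      δ ≤ ‖c + ((t⁻¹ : ℝ) : ℂ) - Complex.I‖ ∧ δ ≤ ‖c + ((t⁻¹ : ℝ) : ℂ) + Complex.I‖)
    (hright : ∀ t ∈ Set.Ioo a b, 0 < c.re + t⁻¹ ∨ c.re + t⁻¹ ≤ 0 ∧ 1 < |c.im|) :
    IsGoodArc δ (-1) a b (fun t => c + ((t⁻¹ : ℝ) : ℂ)) fun t => ((-(t ^ 2)⁻¹ : ℝ) : ℂ) where
  contDiff := contDiffOn_const.add (Complex.ofRealCLM.contDiff.comp_contDiffOn
    (contDiffOn_id.inv fun t ht => (Set.mem_Ioi.1 ht).ne'))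
  hasDeriv t ht := ((hasDerivAt_inv ht.ne').ofReal_comp).const_add c
  ne_zero t ht := by
    rw [Ne, Complex.ofReal_eq_zero, neg_eq_zero, inv_eq_zero]
    exact (pow_pos ht 2).ne'
  mem := hmem
  mono t ht := by
    have h := horizontal_nonneg (z := c + ((t⁻¹ : ℝ) : ℂ)) (k := (t ^ 2)⁻¹)
      (by simpa using hright t ht) (by positivity)
    rw [Complex.ofReal_neg, mul_neg, Complex.neg_re]
    linarith
  length := ⟨fun t => -(c.re + t⁻¹), fun t => (t ^ 2)⁻¹, fun t ht => by
    have ht0 : 0 < t := ha.trans_lt ht.1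
    refine ⟨(((hasDerivAt_inv ht0.ne').const_add c.re).neg).congr_deriv (neg_neg _), ?_⟩
    rw [Complex.norm_real, Real.norm_eq_abs, abs_neg, abs_of_nonneg (by positivity)]
    have h := sq_le_normSq_of_re (c + ((t⁻¹ : ℝ) : ℂ))
    rw [Complex.add_re, Complex.ofReal_re] at h
    have h' : (-(c.re + t⁻¹)) ^ 2 ≤ ‖c + ((t⁻¹ : ℝ) : ℂ)‖ ^ 2 := by rwa [neg_sq]
    gcongr⟩

/-! ### The domains of uniform validity -/

/-- The domain of uniform validity for `I_ν`. -/
def domainI (δ : ℝ) : Set ℂ :=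
  {z | δ / 2 < z.re} ∪ {z | -|z.im| < z.re ∧ |z.im| < 1 - δ / 2}

/-- The domain of uniform validity for `K_ν`. -/
def domainK (δ : ℝ) : Set ℂ :=
  {z | δ / 16 < z.re} ∪ {z | -(δ / 16 * |z.im|) < z.re ∧ -(δ / 16) < z.re ∧ δ / 2 < |(|z.im| - 1)|}

lemma isOpen_domainI (δ : ℝ) : IsOpen (domainI δ) := by
  have h1 : IsOpen {z : ℂ | δ / 2 < z.re} := isOpen_lt (by fun_prop) (by fun_prop)
  have h2 : IsOpen {z : ℂ | -|z.im| < z.re} := isOpen_lt (by fun_prop) (by fun_prop)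
  have h3 : IsOpen {z : ℂ | |z.im| < 1 - δ / 2} := isOpen_lt (by fun_prop) (by fun_prop)
  exact h1.union (h2.and h3)

lemma isOpen_domainK (δ : ℝ) : IsOpen (domainK δ) := by
  have h1 (a : ℝ) : IsOpen {z : ℂ | a < z.re} := isOpen_lt (by fun_prop) (by fun_prop)
  have h2 : IsOpen {z : ℂ | -(δ / 16 * |z.im|) < z.re} := isOpen_lt (by fun_prop) (by fun_prop)
  have h3 : IsOpen {z : ℂ | δ / 2 < |(|z.im| - 1)|} := isOpen_lt (by fun_prop) (by fun_prop)
  exact (h1 _).union (h2.and ((h1 _).and h3))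

lemma isConnected_domainI (δ : ℝ) :
    IsConnected (domainI δ) ∧ ¬ Bornology.IsBounded (domainI δ) := by
  refine isConnected_of_add_real (a := δ / 2) (fun z hz => Or.inl hz) ?_
  rintro z (hz | ⟨h1, h2⟩) t ht
  · refine Or.inl (show δ / 2 < (z + t).re from ?_)
    have : δ / 2 < z.re := hz
    simp only [Complex.add_re, Complex.ofReal_re]
    linarith
  · refine Or.inr ⟨?_, ?_⟩ <;>
      simp only [Complex.add_re, Complex.ofReal_re, Complex.add_im, Complex.ofReal_im, add_zero] <;>
      linarith

lemma isConnected_domainK (δ : ℝ) :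
    IsConnected (domainK δ) ∧ ¬ Bornology.IsBounded (domainK δ) := by
  refine isConnected_of_add_real (a := δ / 16) (fun z hz => Or.inl hz) ?_
  rintro z (hz | ⟨h1, h2, h3⟩) t ht
  · refine Or.inl (show δ / 16 < (z + t).re from ?_)
    have : δ / 16 < z.re := hz
    simp only [Complex.add_re, Complex.ofReal_re]
    linarith
  · refine Or.inr ⟨?_, ?_, ?_⟩ <;>
      simp only [Complex.add_re, Complex.ofReal_re, Complex.add_im, Complex.ofReal_im, add_zero] <;>
      linarith

lemma neg_mul_abs_im_lt_re {z : ℂ} (h0 : 0 ≤ z.re) (hz : z ≠ 0) {k : ℝ} (hk : 0 < k) :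
    -(k * |z.im|) < z.re := by
  rcases h0.eq_or_lt with h | h
  · have hy : z.im ≠ 0 := fun hy => hz (Complex.ext h.symm hy)
    have := mul_pos hk (abs_pos.2 hy)
    linarith
  · have := mul_nonneg hk.le (abs_nonneg z.im)
    linarith

lemma sq_le_of_le_norm_sub_add_I {δ : ℝ} (hδ : 0 < δ) {z : ℂ} (h1 : δ ≤ ‖z - Complex.I‖)
    (h2 : δ ≤ ‖z + Complex.I‖) : δ ^ 2 ≤ z.re ^ 2 + (|z.im| - 1) ^ 2 := by
  have e1 := pow_le_pow_left₀ hδ.le h1 2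
  have e2 := pow_le_pow_left₀ hδ.le h2 2
  rw [Complex.sq_norm, Complex.normSq_apply] at e1 e2
  simp only [Complex.sub_re, Complex.add_re, Complex.I_re, Complex.sub_im, Complex.add_im,
    Complex.I_im] at e1 e2
  rcases le_total 0 z.im with h0 | h0
  · rw [abs_of_nonneg h0]; nlinarith
  · rw [abs_of_nonpos h0]; nlinarith

/-- If `Re z ≤ δ/2`, then `|Im z| < 1`, since otherwise `i Im z` is an excluded point at distance
`Re z < δ`. Distance at least `δ` from `±i` then forces `1 - |Im z| > δ/2`. -/
lemma halfPlaneI_subset_domainI {δ : ℝ} (hδ : 0 < δ) : halfPlaneI δ ⊆ domainI δ := by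
  rintro z ⟨h0, hz, hd⟩
  rcases lt_or_ge (δ / 2) z.re with h | h
  · exact Or.inl h
  have hI := sq_le_of_le_norm_sub_add_I hδ (by simpa using hd 1 (by simp))
    (by simpa using hd (-1) (by simp))
  have hy : |z.im| < 1 := by
    by_contra hy
    have h1 := hd z.im (not_lt.1 hy)
    have h2 : z - z.im * Complex.I = (z.re : ℂ) := by
      rw [sub_eq_iff_eq_add]; exact (Complex.re_add_im z).symm
    rw [h2, Complex.norm_real, Real.norm_eq_abs, abs_of_nonneg h0] at h1
    linarith
  refine Or.inr ⟨by simpa using neg_mul_abs_im_lt_re h0 hz one_pos, ?_⟩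
  by_contra hn
  nlinarith

lemma halfPlaneK_subset_domainK {δ : ℝ} (hδ : 0 < δ) : halfPlaneK δ ⊆ domainK δ := by
  rintro z ⟨h0, hz, h1, h2⟩
  rcases lt_or_ge (δ / 16) z.re with h | h
  · exact Or.inl h
  have hI := sq_le_of_le_norm_sub_add_I hδ h1 h2
  refine Or.inr ⟨neg_mul_abs_im_lt_re h0 hz (by positivity), by linarith, ?_⟩
  by_contra hn
  have := pow_le_pow_left₀ (abs_nonneg _) (not_lt.1 hn) 2
  rw [sq_abs] at this
  nlinarith

/-- The common bound for the lengths of the images in the `q`-plane. -/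
def lengthBound (δ : ℝ) : ℝ := 2 * ((1 + 2 / δ) ^ 2 * Real.pi)

lemma mem_cutPlane_of_im {z : ℂ} (h0 : z.im = 0 → 0 < z.re) (h1 : |z.im| < 1) : z ∈ cutPlane := by
  rintro ⟨hre, him | him | him⟩
  · exact absurd (h0 him) (not_lt.2 hre)
  · rw [him] at h1; norm_num at h1
  · rw [him] at h1; norm_num at h1

lemma mem_cutPlane_of_re {z : ℂ} (h : 0 < z.re) : z ∈ cutPlane := fun hz => not_lt.2 hz.1 h

/-- The segment from `0` stays in the strip between the branch points, where the radial direction is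
progressive also for `Re z ≤ 0`. -/
lemma exists_path_radial {δ : ℝ} (hδ : 0 < δ) {z : ℂ} (hz0 : z ≠ 0)
    (hx : z.im = 0 → 0 < z.re) (hy : |z.im| < 1 - δ) :
    ∃ γ : ℝ → ℂ, Filter.Tendsto γ (nhdsWithin 0 (Set.Ioi 0)) (nhds 0) ∧
      IsBoundedPath 1 (1 + 2 / δ) (lengthBound δ) γ z := by
  have him : ∀ t : ℝ, 0 < t → t ≤ 1 → |(0 + (t : ℂ) * z).im| ≤ |z.im| := by
    intro t ht ht1
    rw [zero_add, Complex.im_ofReal_mul, abs_mul, abs_of_pos ht]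
    exact mul_le_of_le_one_left (abs_nonneg _) ht1
  have hgood : ∀ a b : ℝ, 0 ≤ a → b ≤ 1 →
      IsGoodArc δ 1 a b (fun t => 0 + (t : ℂ) * z) fun _ => z := by
    intro a b ha hb
    refine isGoodArc_affine hz0 (fun t ht => ?_) (fun t ht => ?_) 0 ‖z‖ fun t ht => ?_
    · have ht0 : 0 < t := ht.2
      have hi := him t ht0 (ht.1.2.trans hb)
      refine ⟨mem_cutPlane_of_im (fun h => ?_) (by linarith),
        le_norm_sub_and_add_I (Or.inr (Or.inr (by linarith)))⟩
      rw [zero_add, Complex.im_ofReal_mul] at h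
      rw [zero_add, Complex.re_ofReal_mul]
      exact mul_pos ht0 (hx ((mul_eq_zero.1 h).resolve_left ht0.ne'))
    · have ht0 : 0 < t := ha.trans_lt ht.1
      have hi := him t ht0 (ht.2.le.trans hb)
      have ht' : (t : ℂ) ≠ 0 := Complex.ofReal_ne_zero.2 ht0.ne'
      have h := radial_nonneg (z := 0 + (t : ℂ) * z) (k := t⁻¹)
        (by rw [zero_add]; exact mul_ne_zero ht' hz0) (Or.inr (by linarith)) (by positivity)
      rwa [zero_add, Complex.ofReal_inv, inv_mul_cancel_left₀ ht', ← zero_add ((t : ℂ) * z),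
        ← one_mul (Complex.re _)] at h
    · rw [zero_add, zero_add, norm_mul, Complex.norm_real, Real.norm_eq_abs, mul_pow, mul_pow,
        sq_abs]
  -- One segment, counted as two arcs of the same parametrization so that the lemma on concatenation
  -- applies.
  have hb := isBoundedPath_glue hδ (hgood 0 (1 / 2) le_rfl (by norm_num))
    (hgood (1 / 2) 1 (by norm_num) le_rfl) rfl
  rw [Complex.ofReal_one, one_mul, zero_add] at hb
  refine ⟨_, ?_, hb⟩
  have hc : Filter.Tendsto (fun t : ℝ => 0 + (t : ℂ) * z) (nhdsWithin 0 (Set.Ioi 0)) (nhds 0) := by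
    have : Continuous fun t : ℝ => 0 + (t : ℂ) * z := by fun_prop
    simpa using (this.tendsto 0).mono_left nhdsWithin_le_nhds
  refine hc.congr fun t => ?_
  simp [glue]

/-- Along the real axis to `Re z`, then vertically to `z`: both directions are progressive, and the
vertical part has distance at least `Re z ≥ δ` from `±i`. -/
lemma exists_path_corner {δ : ℝ} (hδ : 0 < δ) (hδ1 : δ ≤ 1) {z : ℂ} (hx : δ ≤ z.re)
    (hy : z.im ≠ 0) :
    ∃ γ : ℝ → ℂ, Filter.Tendsto γ (nhdsWithin 0 (Set.Ioi 0)) (nhds 0) ∧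
      IsBoundedPath 1 (1 + 2 / δ) (lengthBound δ) γ z := by
  have hx0 : 0 < z.re := hδ.trans_le hx
  have h1 : IsGoodArc δ 1 0 (1 / 2) (fun t => 0 + (t : ℂ) * ((2 * z.re : ℝ) : ℂ))
      fun _ => ((2 * z.re : ℝ) : ℂ) := by
    have hpos : ∀ t : ℝ, 0 < t → 0 < (0 + (t : ℂ) * ((2 * z.re : ℝ) : ℂ)).re := by
      intro t ht
      rw [zero_add, Complex.re_ofReal_mul, Complex.ofReal_re]
      positivity
    refine isGoodArc_affine (Complex.ofReal_ne_zero.2 (by positivity)) (fun t ht => ?_)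
      (fun t ht => ?_) 0 (2 * z.re) fun t ht => ?_
    · refine ⟨mem_cutPlane_of_re (hpos t ht.2), le_norm_sub_and_add_I (Or.inr (Or.inr ?_))⟩
      rw [zero_add, Complex.im_ofReal_mul, Complex.ofReal_im, mul_zero, abs_zero]
      linarith
    · rw [one_mul]
      exact horizontal_nonneg (Or.inl (hpos t ht.1)) (by positivity)
    · rw [zero_add, zero_add, norm_mul, Complex.norm_real, Complex.norm_real, Real.norm_eq_abs,
        Real.norm_eq_abs, mul_pow, mul_pow, sq_abs, sq_abs, abs_of_pos (by positivity)]
  have h2 : IsGoodArc δ 1 (1 / 2) 1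
      (fun t => (z.re - z.im * Complex.I) + (t : ℂ) * ((2 * z.im : ℝ) * Complex.I))
      fun _ => (2 * z.im : ℝ) * Complex.I := by
    have hre : ∀ t : ℝ,
        ((z.re - z.im * Complex.I) + (t : ℂ) * ((2 * z.im : ℝ) * Complex.I)).re = z.re := by
      intro t; simp
    have him : ∀ t : ℝ, ((z.re - z.im * Complex.I) + (t : ℂ) * ((2 * z.im : ℝ) * Complex.I)).im =
        -z.im + t * (2 * z.im) := by
      intro t; simp
    refine isGoodArc_affine (mul_ne_zero (Complex.ofReal_ne_zero.2 (by positivity)) Complex.I_ne_zero)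
      (fun t ht => ?_) (fun t ht => ?_) (-|z.im|) (2 * |z.im|) fun t ht => ?_
    · exact ⟨mem_cutPlane_of_re (by rw [hre]; exact hx0),
        le_norm_sub_and_add_I (Or.inl (by rw [hre]; exact hx))⟩
    · rw [one_mul]
      refine vertical_nonneg (by rw [hre]; exact hx0) ?_
      rw [him, show 2 * z.im * (-z.im + t * (2 * z.im)) = 2 * (2 * t - 1) * z.im ^ 2 by ring]
      have : 0 ≤ 2 * t - 1 := by linarith [ht.1]
      positivity
    · have h := sq_le_normSq_of_im
        ((z.re - z.im * Complex.I) + (t : ℂ) * ((2 * z.im : ℝ) * Complex.I))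
      rw [him, show (-z.im + t * (2 * z.im)) ^ 2 = (2 * t - 1) ^ 2 * z.im ^ 2 by ring,
        ← sq_abs z.im,
        show (2 * t - 1) ^ 2 * |z.im| ^ 2 = (-|z.im| + t * (2 * |z.im|)) ^ 2 by ring] at h
      rw [norm_mul, Complex.norm_I, mul_one, Complex.norm_real, Real.norm_eq_abs, abs_mul, abs_two]
      gcongr
  have hend : ((z.re - z.im * Complex.I) + ((1 : ℝ) : ℂ) * ((2 * z.im : ℝ) * Complex.I)) = z := by
    conv_rhs => rw [← Complex.re_add_im z]
    push_cast
    ring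
  have hb := isBoundedPath_glue hδ h1 h2 (by push_cast; ring)
  rw [hend] at hb
  refine ⟨_, ?_, hb⟩
  have hc : Filter.Tendsto (fun t : ℝ => 0 + (t : ℂ) * ((2 * z.re : ℝ) : ℂ))
      (nhdsWithin 0 (Set.Ioi 0)) (nhds 0) := by
    have : Continuous fun t : ℝ => 0 + (t : ℂ) * ((2 * z.re : ℝ) : ℂ) := by fun_prop
    simpa using (this.tendsto 0).mono_left nhdsWithin_le_nhds
  refine hc.congr' ?_
  filter_upwards [Ioo_mem_nhdsGT (show (0 : ℝ) < 1 / 2 by norm_num)] with t ht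
  rw [glue_of_le _ _ ht.2.le]

lemma exists_path_domainI {δ : ℝ} (hδ : 0 < δ) (hδ1 : δ ≤ 1) {z : ℂ} (hz : z ∈ domainI δ) :
    ∃ γ : ℝ → ℂ, IsProgressiveFromZero γ z ∧
      IsBoundedPath 1 (1 + 2 / (δ / 2)) (lengthBound (δ / 2)) γ z := by
  obtain ⟨γ, h0, h⟩ : ∃ γ : ℝ → ℂ, Filter.Tendsto γ (nhdsWithin 0 (Set.Ioi 0)) (nhds 0) ∧
      IsBoundedPath 1 (1 + 2 / (δ / 2)) (lengthBound (δ / 2)) γ z := by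
    rcases lt_or_ge |z.im| (1 - δ / 2) with hy | hy
    · have hx : z.im = 0 → 0 < z.re := by
        intro h
        rcases hz with hz | hz
        · exact (half_pos hδ).trans hz
        · simpa [h] using hz.1
      exact exists_path_radial (half_pos hδ) (fun h => by simp [h] at hx) hx hy
    · have hx : δ / 2 < z.re := hz.elim id fun h => absurd h.2 (not_lt.2 hy)
      refine exists_path_corner (half_pos hδ) (by linarith) hx.le ?_
      exact abs_pos.1 (by linarith)
  exact ⟨γ, ⟨h.arcChain, h0, by simpa using h.mono⟩, h⟩

lemma tendsto_re_add_inv (c : ℂ) : Filter.Tendsto (fun t : ℝ => (c + ((t⁻¹ : ℝ) : ℂ)).re)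
    (nhdsWithin 0 (Set.Ioi 0)) Filter.atTop := by
  simpa using Filter.tendsto_atTop_add_const_left _ c.re tendsto_inv_nhdsGT_zero

/-- The line from `+∞` to `z` itself works unless it has to cross the imaginary axis between the
branch points. -/
lemma exists_path_horizontal {δ : ℝ} (hδ : 0 < δ) {z : ℂ} (hz : z ∈ domainK δ)
    (h0 : 0 ≤ z.re ∨ 1 < |z.im|) :
    ∃ γ : ℝ → ℂ, Filter.Tendsto (fun t => (γ t).re) (nhdsWithin 0 (Set.Ioi 0)) Filter.atTop ∧
      IsBoundedPath (-1) (1 + 2 / (δ / 16)) (lengthBound (δ / 16)) γ z := by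
  have hgood : ∀ a b : ℝ, 0 ≤ a → b ≤ 1 → IsGoodArc (δ / 16) (-1) a b
      (fun t => (z - 1) + ((t⁻¹ : ℝ) : ℂ)) fun t => ((-(t ^ 2)⁻¹ : ℝ) : ℂ) := by
    intro a b ha hb
    have hre : ∀ t : ℝ, ((z - 1) + ((t⁻¹ : ℝ) : ℂ)).re = z.re - 1 + t⁻¹ := fun t => by simp
    have him : ∀ t : ℝ, ((z - 1) + ((t⁻¹ : ℝ) : ℂ)).im = z.im := fun t => by simp
    refine isGoodArc_inv ha (fun t ht => ?_) fun t ht => ?_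
    · have h1 : 1 ≤ t⁻¹ := (one_le_inv₀ ht.2).2 (ht.1.2.trans hb)
      rcases hz with hz | ⟨hz1, -, hz3⟩
      · have hz : δ / 16 < z.re := hz
        exact ⟨mem_cutPlane_of_re (by rw [hre]; linarith),
          le_norm_sub_and_add_I (Or.inl (by rw [hre]; linarith))⟩
      · refine ⟨?_, le_norm_sub_and_add_I (Or.inr ?_)⟩
        · rintro ⟨h2, h3⟩
          rw [hre] at h2
          rw [him] at h3
          rcases h3 with h3 | h3 | h3 <;> rw [h3] at hz1 hz3 <;> norm_num at hz1 hz3 <;> linarith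
        · rw [him]
          rcases lt_abs.1 hz3 with h | h
          · left; linarith
          · right; linarith
    · have h1 : 1 < t⁻¹ := (one_lt_inv₀ (ha.trans_lt ht.1)).2 (ht.2.trans_le hb)
      have e1 : (z - 1).re = z.re - 1 := by simp
      have e2 : (z - 1).im = z.im := by simp
      rw [e1, e2]
      rcases h0 with h0 | h0
      · left; linarith
      · rcases lt_or_ge 0 (z.re - 1 + t⁻¹) with h | h
        · exact Or.inl h
        · exact Or.inr ⟨h, h0⟩
  have hb := isBoundedPath_glue (by positivity) (hgood 0 (1 / 2) le_rfl (by norm_num))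
    (hgood (1 / 2) 1 (by norm_num) le_rfl) rfl
  rw [inv_one, Complex.ofReal_one, sub_add_cancel] at hb
  refine ⟨_, ?_, hb⟩
  refine (tendsto_re_add_inv (z - 1)).congr fun t => ?_
  simp [glue]

/-- To the left of the imaginary axis between the branch points a leftward step increases `Re ξ`, so
the horizontal line stops on the axis, at height `m = |Im z| - Re z`. A diagonal segment towards the
real axis then reaches `z`; the height is chosen so that it ends there. -/
lemma exists_path_bent {δ : ℝ} (hδ : 0 < δ) (hδ1 : δ ≤ 1) {z : ℂ} (hx : z.re < 0)
    (hx1 : -(δ / 16 * |z.im|) < z.re) (hx2 : -(δ / 16) < z.re) (hy : |z.im| < 1 - δ / 2) :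
    ∃ γ : ℝ → ℂ, Filter.Tendsto (fun t => (γ t).re) (nhdsWithin 0 (Set.Ioi 0)) Filter.atTop ∧
      IsBoundedPath (-1) (1 + 2 / (δ / 16)) (lengthBound (δ / 16)) γ z := by
  obtain ⟨g, hg, hgy⟩ : ∃ g : ℝ, (g = 1 ∨ g = -1) ∧ z.im = g * |z.im| := by
    rcases le_total 0 z.im with h | h
    · exact ⟨1, Or.inl rfl, by rw [abs_of_nonneg h, one_mul]⟩
    · exact ⟨-1, Or.inr rfl, by rw [abs_of_nonpos h]; ring⟩
  have hgg : g * g = 1 := by rcases hg with rfl | rfl <;> norm_num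
  have hga : |g| = 1 := by rcases hg with rfl | rfl <;> simp
  set y := |z.im| with hyd
  have hy0 : 0 < y := by
    by_contra h
    nlinarith
  set d := -z.re with hd
  have hd0 : 0 < d := by linarith
  set m : ℝ := y + d with hm
  have hm1 : m ≤ 1 - δ / 4 := by linarith
  have h1 : IsGoodArc (δ / 16) (-1) 0 (1 / 2) (fun t => ((-2 : ℝ) + (g * m : ℝ) * Complex.I) +
      ((t⁻¹ : ℝ) : ℂ)) fun t => ((-(t ^ 2)⁻¹ : ℝ) : ℂ) := by
    have him : ∀ t : ℝ,
        |(((-2 : ℝ) + (g * m : ℝ) * Complex.I) + ((t⁻¹ : ℝ) : ℂ)).im| = m := fun t => by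
      simp [abs_mul, hga, abs_of_pos (add_pos hy0 hd0), hm]
    refine isGoodArc_inv le_rfl (fun t ht => ⟨mem_cutPlane_of_im (fun h => ?_) ?_,
      le_norm_sub_and_add_I (Or.inr (Or.inr ?_))⟩) fun t ht => Or.inl ?_
    · have := him t
      rw [h, abs_zero] at this
      linarith
    · rw [him]; linarith
    · rw [him]; linarith
    · have : 2 < t⁻¹ := (lt_inv_comm₀ two_pos ht.1).2 (by simpa using ht.2)
      simpa using this
  have h2 : IsGoodArc (δ / 16) (-1) (1 / 2) 1
      (fun t => ((d : ℝ) + (g * (m + d) : ℝ) * Complex.I) +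
        (t : ℂ) * (-((2 * d : ℝ) * (1 + g * Complex.I)))) fun _ =>
        -((2 * d : ℝ) * (1 + g * Complex.I)) := by
    have hre : ∀ t : ℝ, (((d : ℝ) + (g * (m + d) : ℝ) * Complex.I) +
        (t : ℂ) * (-((2 * d : ℝ) * (1 + g * Complex.I)))).re = -((2 * t - 1) * d) := fun t => by
      simp; ring
    have him : ∀ t : ℝ, (((d : ℝ) + (g * (m + d) : ℝ) * Complex.I) +
        (t : ℂ) * (-((2 * d : ℝ) * (1 + g * Complex.I)))).im = g * (m - (2 * t - 1) * d) :=
      fun t => by simp; ring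
    have hτ : ∀ t : ℝ, 1 / 2 ≤ t → t ≤ 1 → 0 ≤ (2 * t - 1) * d ∧ (2 * t - 1) * d ≤ d := by
      intro t ht ht1
      exact ⟨mul_nonneg (by linarith) hd0.le, mul_le_of_le_one_left hd0.le (by linarith)⟩
    have habs : ∀ t : ℝ, 1 / 2 ≤ t → t ≤ 1 → |g * (m - (2 * t - 1) * d)| =
        m - (2 * t - 1) * d := by
      intro t ht ht1
      rw [abs_mul, hga, one_mul, abs_of_nonneg (by linarith [hτ t ht ht1])]
    refine isGoodArc_affine ?_ (fun t ht => ?_) (fun t ht => ?_) (-1) 2 fun t ht => ?_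
    · intro h
      have := congrArg Complex.re h
      simp at this
      linarith
    · obtain ⟨τ0, τ1⟩ := hτ t ht.1.1 ht.1.2
      have e := habs t ht.1.1 ht.1.2
      refine ⟨mem_cutPlane_of_im (fun h => ?_) ?_, le_norm_sub_and_add_I (Or.inr (Or.inr ?_))⟩
      · rw [him] at h
        rw [h, abs_zero] at e
        linarith
      · rw [him, e]; linarith
      · rw [him, e]; linarith
    · obtain ⟨τ0, τ1⟩ := hτ t ht.1.le ht.2.le
      have e : g * (g * (m - (2 * t - 1) * d)) = m - (2 * t - 1) * d := by
        rw [← mul_assoc, hgg, one_mul]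
      have h := diagonal_nonneg hδ hδ1 (z := ((d : ℝ) + (g * (m + d) : ℝ) * Complex.I) +
        (t : ℂ) * (-((2 * d : ℝ) * (1 + g * Complex.I)))) (by rw [hre]; linarith) hg
        (by rw [him, e]; linarith)
        (by
          rw [hre, him, e]
          have : δ / 16 * y ≤ δ / 16 * (m - (2 * t - 1) * d) := by
            gcongr; linarith
          linarith)
        (by rw [him, e]; linarith) (k := 2 * d) (by positivity)
      rw [mul_neg, Complex.neg_re]
      linarith
    -- The diagonal piece is short, as `d < δ/16`; the comparison function `-1 + 2t` has values in
    -- `[0, 1]` here, so `2/(1+f²) ≥ 1` suffices.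
    · have hn : ‖-((2 * d : ℝ) * (1 + g * Complex.I))‖ ≤ 1 := by
        rw [norm_neg, norm_mul, Complex.norm_real, Real.norm_eq_abs, abs_of_pos (by positivity)]
        have h3 : ‖(1 : ℂ) + g * Complex.I‖ ≤ 2 := by
          refine (norm_add_le _ _).trans ?_
          rw [norm_one, norm_mul, Complex.norm_I, Complex.norm_real, Real.norm_eq_abs, hga]
          norm_num
        nlinarith [norm_nonneg ((1 : ℂ) + g * Complex.I)]
      have h4 : (-1 + t * 2) ^ 2 ≤ 1 := by nlinarith [ht.1, ht.2]
      rw [div_le_div_iff₀ (by positivity) (by positivity)]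
      nlinarith [norm_nonneg (-((2 * d : ℝ) * (1 + g * Complex.I))), sq_nonneg (-1 + t * 2),
        sq_nonneg ‖((d : ℝ) + (g * (m + d) : ℝ) * Complex.I) +
          (t : ℂ) * (-((2 * d : ℝ) * (1 + g * Complex.I)))‖]
  have hb := isBoundedPath_glue (by positivity) h1 h2 (by push_cast; ring)
  have hend : ((d : ℝ) + (g * (m + d) : ℝ) * Complex.I) +
      ((1 : ℝ) : ℂ) * (-((2 * d : ℝ) * (1 + g * Complex.I))) = z := by
    apply Complex.ext
    · simp; linarith
    · simp; linarith
  rw [hend] at hb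
  refine ⟨_, ?_, hb⟩
  refine (tendsto_re_add_inv ((-2 : ℝ) + (g * m : ℝ) * Complex.I)).congr' ?_
  filter_upwards [Ioo_mem_nhdsGT (show (0 : ℝ) < 1 / 2 by norm_num)] with t ht
  rw [glue_of_le _ _ ht.2.le]

lemma exists_path_domainK {δ : ℝ} (hδ : 0 < δ) (hδ1 : δ ≤ 1) {z : ℂ} (hz : z ∈ domainK δ) :
    ∃ γ : ℝ → ℂ, IsProgressiveFromInfinity γ z ∧
      IsBoundedPath (-1) (1 + 2 / (δ / 16)) (lengthBound (δ / 16)) γ z := by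
  obtain ⟨γ, h0, h⟩ : ∃ γ : ℝ → ℂ,
      Filter.Tendsto (fun t => (γ t).re) (nhdsWithin 0 (Set.Ioi 0)) Filter.atTop ∧
      IsBoundedPath (-1) (1 + 2 / (δ / 16)) (lengthBound (δ / 16)) γ z := by
    by_cases hxy : 0 ≤ z.re ∨ 1 < |z.im|
    · exact exists_path_horizontal hδ hz hxy
    · push Not at hxy
      rcases hz with hz | ⟨h1, h2, h3⟩
      · have hz : δ / 16 < z.re := hz
        linarith
      · refine exists_path_bent hδ hδ1 hxy.1 h1 h2 ?_
        rw [abs_of_nonpos (by linarith)] at h3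
        linarith
  refine ⟨γ, ⟨h.arcChain, h0, fun s hs t ht hst => ?_⟩, h⟩
  have := h.mono hs ht hst
  simp only at this ⊢
  linarith

lemma exists_domainI {δ : ℝ} (hδ : 0 < δ) : ∃ (D : Set ℂ) (Γ : ℂ → ℝ → ℂ),
    IsOpen D ∧ IsConnected D ∧ ¬ Bornology.IsBounded D ∧ halfPlaneI δ ⊆ D ∧
    (∀ z ∈ D, IsProgressiveFromZero (Γ z) z) ∧
    ∀ N : ℕ, 1 ≤ N → ∀ ν₀ : ℝ, 0 < ν₀ → ∃ M : ℝ, ∀ ν : ℝ, ν₀ ≤ ν → ∀ z ∈ D,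
      omegaErr N ν (Γ z) ≤ M ∧ varpiErr N ν (Γ z) ≤ M := by
  -- The path constructions assume `δ ≤ 1`. Decreasing `δ` only enlarges the set the domain must
  -- contain.
  have hε : 0 < min δ 1 := lt_min hδ one_pos
  choose! Γ hΓ using fun z (hz : z ∈ domainI (min δ 1)) =>
    exists_path_domainI hε (min_le_right _ _) hz
  refine ⟨domainI (min δ 1), Γ, isOpen_domainI _, (isConnected_domainI _).1,
    (isConnected_domainI _).2, ?_, fun z hz => (hΓ z hz).1, fun N _ ν₀ hν₀ => ?_⟩
  · refine Set.Subset.trans ?_ (halfPlaneI_subset_domainI hε)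
    exact fun z hz => ⟨hz.1, hz.2.1, fun y hy => (min_le_left _ _).trans (hz.2.2 y hy)⟩
  · obtain ⟨M, hM⟩ := exists_uniform_bound 1 (1 + 2 / (min δ 1 / 2)) (lengthBound (min δ 1 / 2)) N
      hν₀
    exact ⟨M, fun ν hν z hz => hM ν hν _ _ (hΓ z hz).2⟩

lemma exists_domainK {δ : ℝ} (hδ : 0 < δ) : ∃ (D : Set ℂ) (Γ : ℂ → ℝ → ℂ),
    IsOpen D ∧ IsConnected D ∧ ¬ Bornology.IsBounded D ∧ halfPlaneK δ ⊆ D ∧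
    (∀ z ∈ D, IsProgressiveFromInfinity (Γ z) z) ∧
    ∀ N : ℕ, 1 ≤ N → ∀ ν₀ : ℝ, 0 < ν₀ → ∃ M : ℝ, ∀ ν : ℝ, ν₀ ≤ ν → ∀ z ∈ D,
      omegaErr N ν (Γ z) ≤ M ∧ varpiErr N ν (Γ z) ≤ M := by
  have hε : 0 < min δ 1 := lt_min hδ one_pos
  choose! Γ hΓ using fun z (hz : z ∈ domainK (min δ 1)) =>
    exists_path_domainK hε (min_le_right _ _) hz
  refine ⟨domainK (min δ 1), Γ, isOpen_domainK _, (isConnected_domainK _).1,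
    (isConnected_domainK _).2, ?_, fun z hz => (hΓ z hz).1, fun N _ ν₀ hν₀ => ?_⟩
  · refine Set.Subset.trans ?_ (halfPlaneK_subset_domainK hε)
    exact fun z hz => ⟨hz.1, hz.2.1, (min_le_left _ _).trans hz.2.2.1,
      (min_le_left _ _).trans hz.2.2.2⟩
  · obtain ⟨M, hM⟩ := exists_uniform_bound (-1) (1 + 2 / (min δ 1 / 16))
      (lengthBound (min δ 1 / 16)) N hν₀
    exact ⟨M, fun ν hν z hz => hM ν hν _ _ (hΓ z hz).2⟩

end

end BesselLG

theorem mainTheorem5 :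
    -- the coefficients are polynomials (with real coefficients), and `k_s = Ẽ_s(1)`
    (∀ s : ℕ, 1 ≤ s →
      (∃ P : Polynomial ℝ, ∀ p : ℂ, Etilde s p = Polynomial.aeval p P) ∧
      Etilde s 1 = (kConst s : ℂ)) ∧
    -- the expansions and their error bounds, along every progressive path
    (∀ ν : ℝ, 0 < ν → ∃ η₁ η₂ : ℕ → ℂ → ℂ, ∀ n : ℕ, 1 ≤ n → ∀ z ∈ cutPlane,
      (besselI ν (ν * z) =
          ((ν ^ ν / (Real.exp ν * Real.Gamma (ν + 1)) : ℝ) : ℂ) / fourthRootBr z *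
            Complex.exp (ν * xi z +
              ∑ s ∈ Finset.Ico 1 n, (Etilde s (pVar z) - kConst s) / (ν : ℂ) ^ s) *
            (1 + η₁ n z) ∧
        ∀ r : ℕ, ∀ γ : ℝ → ℂ, IsProgressiveFromZero γ z →
          ‖η₁ n z‖ ≤
            ‖Complex.exp (∑ s ∈ Finset.Ico n (n + r),
                (Etilde s (pVar z) - kConst s) / (ν : ℂ) ^ s) - 1‖ +
            omegaErr (n + r) ν γ / ν ^ (n + r) *
              Real.exp (varpiErr (n + r) ν γ / ν +
                ∑ s ∈ Finset.Ico n (n + r), ((Etilde s (pVar z)).re - kConst s) / ν ^ s +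
                omegaErr (n + r) ν γ / ν ^ (n + r))) ∧
      (besselK ν (ν * z) =
          ((Real.sqrt (Real.pi / (2 * ν)) : ℝ) : ℂ) / fourthRootBr z *
            Complex.exp (-(ν * xi z) +
              ∑ s ∈ Finset.Ico 1 n, (-1) ^ s * (Etilde s (pVar z) / (ν : ℂ) ^ s)) *
            (1 + η₂ n z) ∧
        ∀ r : ℕ, ∀ γ : ℝ → ℂ, IsProgressiveFromInfinity γ z →
          ‖η₂ n z‖ ≤
            ‖Complex.exp (∑ s ∈ Finset.Ico n (n + r),
                (-1) ^ s * (Etilde s (pVar z) / (ν : ℂ) ^ s)) - 1‖ +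
            omegaErr (n + r) ν γ / ν ^ (n + r) *
              Real.exp (varpiErr (n + r) ν γ / ν +
                ∑ s ∈ Finset.Ico n (n + r), (-1) ^ s * ((Etilde s (pVar z)).re / ν ^ s) +
                omegaErr (n + r) ν γ / ν ^ (n + r)))) ∧
    -- the domain of uniform validity of the bound for `I_ν`
    (∀ δ : ℝ, 0 < δ → ∃ (D : Set ℂ) (Γ : ℂ → ℝ → ℂ),
      IsOpen D ∧ IsConnected D ∧ ¬ Bornology.IsBounded D ∧ halfPlaneI δ ⊆ D ∧
      (∀ z ∈ D, IsProgressiveFromZero (Γ z) z) ∧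
      ∀ N : ℕ, 1 ≤ N → ∀ ν₀ : ℝ, 0 < ν₀ → ∃ M : ℝ, ∀ ν : ℝ, ν₀ ≤ ν → ∀ z ∈ D,
        omegaErr N ν (Γ z) ≤ M ∧ varpiErr N ν (Γ z) ≤ M) ∧
    -- the domain of uniform validity of the bound for `K_ν`
    (∀ δ : ℝ, 0 < δ → ∃ (D : Set ℂ) (Γ : ℂ → ℝ → ℂ),
      IsOpen D ∧ IsConnected D ∧ ¬ Bornology.IsBounded D ∧ halfPlaneK δ ⊆ D ∧
      (∀ z ∈ D, IsProgressiveFromInfinity (Γ z) z) ∧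
      ∀ N : ℕ, 1 ≤ N → ∀ ν₀ : ℝ, 0 < ν₀ → ∃ M : ℝ, ∀ ν : ℝ, ν₀ ≤ ν → ∀ z ∈ D,
        omegaErr N ν (Γ z) ≤ M ∧ varpiErr N ν (Γ z) ≤ M) := by
  refine ⟨fun s _ => ⟨⟨Epoly s, Etilde_eq s⟩, Etilde_one s⟩, fun ν hν => ?_,
    fun δ hδ => exists_domainI hδ, fun δ hδ => exists_domainK hδ⟩
  obtain ⟨η₁, h₁⟩ := besselI_expansion hν
  obtain ⟨η₂, h₂⟩ := besselK_expansion hν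
  exact ⟨η₁, η₂, fun n hn z hz => ⟨h₁ n hn z hz, h₂ n hn z hz⟩⟩
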